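/- Let $k\ge 1$. There is an order of smoothness $m=m(k)$ such that the following holds. Let $1<\alpha<2$, $\varepsilon,\beta,T>0$, $a<b$, $\rho\in\mathbb R$, let $f\in C^3(\mathbb R)$, and let $\hat f$ be a monotone numerical flux for $f$ (locally Lipschitz on $\mathbb R^2$, $\hat f(c,c)=f(c)$, non-decreasing in its first and non-increasing in its second argument). Put $$I_L^s w(x)=\tfrac1{\Gamma(s)}\int_{-\infty}^x (x-y)^{s-1}w(y)\,dy,\qquad I_R^s w(x)=\tfrac1{\Gamma(s)}\int_x^{\infty}(y-x)^{s-1}w(y)\,dy,$$ $$-(-\Delta)^{\alpha/2}w=-\frac{\frac{d^2}{dx^2}I_L^{2-\alpha}w+\frac{d^2}{dx^2}I_R^{2-\alpha}w}{2\cos(\alpha\pi/2)},\qquad \Delta_{-s/2}w=\frac{I_L^s w+I_R^s w}{2\cos(s\pi/2)}\quad(0<s<1).$$ Let $u$ be of class $C^m$ on $\mathbb R\times[0,T]$, zero for $x\notin[a,b]$, and an exact solution of $$u_t+f(u)_x=\varepsilon\,\bigl(-(-\Delta)^{\alpha/2}\bigr)u+g\ \text{ in }(a,b)\times(0,T),\qquad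 u(\cdot,0)=u_0,$$ where $g$ is a given source term ($g=0$ allowed). For a partition $a=x_{1/2}<\dots<x_{K+1/2}=b$ with cells $I_j=[x_{j-1/2},x_{j+1/2}]$ of lengths $\Delta x_j$, let $h=\max_j\Delta x_j$ and let $V_h$ be the space of functions that are polynomials of degree at most $k$ on each cell (extended by zero outside $[a,b]$). The semi-discrete LDG scheme seeks $u_h,p_h,q_h$ with values in $V_h$, $u_h$ continuous on $[0,T]$ and differentiable in $t$ on $(0,T)$, such that for all cells $I_j$, all $v,w,z\in V_h$ and all $t\in(0,T)$ $$((u_h)_t,v)_{I_j}+(\hat f_h-\sqrt\varepsilon\,\hat q_h)v\big|_{x_{j-1/2}^+}^{x_{j+1/2}^-}-(f(u_h)-\sqrt\varepsilon\,q_h,v_x)_{I_j}=(g,v)_{I_j},$$ $$(q_h,w)_{I_j}-(\Delta_{(\alpha-2)/2}p_h,w)_{I_j}=0,\qquad (p_h,z)_{I_j}-\sqrt\varepsilon\,\hat u_h z\big|_{x_{j-1/2}^+}^{x_{j+1/2}^-}+\sqrt\varepsilon\,(u_h,z_x)_{I_j}=0,$$ and $(u_h(\cdot,0),v)_{I_j}=(u_0,v)_{I_j}$.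 Here $\hat f_h=\hat f(u_h^-,u_h^+)$ at every node, with the exterior traces of $u_h$ at $a$ and $b$ equal to $0$, and $\hat u_h,\hat q_h$ are either of the two alternating choices: 1. $\hat u_h=u_h^-$, $\hat q_h=q_h^+$ at all nodes but $b$; at $b$, $\hat u_h=0$ and $\hat q_h=q_h^-+\frac\beta h(u_h^+-u_h^-)=q_h^--\frac\beta h u_h^-$; 2. $\hat u_h=u_h^+$, $\hat q_h=q_h^-$ at all nodes but $a$; at $a$, $\hat u_h=0$ and $\hat q_h=q_h^++\frac\beta h(u_h^+-u_h^-)=q_h^++\frac\beta h u_h^+$ (so $\hat u_h=0$ at both $a$ and $b$). Then there are constants $C,h_0>0$, independent of the partition and of $h$, such that for every partition with $h<h_0$ that is quasi-uniform in the sense that $h\le\rho\,\Delta x_j$ for all $j$, and for every solution $(u_h,p_h,q_h)$ of the scheme on $[0,T]$, $$\|u(\cdot,t)-u_h(\cdot,t)\|_{L^2(a,b)}\le C\,h^{k+\frac12}\qquad\text{for all }t\in[0,T].$$ -/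

import Mathlib

open MeasureTheory Set Polynomial

namespace LDG

noncomputable section

/-- Left fractional integral of order `s` on the line. -/
def leftFracInt (s : ℝ) (w : ℝ → ℝ) (x : ℝ) : ℝ :=
  1 / Real.Gamma s * ∫ y in Iio x, (x - y) ^ (s - 1) * w y

/-- Right fractional integral of order `s` on the line. -/
def rightFracInt (s : ℝ) (w : ℝ → ℝ) (x : ℝ) : ℝ :=
  1 / Real.Gamma s * ∫ y in Ioi x, (y - x) ^ (s - 1) * w y

/-- Left Riemann–Liouville derivative of order `α`, for `1 < α < 2`. -/
def leftRLDeriv (α : ℝ) (w : ℝ → ℝ) (x : ℝ) : ℝ :=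
  iteratedDeriv 2 (leftFracInt (2 - α) w) x

/-- Right Riemann–Liouville derivative of order `α`, for `1 < α < 2`
(the two signs in `(-d/dx)²` cancel). -/
def rightRLDeriv (α : ℝ) (w : ℝ → ℝ) (x : ℝ) : ℝ :=
  iteratedDeriv 2 (rightFracInt (2 - α) w) x

/-- The operator `-(-Δ)^{α/2}` for `1 < α < 2`, as a Riesz derivative. -/
def negFracLap (α : ℝ) (w : ℝ → ℝ) (x : ℝ) : ℝ :=
  -(leftRLDeriv α w x + rightRLDeriv α w x) / (2 * Real.cos (α * Real.pi / 2))

/-- The fractional integral operator `Δ_{-s/2}` for `0 < s < 1`. -/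
def rieszInt (s : ℝ) (w : ℝ → ℝ) (x : ℝ) : ℝ :=
  (leftFracInt s w x + rightFracInt s w x) / (2 * Real.cos (s * Real.pi / 2))

/-- `u` (space first, time second) is an exact solution, of class `C^m` on `ℝ × [0,T]` and vanishing
for `x` outside `[a,b]`, of `u_t + f(u)_x = ε (-(-Δ)^{α/2}) u + g` in `(a,b) × (0,T)`,
`u(·,0) = u₀`. -/
structure IsExactSolution (m : ℕ) (α ε a b T : ℝ) (f : ℝ → ℝ) (g : ℝ → ℝ → ℝ) (u₀ : ℝ → ℝ)
    (u : ℝ → ℝ → ℝ) : Prop where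
  smooth : ContDiffOn ℝ m (Function.uncurry u) (univ ×ˢ Icc 0 T)
  support : ∀ t ∈ Icc 0 T, ∀ x ∉ Icc a b, u x t = 0
  equation : ∀ t ∈ Ioo 0 T, ∀ x ∈ Ioo a b,
    deriv (fun τ => u x τ) t + deriv (fun y => f (u y t)) x
      = ε * negFracLap α (fun y => u y t) x + g x t
  initial : ∀ x, u x 0 = u₀ x

/-- `F (u⁻, u⁺)` is a monotone numerical flux consistent with `f`. -/
structure IsMonotoneFlux (f : ℝ → ℝ) (F : ℝ → ℝ → ℝ) : Prop where
  lipschitz : LocallyLipschitz (Function.uncurry F)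
  consistent : ∀ c, F c c = f c
  mono_left : ∀ c, Monotone (fun c' => F c' c)
  anti_right : ∀ c, Antitone (fun c' => F c c')

/-- A partition of `[a,b]` into `K` cells; cell `j` is `[node j, node (j+1)]`. -/
structure Mesh (a b : ℝ) where
  K : ℕ
  node : Fin (K + 1) → ℝ
  strictMono : StrictMono node
  node_zero : node 0 = a
  node_last : node (Fin.last K) = b

namespace Mesh

variable {a b : ℝ} (M : Mesh a b)

/-- Length of cell `j`. -/
def width (j : Fin M.K) : ℝ := M.node j.succ - M.node j.castSucc

/-- The mesh size `h`, the largest length of a cell. -/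
def size : ℝ := ⨆ j, M.width j

/-- The function on `ℝ` given by the polynomial `P j` on cell `j`, and by zero outside `[a,b)`. -/
def toFun (P : Fin M.K → ℝ[X]) (x : ℝ) : ℝ :=
  ∑ j, (Ico (M.node j.castSucc) (M.node j.succ)).indicator (fun y => (P j).eval y) x

/-- Trace from the left at node `i`; at the first node it is the exterior value zero. -/
def traceL (P : Fin M.K → ℝ[X]) (i : Fin (M.K + 1)) : ℝ :=
  Fin.cases (motive := fun _ => ℝ) 0 (fun j => (P j).eval (M.node j.succ)) i

/-- Trace from the right at node `i`; at the last node it is the exterior value zero. -/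
def traceR (P : Fin M.K → ℝ[X]) (i : Fin (M.K + 1)) : ℝ :=
  Fin.lastCases (motive := fun _ => ℝ) 0 (fun j => (P j).eval (M.node j.castSucc)) i

/-- Integral over cell `j`. -/
def cellInt (j : Fin M.K) (φ : ℝ → ℝ) : ℝ :=
  ∫ x in (M.node j.castSucc)..(M.node j.succ), φ x

/-- Boundary term `(φ v)` at the right end of cell `j`, minus the same at the left end, where `φ` is
a quantity given at the nodes. -/
def cellBdry (j : Fin M.K) (φ : Fin (M.K + 1) → ℝ) (v : ℝ[X]) : ℝ :=
  φ j.succ * v.eval (M.node j.succ) - φ j.castSucc * v.eval (M.node j.castSucc)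

end Mesh

/-- The two alternating choices: `û = u⁻, q̂ = q⁺` or `û = u⁺, q̂ = q⁻` at interior nodes. -/
inductive Direction where
  | minusPlus
  | plusMinus

/-- The flux `û`; at both ends of the domain it is the boundary value zero. -/
def uHat {a b : ℝ} (M : Mesh a b) (d : Direction) (U : Fin M.K → ℝ[X])
    (i : Fin (M.K + 1)) : ℝ :=
  match d with
  | .minusPlus => if i = Fin.last M.K then 0 else M.traceL U i
  | .plusMinus => if i = 0 then 0 else M.traceR U i

/-- The flux `q̂`. For the first choice it has the penalty `(β/h)(u⁺ - u⁻)` at the right end, for the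
second choice at the left end (the exterior trace of `u` being zero there); at an end of the domain
the interior trace of `q` is used. -/
def qHat {a b : ℝ} (M : Mesh a b) (d : Direction) (β : ℝ) (U Q : Fin M.K → ℝ[X])
    (i : Fin (M.K + 1)) : ℝ :=
  match d with
  | .minusPlus =>
      if i = Fin.last M.K then M.traceL Q i + β / M.size * (M.traceR U i - M.traceL U i)
      else M.traceR Q i
  | .plusMinus =>
      if i = 0 then M.traceR Q i + β / M.size * (M.traceR U i - M.traceL U i)
      else M.traceL Q i

/-- The flux `f̂`, with exterior trace zero at both ends of the domain. -/
def fHat {a b : ℝ} (M : Mesh a b) (F : ℝ → ℝ → ℝ) (U : Fin M.K → ℝ[X])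
    (i : Fin (M.K + 1)) : ℝ :=
  F (M.traceL U i) (M.traceR U i)

/-- `U t`, `P t`, `Q t` (piecewise polynomials of degree at most `k`) are the functions
`u_h, p_h, q_h` of a solution on `[0,T]` of the semi-discrete LDG scheme, and `U' t` is the time
derivative of `U t`. -/
structure IsLDGSolution {a b : ℝ} (M : Mesh a b) (k : ℕ) (d : Direction) (α ε β T : ℝ)
    (f : ℝ → ℝ) (F : ℝ → ℝ → ℝ) (g : ℝ → ℝ → ℝ) (u₀ : ℝ → ℝ)
    (U U' P Q : ℝ → Fin M.K → ℝ[X]) : Prop where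
  degree_U : ∀ t j, (U t j).natDegree ≤ k
  degree_U' : ∀ t j, (U' t j).natDegree ≤ k
  degree_P : ∀ t j, (P t j).natDegree ≤ k
  degree_Q : ∀ t j, (Q t j).natDegree ≤ k
  continuousOn : ∀ j x, ContinuousOn (fun t => (U t j).eval x) (Icc 0 T)
  hasDerivAt : ∀ t ∈ Ioo 0 T, ∀ j x, HasDerivAt (fun τ => (U τ j).eval x) ((U' t j).eval x) t
  eq_u : ∀ t ∈ Ioo 0 T, ∀ j, ∀ v : ℝ[X], v.natDegree ≤ k →
    M.cellInt j (fun x => (U' t j).eval x * v.eval x)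
      + M.cellBdry j (fun i => fHat M F (U t) i - √ε * qHat M d β (U t) (Q t) i) v
      - M.cellInt j (fun x => (f ((U t j).eval x) - √ε * (Q t j).eval x) * v.derivative.eval x)
      = M.cellInt j (fun x => g x t * v.eval x)
  eq_q : ∀ t ∈ Ioo 0 T, ∀ j, ∀ w : ℝ[X], w.natDegree ≤ k →
    M.cellInt j (fun x => (Q t j).eval x * w.eval x)
      - M.cellInt j (fun x => rieszInt (2 - α) (M.toFun (P t)) x * w.eval x) = 0
  eq_p : ∀ t ∈ Ioo 0 T, ∀ j, ∀ z : ℝ[X], z.natDegree ≤ k →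
    M.cellInt j (fun x => (P t j).eval x * z.eval x)
      - √ε * M.cellBdry j (uHat M d (U t)) z
      + √ε * M.cellInt j (fun x => (U t j).eval x * z.derivative.eval x) = 0
  initial : ∀ j, ∀ v : ℝ[X], v.natDegree ≤ k →
    M.cellInt j (fun x => (U 0 j).eval x * v.eval x) - M.cellInt j (fun x => u₀ x * v.eval x) = 0

end

end LDG

namespace LDG
noncomputable section

/-! ### Polynomials of bounded degree on an interval -/

/-- The polynomial with coefficient vector `v`. -/
def polyOf {n : ℕ} (v : Fin n → ℝ) : ℝ[X] := ∑ i, C (v i) * X ^ (i : ℕ)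

lemma eval_polyOf {n : ℕ} (v : Fin n → ℝ) (y : ℝ) :
    (polyOf v).eval y = ∑ i, v i * y ^ (i : ℕ) := by
  simp [polyOf, eval_finsetSum]

lemma natDegree_polyOf_le {k : ℕ} (v : Fin (k + 1) → ℝ) : (polyOf v).natDegree ≤ k := by
  refine natDegree_sum_le_of_forall_le _ _ fun i _ => ?_
  exact (natDegree_C_mul_X_pow_le _ _).trans (Nat.lt_succ_iff.mp i.2)

lemma polyOf_coeff {k : ℕ} {p : ℝ[X]} (hp : p.natDegree ≤ k) :
    polyOf (fun i : Fin (k + 1) => p.coeff i) = p := by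
  conv_rhs => rw [p.as_sum_range_C_mul_X_pow' (Nat.lt_succ_iff.mpr hp)]
  rw [polyOf, Finset.sum_range]

lemma coeff_polyOf {n : ℕ} (v : Fin n → ℝ) (i : Fin n) : (polyOf v).coeff i = v i := by
  simp only [polyOf, finsetSum_coeff, coeff_C_mul, coeff_X_pow]
  rw [Finset.sum_eq_single i] <;> simp +contextual [Fin.ext_iff, eq_comm]

lemma polyOf_ne_zero {n : ℕ} {v : Fin n → ℝ} (hv : v ≠ 0) : polyOf v ≠ 0 := by
  intro h
  refine hv (funext fun i => ?_)
  rw [← coeff_polyOf v i, h]; simp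

lemma continuous_eval_polyOf {n : ℕ} :
    Continuous (fun z : (Fin n → ℝ) × ℝ => (polyOf z.1).eval z.2) := by
  simp only [eval_polyOf]; fun_prop

lemma exists_norm_sq_le_of_posDef {n : ℕ} (q : (Fin n → ℝ) → ℝ) (hc : Continuous q)
    (hh : ∀ (t : ℝ) v, q (t • v) = t ^ 2 * q v) (hp : ∀ v, v ≠ 0 → 0 < q v) :
    ∃ K : ℝ, 0 < K ∧ ∀ v, ‖v‖ ^ 2 ≤ K * q v := by
  rcases (Metric.sphere (0 : Fin n → ℝ) 1).eq_empty_or_nonempty with h | h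
  · refine ⟨1, one_pos, fun v => ?_⟩
    by_cases hv : v = 0
    · subst hv
      have := hh 0 0
      simp at this
      simp [this]
    · exfalso
      have : ‖v‖⁻¹ • v ∈ Metric.sphere (0 : Fin n → ℝ) 1 := by
        simp [norm_smul, norm_ne_zero_iff.mpr hv]
      rw [h] at this; exact this
  · obtain ⟨v₀, hv₀, hmin⟩ := (isCompact_sphere (0 : Fin n → ℝ) 1).exists_isMinOn h hc.continuousOn
    have hv₀0 : v₀ ≠ 0 := by
      rintro rfl; simp at hv₀
    have hq := hp v₀ hv₀0
    refine ⟨(q v₀)⁻¹, inv_pos.mpr hq, fun v => ?_⟩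
    by_cases hv : v = 0
    · subst hv
      have := hh 0 0
      simp at this
      simp [this]
    · have hn : 0 < ‖v‖ := norm_pos_iff.mpr hv
      have hs : ‖v‖⁻¹ • v ∈ Metric.sphere (0 : Fin n → ℝ) 1 := by
        simp [norm_smul, hn.ne']
      have h1 : q v₀ ≤ q (‖v‖⁻¹ • v) := hmin hs
      rw [hh] at h1
      have h2 : q v = ‖v‖ ^ 2 * (‖v‖⁻¹ ^ 2 * q v) := by field_simp
      rw [h2, ← mul_assoc, mul_comm _ (‖v‖ ^ 2), mul_assoc]
      have : 1 ≤ (q v₀)⁻¹ * (‖v‖⁻¹ ^ 2 * q v) := by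
        rw [inv_mul_eq_div, le_div_iff₀ hq]; linarith
      nlinarith [sq_nonneg ‖v‖]

/-- A positive definite quadratic form on polynomials of degree at most `k` dominates the
values on `[0,1]`. -/
lemma exists_eval_sq_le_of_posDef (k : ℕ) (φ : ℝ[X] → ℝ)
    (hc : Continuous fun v : Fin (k + 1) → ℝ => φ (polyOf v))
    (hh : ∀ (t : ℝ) p, φ (C t * p) = t ^ 2 * φ p)
    (hp : ∀ p : ℝ[X], p ≠ 0 → 0 < φ p) :
    ∃ K : ℝ, 0 < K ∧ ∀ p : ℝ[X], p.natDegree ≤ k → ∀ y ∈ Icc (0 : ℝ) 1,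
      p.eval y ^ 2 ≤ K * φ p := by
  obtain ⟨K, hK, h⟩ := exists_norm_sq_le_of_posDef (fun v : Fin (k + 1) → ℝ => φ (polyOf v)) hc
    (fun t v => by
      rw [← hh]
      congr 1
      simp [polyOf, Finset.mul_sum, mul_assoc])
    (fun v hv => hp _ (polyOf_ne_zero hv))
  refine ⟨(k + 1) ^ 2 * K, by positivity, fun p hpk y hy => ?_⟩
  have h1 := h (fun i => p.coeff i)
  simp only [polyOf_coeff hpk] at h1
  have h2 : |p.eval y| ≤ (k + 1) * ‖(fun i : Fin (k + 1) => p.coeff i)‖ := by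
    conv_lhs => rw [← polyOf_coeff hpk, eval_polyOf]
    refine (Finset.abs_sum_le_sum_abs _ _).trans ?_
    refine (Finset.sum_le_card_nsmul _ _ ‖(fun i : Fin (k + 1) => p.coeff i)‖ fun i _ => ?_).trans
      (by simp)
    rw [abs_mul, abs_pow]
    have h3 : |y| ^ (i : ℕ) ≤ 1 := pow_le_one₀ (abs_nonneg _) (abs_le.mpr ⟨by linarith [hy.1], hy.2⟩)
    have h4 := norm_le_pi_norm (fun i : Fin (k + 1) => p.coeff i) i
    simp only [Real.norm_eq_abs] at h4
    calc _ ≤ |p.coeff i| * 1 := by gcongr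
      _ ≤ _ := by simpa using h4
  calc p.eval y ^ 2 = |p.eval y| ^ 2 := (sq_abs _).symm
    _ ≤ ((k + 1) * ‖(fun i : Fin (k + 1) => p.coeff i)‖) ^ 2 := by gcongr
    _ = (k + 1) ^ 2 * ‖(fun i : Fin (k + 1) => p.coeff i)‖ ^ 2 := by ring
    _ ≤ (k + 1) ^ 2 * (K * φ p) := by gcongr
    _ = _ := by ring

lemma eq_zero_of_eval_eq_zero_on {p : ℝ[X]} {l r : ℝ} (hlr : l < r)
    (h : ∀ x ∈ Ioo l r, p.eval x = 0) : p = 0 :=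
  Polynomial.eq_zero_of_infinite_isRoot p ((Ioo_infinite hlr).mono fun x hx => h x hx)

lemma integral_mul_sq_pos {p : ℝ[X]} (hp : p ≠ 0) {w : ℝ → ℝ} (hw : Continuous w) {l r : ℝ}
    (hlr : l < r) (hpos : ∀ x ∈ Ioo l r, 0 < w x) :
    0 < ∫ x in l..r, w x * p.eval x ^ 2 := by
  have hcont : Continuous fun x => w x * p.eval x ^ 2 := hw.mul (p.continuous.pow 2)
  have hnn : ∀ x ∈ Ioo l r, 0 ≤ w x * p.eval x ^ 2 := fun x hx =>
    mul_nonneg (hpos x hx).le (sq_nonneg _)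
  have hnn' : ∀ x ∈ Icc l r, 0 ≤ w x * p.eval x ^ 2 := by
    intro x hx
    have : x ∈ closure (Ioo l r) := by rwa [closure_Ioo hlr.ne]
    exact closure_minimal (t := {x | 0 ≤ w x * p.eval x ^ 2}) hnn
      (isClosed_le continuous_const hcont) this
  have hex : ∃ c ∈ Ioo l r, p.eval c ≠ 0 := by
    by_contra hcon
    push Not at hcon
    exact hp (eq_zero_of_eval_eq_zero_on hlr hcon)
  obtain ⟨c, hc, hc0⟩ := hex
  refine intervalIntegral.integral_pos hlr hcont.continuousOn
    (fun x hx => hnn' x ⟨hx.1.le, hx.2⟩) ⟨c, ⟨hc.1.le, hc.2.le⟩, ?_⟩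
  have := hpos c hc
  positivity

/-- The affine change of variable from `[l, l + h]` to `[0, 1]`. -/
def rescale (l h : ℝ) (p : ℝ[X]) : ℝ[X] := p.comp (C l + C h * X)

@[simp] lemma eval_rescale (l h : ℝ) (p : ℝ[X]) (y : ℝ) :
    (rescale l h p).eval y = p.eval (l + h * y) := by simp [rescale]

lemma natDegree_rescale_le (l h : ℝ) {p : ℝ[X]} {k : ℕ} (hp : p.natDegree ≤ k) :
    (rescale l h p).natDegree ≤ k := by
  have h1 : (C l + C h * X : ℝ[X]).natDegree ≤ 1 := by compute_degree
  calc _ ≤ p.natDegree * (C l + C h * X : ℝ[X]).natDegree := natDegree_comp_le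
    _ ≤ p.natDegree * 1 := by gcongr
    _ ≤ k := by simpa using hp

lemma integral_eq_smul_unit (g : ℝ → ℝ) (l r : ℝ) :
    ∫ x in l..r, g x = (r - l) * ∫ y in (0 : ℝ)..1, g (l + (r - l) * y) := by
  rw [intervalIntegral.mul_integral_comp_add_mul]; simp

lemma exists_unit_point {l r x : ℝ} (hlr : l < r) (hx : x ∈ Icc l r) :
    ∃ y ∈ Icc (0 : ℝ) 1, x = l + (r - l) * y := by
  have : 0 < r - l := sub_pos.mpr hlr
  refine ⟨(x - l) / (r - l), ⟨div_nonneg (by linarith [hx.1]) this.le, ?_⟩, by field_simp; ring⟩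
  rw [div_le_one this]; linarith [hx.2]

lemma exists_eval_sq_le_weight (k : ℕ) {w : ℝ → ℝ} (hw : Continuous w)
    (hpos : ∀ x ∈ Ioo (0 : ℝ) 1, 0 < w x) :
    ∃ K : ℝ, 0 < K ∧ ∀ p : ℝ[X], p.natDegree ≤ k → ∀ y ∈ Icc (0 : ℝ) 1,
      p.eval y ^ 2 ≤ K * ∫ x in (0 : ℝ)..1, w x * p.eval x ^ 2 := by
  refine exists_eval_sq_le_of_posDef k (fun p => ∫ x in (0 : ℝ)..1, w x * p.eval x ^ 2) ?_ ?_ ?_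
  · apply intervalIntegral.continuous_parametric_intervalIntegral_of_continuous'
    exact (hw.comp continuous_snd).mul (continuous_eval_polyOf.pow 2)
  · intro t p
    simp only [eval_mul, eval_C]
    rw [← intervalIntegral.integral_const_mul]
    congr 1; ext x; ring
  · exact fun p hp => integral_mul_sq_pos hp hw one_pos hpos

lemma exists_eval_sq_le_left (k : ℕ) :
    ∃ K : ℝ, 0 < K ∧ ∀ l r : ℝ, l < r → ∀ p : ℝ[X], p.natDegree ≤ k → ∀ x ∈ Icc l r,
      p.eval x ^ 2 * (r - l) ^ 2 ≤ K * ∫ x in l..r, (x - l) * p.eval x ^ 2 := by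
  obtain ⟨K, hK, h⟩ := exists_eval_sq_le_weight k (w := fun x => x) continuous_id (fun x hx => hx.1)
  refine ⟨K, hK, fun l r hlr p hp x hx => ?_⟩
  obtain ⟨y, hy, rfl⟩ := exists_unit_point hlr hx
  have := h (rescale l (r - l) p) (natDegree_rescale_le _ _ hp) y hy
  rw [integral_eq_smul_unit]
  simp only [eval_rescale] at this
  have h2 : ∀ y : ℝ, (l + (r - l) * y - l) * eval (l + (r - l) * y) p ^ 2
    = (r - l) * (y * eval (l + (r - l) * y) p ^ 2) := fun y => by ring
  simp only [h2, intervalIntegral.integral_const_mul]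
  nlinarith [mul_le_mul_of_nonneg_right this (sq_nonneg (r - l))]

lemma exists_eval_sq_le_right (k : ℕ) :
    ∃ K : ℝ, 0 < K ∧ ∀ l r : ℝ, l < r → ∀ p : ℝ[X], p.natDegree ≤ k → ∀ x ∈ Icc l r,
      p.eval x ^ 2 * (r - l) ^ 2 ≤ K * ∫ x in l..r, (r - x) * p.eval x ^ 2 := by
  obtain ⟨K, hK, h⟩ := exists_eval_sq_le_weight k (w := fun x => 1 - x) (by fun_prop)
    (fun x hx => sub_pos.mpr hx.2)
  refine ⟨K, hK, fun l r hlr p hp x hx => ?_⟩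
  obtain ⟨y, hy, rfl⟩ := exists_unit_point hlr hx
  have := h (rescale l (r - l) p) (natDegree_rescale_le _ _ hp) y hy
  rw [integral_eq_smul_unit]
  simp only [eval_rescale] at this
  have h2 : ∀ y : ℝ, (r - (l + (r - l) * y)) * eval (l + (r - l) * y) p ^ 2
    = (r - l) * ((1 - y) * eval (l + (r - l) * y) p ^ 2) := fun y => by ring
  simp only [h2, intervalIntegral.integral_const_mul]
  nlinarith [mul_le_mul_of_nonneg_right this (sq_nonneg (r - l))]

lemma exists_eval_sq_le (k : ℕ) :
    ∃ K : ℝ, 0 < K ∧ ∀ l r : ℝ, l < r → ∀ p : ℝ[X], p.natDegree ≤ k → ∀ x ∈ Icc l r,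
      p.eval x ^ 2 * (r - l) ≤ K * ∫ x in l..r, p.eval x ^ 2 := by
  obtain ⟨K, hK, h⟩ := exists_eval_sq_le_weight k (w := fun _ => 1) (by fun_prop)
    (fun x _ => one_pos)
  refine ⟨K, hK, fun l r hlr p hp x hx => ?_⟩
  obtain ⟨y, hy, rfl⟩ := exists_unit_point hlr hx
  have := h (rescale l (r - l) p) (natDegree_rescale_le _ _ hp) y hy
  rw [integral_eq_smul_unit]
  simp only [eval_rescale, one_mul] at this
  nlinarith [mul_le_mul_of_nonneg_right this (sub_pos.mpr hlr).le]

lemma integral_sq_window_pos {p : ℝ[X]} (hp : p ≠ 0) :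
    0 < ∫ x in (0 : ℝ)..1 / 2, ∫ y in (1 / 2 : ℝ)..1, (∫ z in x..y, p.eval z) ^ 2 := by
  have hP : Continuous fun z => p.eval z := p.continuous
  set A : ℝ → ℝ := fun y => ∫ z in (0 : ℝ)..y, p.eval z with hA
  have hAd : ∀ y, HasDerivAt A (p.eval y) y := fun y => hP.integral_hasStrictDerivAt 0 y |>.hasDerivAt
  have hAc : Continuous A := continuous_iff_continuousAt.mpr fun y => (hAd y).continuousAt
  have hsub : ∀ x y, ∫ z in x..y, p.eval z = A y - A x := fun x y =>
    (intervalIntegral.integral_interval_sub_left (hP.intervalIntegrable _ _)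
      (hP.intervalIntegrable _ _)).symm
  simp only [hsub]
  have hin : Continuous fun x => ∫ y in (1 / 2 : ℝ)..1, (A y - A x) ^ 2 := by
    apply intervalIntegral.continuous_parametric_intervalIntegral_of_continuous'
    exact ((hAc.comp continuous_snd).sub (hAc.comp continuous_fst)).pow 2
  refine intervalIntegral.integral_pos (by norm_num) hin.continuousOn
    (fun x _ => intervalIntegral.integral_nonneg (by norm_num) fun y _ => sq_nonneg _)
    ⟨0, by simp, ?_⟩
  refine intervalIntegral.integral_pos (by norm_num)
    ((hAc.sub continuous_const).pow 2).continuousOn (fun x _ => sq_nonneg _) ?_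
  by_contra hcon
  push Not at hcon
  refine hp (eq_zero_of_eval_eq_zero_on (by norm_num : (1 / 2 : ℝ) < 1) fun x hx => ?_)
  have hz : A =ᶠ[nhds x] fun _ => A 0 := by
    filter_upwards [isOpen_Ioo.mem_nhds hx] with y hy
    have := hcon y ⟨hy.1.le, hy.2.le⟩
    exact sub_eq_zero.mp (pow_eq_zero_iff two_ne_zero |>.mp (le_antisymm this (sq_nonneg _)))
  exact (hAd x).unique ((hasDerivAt_const x (A 0)).congr_of_eventuallyEq hz)

lemma exists_eval_sq_le_window (k : ℕ) :
    ∃ K : ℝ, 0 < K ∧ ∀ l r : ℝ, l < r → ∀ p : ℝ[X], p.natDegree ≤ k → ∀ x ∈ Icc l r,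
      p.eval x ^ 2 * (r - l) ^ 4
        ≤ K * ∫ x in l..(l + r) / 2, ∫ y in (l + r) / 2..r, (∫ z in x..y, p.eval z) ^ 2 := by
  obtain ⟨K, hK, h⟩ := exists_eval_sq_le_of_posDef k
    (fun p => ∫ x in (0 : ℝ)..1 / 2, ∫ y in (1 / 2 : ℝ)..1, (∫ z in x..y, p.eval z) ^ 2) (by
      apply intervalIntegral.continuous_parametric_intervalIntegral_of_continuous'
      apply intervalIntegral.continuous_parametric_intervalIntegral_of_continuous'
      apply Continuous.pow
      have h0 : ∀ w : ((Fin (k + 1) → ℝ) × ℝ) × ℝ, ∫ z in w.1.2..w.2, (polyOf w.1.1).eval z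
          = (∫ z in (0 : ℝ)..w.2, (polyOf w.1.1).eval z)
            - ∫ z in (0 : ℝ)..w.1.2, (polyOf w.1.1).eval z := fun w =>
        (intervalIntegral.integral_interval_sub_left
          ((polyOf w.1.1).continuous.intervalIntegrable _ _)
          ((polyOf w.1.1).continuous.intervalIntegrable _ _)).symm
      simp only [h0]
      have hc : Continuous fun z : (((Fin (k + 1) → ℝ) × ℝ) × ℝ) × ℝ => (polyOf z.1.1.1).eval z.2 :=
        continuous_eval_polyOf.comp
          ((continuous_fst.comp (continuous_fst.comp continuous_fst)).prodMk continuous_snd)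
      exact (intervalIntegral.continuous_parametric_intervalIntegral_of_continuous hc
        continuous_snd).sub
        (intervalIntegral.continuous_parametric_intervalIntegral_of_continuous hc
          (continuous_snd.comp continuous_fst)))
    (fun t p => by
      simp only [eval_mul, eval_C, intervalIntegral.integral_const_mul, mul_pow])
    (fun p hp => integral_sq_window_pos hp)
  refine ⟨K, hK, fun l r hlr p hp x hx => ?_⟩
  obtain ⟨y, hy, rfl⟩ := exists_unit_point hlr hx
  have := h (rescale l (r - l) p) (natDegree_rescale_le _ _ hp) y hy
  have hmid : (l + r) / 2 = l + (r - l) * (1 / 2) := by ring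
  have h0 : ∀ g : ℝ → ℝ, ∫ x in l..(l + r) / 2, g x
      = (r - l) * ∫ y in (0 : ℝ)..1 / 2, g (l + (r - l) * y) := fun g => by
    rw [intervalIntegral.mul_integral_comp_add_mul (f := g), hmid]; simp
  have h1 : ∀ g : ℝ → ℝ, ∫ x in (l + r) / 2..r, g x
      = (r - l) * ∫ y in (1 / 2 : ℝ)..1, g (l + (r - l) * y) := fun g => by
    rw [intervalIntegral.mul_integral_comp_add_mul (f := g), hmid]; simp
  simp only [h0, h1]
  have h2 : ∀ a b : ℝ, ∫ z in (l + (r - l) * a)..(l + (r - l) * b), p.eval z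
    = (r - l) * ∫ z in a..b, p.eval (l + (r - l) * z) := fun a b => by
      rw [intervalIntegral.mul_integral_comp_add_mul (f := fun z => p.eval z)]
  simp only [h2, mul_pow, intervalIntegral.integral_const_mul]
  simp only [eval_rescale] at this
  calc _ ≤ (K * ∫ x in (0 : ℝ)..1 / 2, ∫ y in (1 / 2 : ℝ)..1, (∫ z in x..y, p.eval (l + (r - l) * z)) ^ 2)
        * (r - l) ^ 4 := by gcongr
    _ = _ := by ring

end
end LDG

namespace LDG
noncomputable section

/-! ### Local projections and Taylor polynomials -/

/-- The functionals that determine a local projection on the unit interval: the moments of order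
less than `k`, and either the moment of order `k` or the value at a point. -/
def refMom (e : Option ℝ) (k i : ℕ) (w : ℝ → ℝ) : ℝ :=
  if i = k then e.elim (∫ y in (0 : ℝ)..1, w y * y ^ k) w else ∫ y in (0 : ℝ)..1, w y * y ^ i

lemma refMom_add (e : Option ℝ) (k i : ℕ) {v w : ℝ → ℝ} (hv : Continuous v) (hw : Continuous w) :
    refMom e k i (fun y => v y + w y) = refMom e k i v + refMom e k i w := by
  have h : ∀ i : ℕ, ∫ y in (0 : ℝ)..1, (v y + w y) * y ^ i
      = (∫ y in (0 : ℝ)..1, v y * y ^ i) + ∫ y in (0 : ℝ)..1, w y * y ^ i := fun i => by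
    rw [← intervalIntegral.integral_add (Continuous.intervalIntegrable (by fun_prop) _ _)
      (Continuous.intervalIntegrable (by fun_prop) _ _)]
    congr 1; ext y; ring
  unfold refMom
  split_ifs
  · cases e <;> simp [h]
  · exact h i

lemma refMom_smul (e : Option ℝ) (k i : ℕ) (c : ℝ) (v : ℝ → ℝ) :
    refMom e k i (fun y => c * v y) = c * refMom e k i v := by
  have h : ∀ i : ℕ, ∫ y in (0 : ℝ)..1, c * v y * y ^ i
      = c * ∫ y in (0 : ℝ)..1, v y * y ^ i := fun i => by
    rw [← intervalIntegral.integral_const_mul]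
    congr 1; ext y; ring
  unfold refMom
  split_ifs
  · cases e <;> simp [h]
  · exact h i

lemma abs_refMom_le {e : Option ℝ} (he : ∀ c, e = some c → c ∈ Icc (0 : ℝ) 1) (k i : ℕ)
    {v : ℝ → ℝ} {S : ℝ} (hS : ∀ y ∈ Icc (0 : ℝ) 1, |v y| ≤ S) : |refMom e k i v| ≤ S := by
  have hS0 : 0 ≤ S := (abs_nonneg _).trans (hS 0 (by simp))
  have h : ∀ i : ℕ, |∫ y in (0 : ℝ)..1, v y * y ^ i| ≤ S := fun i => by
    have := intervalIntegral.norm_integral_le_of_norm_le_const (a := 0) (b := 1) (C := S)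
      (f := fun y => v y * y ^ i) (fun y hy => by
        rw [uIoc_of_le zero_le_one] at hy
        rw [Real.norm_eq_abs, abs_mul, abs_pow, abs_of_pos hy.1]
        have h1 := hS y ⟨hy.1.le, hy.2⟩
        have h2 : y ^ i ≤ 1 := pow_le_one₀ hy.1.le hy.2
        nlinarith [pow_nonneg hy.1.le i])
    simpa using this
  unfold refMom
  split_ifs
  · cases e with
    | none => exact h k
    | some c => exact hS c (he c rfl)
  · exact h i

/-- The functionals vanish on a polynomial of degree at most `k` only if it is zero. -/
lemma eq_zero_of_refMom {e : Option ℝ} (he : e = none ∨ e = some 0 ∨ e = some 1) {k : ℕ}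
    {p : ℝ[X]} (hp : p.natDegree ≤ k) (h : ∀ i ≤ k, refMom e k i (fun y => p.eval y) = 0) :
    p = 0 := by
  have hlow : ∀ v : ℝ[X], v.natDegree < k → ∫ y in (0 : ℝ)..1, p.eval y * v.eval y = 0 := by
    intro v hv
    rw [v.as_sum_range_C_mul_X_pow' hv]
    simp only [eval_finsetSum, eval_mul, eval_C, eval_pow, eval_X, Finset.mul_sum]
    rw [intervalIntegral.integral_finsetSum fun i _ =>
      Continuous.intervalIntegrable (by fun_prop) _ _]
    refine Finset.sum_eq_zero fun i hi => ?_
    have hi' : i < k := Finset.mem_range.mp hi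
    have := h i hi'.le
    rw [refMom, if_neg hi'.ne] at this
    calc _ = ∫ y in (0 : ℝ)..1, v.coeff i * (p.eval y * y ^ i) := by congr 1; ext y; ring
      _ = 0 := by rw [intervalIntegral.integral_const_mul, this, mul_zero]
  by_contra hp0
  have hroot : ∀ c : ℝ, e = some c → ∃ v : ℝ[X], v ≠ 0 ∧ p = (X - C c) * v ∧
      ∫ y in (0 : ℝ)..1, (y - c) * v.eval y ^ 2 = 0 := by
    intro c hc
    have h1 := h k le_rfl
    rw [refMom, if_pos rfl, hc] at h1
    obtain ⟨v, hv⟩ := dvd_iff_isRoot.mpr (show p.IsRoot c from h1)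
    have hv0 : v ≠ 0 := by rintro rfl; exact hp0 (by simpa using hv)
    refine ⟨v, hv0, hv, ?_⟩
    have hd : v.natDegree < k := by
      have : p.natDegree = 1 + v.natDegree := by
        rw [hv, natDegree_mul (X_sub_C_ne_zero c) hv0, natDegree_X_sub_C]
      omega
    have h2 := hlow v hd
    rw [hv] at h2
    rw [← h2]
    congr 1; ext y; simp; ring
  rcases he with he | he | he
  · have hall : ∫ y in (0 : ℝ)..1, p.eval y * p.eval y = 0 := by
      conv_lhs =>
        enter [1, y, 2]
        rw [p.as_sum_range_C_mul_X_pow' (Nat.lt_succ_iff.mpr hp)]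
      simp only [eval_finsetSum, eval_mul, eval_C, eval_pow, eval_X, Finset.mul_sum]
      rw [intervalIntegral.integral_finsetSum fun i _ =>
        Continuous.intervalIntegrable (by fun_prop) _ _]
      refine Finset.sum_eq_zero fun i hi => ?_
      have hi' : i ≤ k := Nat.lt_succ_iff.mp (Finset.mem_range.mp hi)
      have := h i hi'
      have h2 : ∫ y in (0 : ℝ)..1, p.eval y * y ^ i = 0 := by
        rw [refMom, he] at this
        split_ifs at this with h3
        · subst h3; simpa using this
        · exact this
      calc _ = ∫ y in (0 : ℝ)..1, p.coeff i * (p.eval y * y ^ i) := by congr 1; ext y; ring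
        _ = 0 := by rw [intervalIntegral.integral_const_mul, h2, mul_zero]
    have := integral_mul_sq_pos hp0 (w := fun _ => 1) continuous_const one_pos fun _ _ => one_pos
    simp only [one_mul, sq] at this
    linarith
  · obtain ⟨v, hv0, -, hv⟩ := hroot 0 he
    have := integral_mul_sq_pos hv0 (w := fun y => y - 0) (by fun_prop) one_pos
      fun x hx => by simpa using hx.1
    linarith
  · obtain ⟨v, hv0, -, hv⟩ := hroot 1 he
    have := integral_mul_sq_pos hv0 (w := fun y => 1 - y) (by fun_prop) one_pos
      fun x hx => sub_pos.mpr hx.2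
    have h2 : ∫ y in (0 : ℝ)..1, (1 - y) * v.eval y ^ 2
        = -∫ y in (0 : ℝ)..1, (y - 1) * v.eval y ^ 2 := by
      rw [← intervalIntegral.integral_neg]; congr 1; ext y; ring
    linarith

/-- The family `B` of polynomials of degree at most `k` is dual to the functionals `refMom`. -/
structure IsDualBasis (e : Option ℝ) (k : ℕ) (B : Fin (k + 1) → ℝ[X]) : Prop where
  degree : ∀ i, (B i).natDegree ≤ k
  dual : ∀ p : ℝ[X], p.natDegree ≤ k →
    p = ∑ i : Fin (k + 1), C (refMom e k i fun y => p.eval y) * B i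
  refMom_eval : ∀ i j : Fin (k + 1), refMom e k i (fun y => (B j).eval y) = if i = j then 1 else 0

lemma exists_isDualBasis {e : Option ℝ} (he : e = none ∨ e = some 0 ∨ e = some 1) (k : ℕ) :
    ∃ B, IsDualBasis e k B := by
  let L : (Fin (k + 1) → ℝ) →ₗ[ℝ] (Fin (k + 1) → ℝ) :=
    { toFun := fun v i => refMom e k i fun y => (polyOf v).eval y
      map_add' := fun v w => by
        ext i
        rw [Pi.add_apply, ← refMom_add e k i (polyOf v).continuous (polyOf w).continuous]
        congr 1; ext y; simp [eval_polyOf, add_mul, Finset.sum_add_distrib]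
      map_smul' := fun c v => by
        ext i
        rw [Pi.smul_apply, RingHom.id_apply, smul_eq_mul, ← refMom_smul]
        congr 1; ext y; simp [eval_polyOf, mul_assoc, Finset.mul_sum] }
  have hL : Function.Injective L := by
    rw [← LinearMap.ker_eq_bot, LinearMap.ker_eq_bot']
    intro v hv
    by_contra hv0
    refine polyOf_ne_zero hv0 (eq_zero_of_refMom he (natDegree_polyOf_le v) fun i hi => ?_)
    exact congrFun hv ⟨i, Nat.lt_succ_iff.mpr hi⟩
  let Le := LinearEquiv.ofInjectiveEndo L hL
  have hLe : ∀ v, Le v = L v := fun v => rfl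
  refine ⟨fun j => polyOf (Le.symm (Pi.single j 1)), fun i => natDegree_polyOf_le _, fun p hp => ?_,
    fun i j => ?_⟩
  · have h1 : (fun i : Fin (k + 1) => p.coeff i)
        = ∑ i : Fin (k + 1), (refMom e k i fun y => p.eval y) • Le.symm (Pi.single i 1) := by
      rw [← Le.symm_apply_apply (fun i : Fin (k + 1) => p.coeff i)]
      simp only [← map_smul, ← map_sum]
      congr 1
      ext i
      rw [hLe]
      simp only [Finset.sum_apply, Pi.smul_apply, Pi.single_apply, smul_eq_mul, mul_ite, mul_one,
        mul_zero, Finset.sum_ite_eq, Finset.mem_univ, if_true]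
      simp only [L, LinearMap.coe_mk, AddHom.coe_mk, polyOf_coeff hp]
    conv_lhs => rw [← polyOf_coeff hp, h1]
    refine Polynomial.funext fun y => ?_
    simp only [eval_polyOf, eval_finsetSum, eval_mul, eval_C, Finset.sum_apply, Pi.smul_apply,
      smul_eq_mul, Finset.mul_sum, Finset.sum_mul]
    rw [Finset.sum_comm]
    simp only [mul_assoc]
  · have : Le (Le.symm (Pi.single j 1)) i = (Pi.single j 1 : Fin (k + 1) → ℝ) i := by
      rw [Le.apply_symm_apply]
    rw [Pi.single_apply] at this
    exact this

/-- The projection of `w` on the interval `[l, l + h]`. -/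
def cellProj (e : Option ℝ) {k : ℕ} (B : Fin (k + 1) → ℝ[X]) (l h : ℝ) (w : ℝ → ℝ) : ℝ[X] :=
  ∑ i : Fin (k + 1), C (refMom e k i fun y => w (l + h * y)) * (B i).comp (C h⁻¹ * (X - C l))

variable {e : Option ℝ} {k : ℕ} {B : Fin (k + 1) → ℝ[X]}

lemma eval_cellProj (l h : ℝ) (w : ℝ → ℝ) (x : ℝ) : (cellProj e B l h w).eval x
    = ∑ i : Fin (k + 1), refMom e k i (fun y => w (l + h * y)) * (B i).eval (h⁻¹ * (x - l)) := by
  simp [cellProj, eval_finsetSum]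

lemma natDegree_comp_affine_le {p : ℝ[X]} (hp : p.natDegree ≤ k) (l h : ℝ) :
    (p.comp (C h⁻¹ * (X - C l))).natDegree ≤ k := by
  have h1 : (C h⁻¹ * (X - C l) : ℝ[X]).natDegree ≤ 1 := by compute_degree
  calc _ ≤ p.natDegree * (C h⁻¹ * (X - C l) : ℝ[X]).natDegree := natDegree_comp_le
    _ ≤ p.natDegree * 1 := by gcongr
    _ ≤ k := by simpa using hp

lemma IsDualBasis.natDegree_cellProj_le (hB : IsDualBasis e k B) (l h : ℝ) (w : ℝ → ℝ) :
    (cellProj e B l h w).natDegree ≤ k := by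
  refine natDegree_sum_le_of_forall_le _ _ fun i _ => ?_
  exact (natDegree_C_mul_le _ _).trans (natDegree_comp_affine_le (hB.degree i) l h)

lemma refMom_finset_sum {ι : Type*} (s : Finset ι) (i : ℕ) (c : ι → ℝ) (v : ι → ℝ → ℝ)
    (hv : ∀ j, Continuous (v j)) :
    refMom e k i (fun y => ∑ j ∈ s, c j * v j y) = ∑ j ∈ s, c j * refMom e k i (v j) := by
  classical
  induction s using Finset.induction_on with
  | empty =>
    have := refMom_smul e k i 0 (fun _ => 0)
    simpa using this
  | insert a s ha ih =>
    simp only [Finset.sum_insert ha]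
    rw [refMom_add e k i (by fun_prop) (by fun_prop), ih, refMom_smul]

lemma IsDualBasis.refMom_cellProj (hB : IsDualBasis e k B) (l : ℝ) {h : ℝ} (hh : h ≠ 0)
    (w : ℝ → ℝ) (i : Fin (k + 1)) :
    refMom e k i (fun y => (cellProj e B l h w).eval (l + h * y))
      = refMom e k i (fun y => w (l + h * y)) := by
  have : ∀ y : ℝ, h⁻¹ * (l + h * y - l) = y := fun y => by field_simp; ring
  simp only [eval_cellProj, this]
  rw [refMom_finset_sum _ _ _ _ fun j => (B j).continuous]
  simp [hB.refMom_eval]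

/-- The projection preserves moments against polynomials for which all the moments are among the
defining functionals. -/
lemma IsDualBasis.integral_cellProj (hB : IsDualBasis e k B) {l r : ℝ} (hlr : l < r) {w : ℝ → ℝ}
    (hw : Continuous w) {v : ℝ[X]} (hv : v.natDegree < k ∨ e = none ∧ v.natDegree ≤ k) :
    ∫ x in l..r, (cellProj e B l (r - l) w).eval x * v.eval x = ∫ x in l..r, w x * v.eval x := by
  have hmom : ∀ i, i < k ∨ e = none ∧ i ≤ k →
      ∫ y in (0 : ℝ)..1, (cellProj e B l (r - l) w).eval (l + (r - l) * y) * y ^ i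
        = ∫ y in (0 : ℝ)..1, w (l + (r - l) * y) * y ^ i := by
    intro i hi
    have := hB.refMom_cellProj l (sub_pos.mpr hlr).ne' w ⟨i, by omega⟩
    unfold refMom at this
    rcases hi with hi | ⟨rfl, hi⟩
    · simpa [hi.ne] using this
    · simp only [Option.elim] at this
      split_ifs at this with h1
      · simpa [h1] using this
      · simpa using this
  rw [integral_eq_smul_unit, integral_eq_smul_unit (fun x => w x * v.eval x)]
  congr 1
  set v' := rescale l (r - l) v with hv'
  have hvv : ∀ y, v.eval (l + (r - l) * y) = v'.eval y := fun y => by simp [hv']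
  have hd : v'.natDegree ≤ v.natDegree := natDegree_rescale_le _ _ le_rfl
  simp only [hvv]
  have key : ∀ g : ℝ → ℝ, Continuous g → ∫ y in (0 : ℝ)..1, g y * v'.eval y
      = ∑ i ∈ Finset.range (v'.natDegree + 1), v'.coeff i * ∫ y in (0 : ℝ)..1, g y * y ^ i := by
    intro g hg
    have : ∀ y, g y * v'.eval y
        = ∑ i ∈ Finset.range (v'.natDegree + 1), v'.coeff i * (g y * y ^ i) := fun y => by
      rw [eval_eq_sum_range, Finset.mul_sum]
      exact Finset.sum_congr rfl fun i _ => by ring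
    simp only [this]
    rw [intervalIntegral.integral_finsetSum fun i _ =>
      Continuous.intervalIntegrable (by fun_prop) _ _]
    simp only [intervalIntegral.integral_const_mul]
  rw [key _ (by fun_prop), key _ (by fun_prop)]
  refine Finset.sum_congr rfl fun i hi => ?_
  have hi' := Finset.mem_range.mp hi
  rw [hmom i (hv.imp (fun h => by omega) (fun h => ⟨h.1, by omega⟩))]

lemma IsDualBasis.eval_cellProj_point {c : ℝ} {B : Fin (k + 1) → ℝ[X]}
    (hB : IsDualBasis (some c) k B) {l r : ℝ} (hlr : l < r) (w : ℝ → ℝ) :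
    (cellProj (some c) B l (r - l) w).eval (l + (r - l) * c) = w (l + (r - l) * c) := by
  have := hB.refMom_cellProj l (sub_pos.mpr hlr).ne' w (Fin.last k)
  simpa [refMom] using this

lemma IsDualBasis.cellProj_poly (hB : IsDualBasis e k B) (l : ℝ) {h : ℝ} (hh : h ≠ 0) {p : ℝ[X]}
    (hp : p.natDegree ≤ k) : cellProj e B l h (fun x => p.eval x) = p := by
  refine Polynomial.funext fun x => ?_
  have h1 := hB.dual (rescale l h p) (natDegree_rescale_le l h hp)
  have h2 := congrArg (eval (h⁻¹ * (x - l))) h1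
  have h3 : l + h * (h⁻¹ * (x - l)) = x := by field_simp; ring
  rw [eval_rescale, h3] at h2
  rw [h2, eval_cellProj]
  simp [eval_finsetSum]

lemma IsDualBasis.cellProj_sub (l h : ℝ) {v w : ℝ → ℝ} (hv : Continuous v)
    (hw : Continuous w) : cellProj e B l h (fun x => v x - w x)
      = cellProj e B l h v - cellProj e B l h w := by
  refine Polynomial.funext fun x => ?_
  rw [eval_sub, eval_cellProj, eval_cellProj, eval_cellProj, ← Finset.sum_sub_distrib]
  refine Finset.sum_congr rfl fun i _ => ?_
  have h1 := refMom_add e k i (v := fun y => v (l + h * y)) (w := fun y => (-1) * w (l + h * y))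
    (by fun_prop) (by fun_prop)
  rw [refMom_smul] at h1
  have h2 : (fun y => v (l + h * y) + (-1) * w (l + h * y))
    = fun y => v (l + h * y) - w (l + h * y) := by ext y; ring
  rw [h2] at h1
  rw [h1]; ring

/-- The projection is quasi-optimal in the supremum norm, uniformly in the interval. -/
lemma IsDualBasis.exists_abs_cellProj_sub_le (hB : IsDualBasis e k B)
    (he : ∀ c, e = some c → c ∈ Icc (0 : ℝ) 1) :
    ∃ K : ℝ, 0 < K ∧ ∀ l r : ℝ, l < r → ∀ w : ℝ → ℝ, Continuous w → ∀ p : ℝ[X],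
      p.natDegree ≤ k → ∀ S, (∀ x ∈ Icc l r, |w x - p.eval x| ≤ S) → ∀ x ∈ Icc l r,
        |(cellProj e B l (r - l) w).eval x - w x| ≤ K * S := by
  have hbd : ∀ i, ∃ b, ∀ y ∈ Icc (0 : ℝ) 1, |(B i).eval y| ≤ b := fun i => by
    obtain ⟨b, hb⟩ := isCompact_Icc.exists_bound_of_continuousOn (s := Icc (0 : ℝ) 1)
      (B i).continuous.continuousOn
    exact ⟨b, hb⟩
  choose b hb using hbd
  have hb0 : ∀ i, 0 ≤ b i := fun i => (abs_nonneg _).trans (hb i 0 (by simp))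
  refine ⟨(∑ i, b i) + 1, by have := Finset.sum_nonneg fun i (_ : i ∈ Finset.univ) => hb0 i; linarith,
    fun l r hlr w hw p hp S hS x hx => ?_⟩
  have hh : 0 < r - l := sub_pos.mpr hlr
  have h1 : cellProj e B l (r - l) w
      = cellProj e B l (r - l) (fun x => w x - p.eval x) + p := by
    rw [IsDualBasis.cellProj_sub l (r - l) hw p.continuous, hB.cellProj_poly l hh.ne' hp]; ring
  obtain ⟨y, hy, rfl⟩ := exists_unit_point hlr hx
  have h2 : |(cellProj e B l (r - l) (fun x => w x - p.eval x)).eval (l + (r - l) * y)|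
      ≤ (∑ i, b i) * S := by
    rw [eval_cellProj, Finset.sum_mul]
    refine (Finset.abs_sum_le_sum_abs _ _).trans (Finset.sum_le_sum fun i _ => ?_)
    have h3 : (r - l)⁻¹ * (l + (r - l) * y - l) = y := by field_simp; ring
    rw [h3, abs_mul, mul_comm]
    refine mul_le_mul (hb i y hy) ?_ (abs_nonneg _) (hb0 i)
    refine abs_refMom_le he k i fun z hz => hS _ ⟨?_, ?_⟩
    · nlinarith [hz.1]
    · nlinarith [hz.2]
  rw [h1, eval_add]
  have h4 := hS _ hx
  rw [abs_sub_comm] at h4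
  calc _ = |(cellProj e B l (r - l) (fun x => w x - p.eval x)).eval (l + (r - l) * y)
      + (p.eval (l + (r - l) * y) - w (l + (r - l) * y))| := by congr 1; ring
    _ ≤ _ := (abs_add_le _ _).trans (by linarith)

lemma exists_taylor_poly {k : ℕ} {w : ℝ → ℝ} (hw : ContDiff ℝ (k + 1 : ℕ) w) {l r D : ℝ}
    (hlr : l < r) (hD : ∀ x ∈ Icc l r, |iteratedDeriv (k + 1) w x| ≤ D) :
    ∃ p : ℝ[X], p.natDegree ≤ k ∧ ∀ x ∈ Icc l r, |w x - p.eval x| ≤ D * (r - l) ^ (k + 1) := by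
  have hD0 : 0 ≤ D := (abs_nonneg _).trans (hD l ⟨le_rfl, hlr.le⟩)
  refine ⟨∑ i ∈ Finset.range (k + 1), C (((i.factorial : ℝ)⁻¹) * iteratedDerivWithin i w (Icc l r) l)
    * (X - C l) ^ i, ?_, fun x hx => ?_⟩
  · refine natDegree_sum_le_of_forall_le _ _ fun i hi => ?_
    have hi' := Finset.mem_range.mp hi
    refine (natDegree_C_mul_le _ _).trans ?_
    refine natDegree_pow_le.trans ?_
    rw [natDegree_X_sub_C]; omega
  · have h := taylor_mean_remainder_bound (n := k) (C := D) hlr.le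
      (by exact_mod_cast hw.contDiffOn) hx (fun y hy => by
        rw [iteratedDerivWithin_eq_iteratedDeriv (uniqueDiffOn_Icc hlr) hw.contDiffAt hy]
        exact hD y hy)
    rw [taylor_within_apply] at h
    have h1 : (∑ i ∈ Finset.range (k + 1), C (((i.factorial : ℝ)⁻¹) *
        iteratedDerivWithin i w (Icc l r) l) * (X - C l) ^ i).eval x
        = ∑ i ∈ Finset.range (k + 1), (((i.factorial : ℝ)⁻¹) * (x - l) ^ i) •
          iteratedDerivWithin i w (Icc l r) l := by
      simp only [eval_finsetSum, eval_mul, eval_C, eval_pow, eval_sub, eval_X, smul_eq_mul]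
      exact Finset.sum_congr rfl fun i _ => by ring
    rw [h1]
    refine h.trans ?_
    have h2 : (x - l) ^ (k + 1) ≤ (r - l) ^ (k + 1) :=
      pow_le_pow_left₀ (by linarith [hx.1]) (by linarith [hx.2]) _
    have h3 : (1 : ℝ) ≤ k.factorial := by exact_mod_cast k.factorial_pos
    calc _ ≤ D * (x - l) ^ (k + 1) := div_le_self
            (mul_nonneg hD0 (pow_nonneg (by linarith [hx.1]) _)) h3
      _ ≤ _ := by gcongr

end
end LDG

namespace LDG
noncomputable section

/-! ### The Riesz potential of bounded functions with bounded support -/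

/-- The Riesz potential without its normalisation. -/
def rieszPot (s : ℝ) (w : ℝ → ℝ) (x : ℝ) : ℝ := ∫ y, |x - y| ^ (s - 1) * w y

/-- The normalisation constant of the Riesz potential. -/
def rieszConst (s : ℝ) : ℝ := 1 / Real.Gamma s / (2 * Real.cos (s * Real.pi / 2))

lemma rieszConst_pos {s : ℝ} (h0 : 0 < s) (h1 : s < 1) : 0 < rieszConst s := by
  have hg := Real.Gamma_pos_of_pos h0
  have hpi := Real.pi_pos
  have hc : 0 < Real.cos (s * Real.pi / 2) :=
    Real.cos_pos_of_mem_Ioo ⟨by nlinarith, by nlinarith⟩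
  unfold rieszConst
  positivity

/-- Measurable, bounded, and zero outside `[a,b]`. -/
structure Tame (a b : ℝ) (w : ℝ → ℝ) : Prop where
  measurable : Measurable w
  bounded : ∃ S, ∀ x, |w x| ≤ S
  support : ∀ x ∉ Icc a b, w x = 0

lemma Tame.sub {a b : ℝ} {v w : ℝ → ℝ} (hv : Tame a b v) (hw : Tame a b w) :
    Tame a b (fun x => v x - w x) := by
  obtain ⟨S, hS⟩ := hv.bounded
  obtain ⟨S', hS'⟩ := hw.bounded
  exact ⟨hv.measurable.sub hw.measurable, ⟨S + S', fun x =>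
    (abs_sub _ _).trans (add_le_add (hS x) (hS' x))⟩,
    fun x hx => by rw [hv.support x hx, hw.support x hx, sub_zero]⟩

variable {s : ℝ}

lemma integrableOn_ker (h0 : 0 < s) (R : ℝ) :
    IntegrableOn (fun z : ℝ => |z| ^ (s - 1)) (Icc (-R) R) := by
  have h1 : IntegrableOn (fun z : ℝ => |z| ^ (s - 1)) (Icc 0 R) := by
    rcases lt_or_ge R 0 with hR | hR
    · rw [Icc_eq_empty (not_le.mpr hR)]; exact integrableOn_empty
    · have := (intervalIntegral.intervalIntegrable_rpow' (a := 0) (b := R) (r := s - 1)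
        (by linarith))
      rw [intervalIntegrable_iff_integrableOn_Icc_of_le hR] at this
      refine this.congr_fun (fun z hz => ?_) measurableSet_Icc
      simp only [abs_of_nonneg hz.1]
  have h2 : IntegrableOn (fun z : ℝ => |z| ^ (s - 1)) (Icc (-R) 0) := by
    have := ((Measure.measurePreserving_neg (volume : Measure ℝ)).integrableOn_comp_preimage
      (Homeomorph.neg ℝ).measurableEmbedding).mpr h1
    simpa [Function.comp_def] using this
  rcases lt_or_ge R 0 with hR | hR
  · rw [Icc_eq_empty (by linarith)]; exact integrableOn_empty
  · rw [← Icc_union_Icc_eq_Icc (b := 0) (by linarith) hR]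
    exact h2.union h1

lemma integrableOn_ker_sub (h0 : 0 < s) (x a b : ℝ) :
    IntegrableOn (fun y : ℝ => |x - y| ^ (s - 1)) (Icc a b) := by
  have h1 := (integrableOn_ker h0 (|x| + |a| + |b|)).mono_set (t := Icc (-(|x| + |a| + |b|)) _)
    (s := Icc (x - b) (x - a)) (Icc_subset_Icc
      (by linarith [neg_abs_le x, le_abs_self b, abs_nonneg a])
      (by linarith [le_abs_self x, neg_abs_le a, abs_nonneg b]))
  have := ((Measure.measurePreserving_sub_left (volume : Measure ℝ) x).integrableOn_comp_preimage
    (Homeomorph.subLeft x).measurableEmbedding).mpr h1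
  simpa [Function.comp_def] using this

variable {a b : ℝ}

lemma Tame.ker_integrable (h0 : 0 < s) {w : ℝ → ℝ} (hw : Tame a b w) (x : ℝ) :
    Integrable (fun y => |x - y| ^ (s - 1) * w y) := by
  obtain ⟨S, hS⟩ := hw.bounded
  have h1 : IntegrableOn (fun y => |x - y| ^ (s - 1) * w y) (Icc a b) :=
    (integrableOn_ker_sub h0 x a b).mul_bdd (c := S)
      hw.measurable.aestronglyMeasurable (Filter.Eventually.of_forall hS)
  refine (integrableOn_iff_integrable_of_support_subset fun y hy => ?_).mp h1
  by_contra hy'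
  exact hy (by simp [hw.support y hy'])

lemma Tame.rieszPot_sub (h0 : 0 < s) {v w : ℝ → ℝ} (hv : Tame a b v) (hw : Tame a b w) (x : ℝ) :
    rieszPot s (fun y => v y - w y) x = rieszPot s v x - rieszPot s w x := by
  unfold rieszPot
  rw [← integral_sub (hv.ker_integrable h0 x) (hw.ker_integrable h0 x)]
  congr 1; ext y; ring

/-- The integral that bounds the Riesz potential on an interval of length `R`. -/
def kerMass (s R : ℝ) : ℝ := ∫ z in Icc (-R) R, |z| ^ (s - 1)

lemma kerMass_nonneg (s R : ℝ) : 0 ≤ kerMass s R :=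
  integral_nonneg fun _ => Real.rpow_nonneg (abs_nonneg _) _

lemma integral_ker_sub_le (h0 : 0 < s) {x : ℝ} (hx : x ∈ Icc a b) :
    ∫ y in Icc a b, |x - y| ^ (s - 1) ≤ kerMass s (b - a) := by
  have h1 : ∫ y in Icc a b, |x - y| ^ (s - 1) = ∫ z in Icc (x - b) (x - a), |z| ^ (s - 1) := by
    have := (Measure.measurePreserving_sub_left (volume : Measure ℝ) x).setIntegral_preimage_emb
      (Homeomorph.subLeft x).measurableEmbedding (fun z : ℝ => |z| ^ (s - 1)) (Icc (x - b) (x - a))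
    simpa using this
  rw [h1]
  refine setIntegral_mono_set (integrableOn_ker h0 _)
    (Filter.Eventually.of_forall fun _ => Real.rpow_nonneg (abs_nonneg _) _)
    (Icc_subset_Icc ?_ ?_).eventuallyLE
  · linarith [hx.1]
  · linarith [hx.2]

lemma Tame.abs_rieszPot_le (h0 : 0 < s) {w : ℝ → ℝ} (hw : Tame a b w) {S : ℝ}
    (hS : ∀ x, |w x| ≤ S) {x : ℝ} (hx : x ∈ Icc a b) :
    |rieszPot s w x| ≤ S * kerMass s (b - a) := by
  have hS0 : 0 ≤ S := (abs_nonneg _).trans (hS 0)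
  have h1 : rieszPot s w x = ∫ y in Icc a b, |x - y| ^ (s - 1) * w y := by
    unfold rieszPot
    exact (setIntegral_eq_integral_of_forall_compl_eq_zero fun y hy => by
      simp [hw.support y hy]).symm
  rw [h1]
  calc |∫ y in Icc a b, |x - y| ^ (s - 1) * w y|
      ≤ ∫ y in Icc a b, S * |x - y| ^ (s - 1) := by
        rw [← Real.norm_eq_abs]
        refine norm_integral_le_of_norm_le ((integrableOn_ker_sub h0 x a b).const_mul S)
          (Filter.Eventually.of_forall fun y => ?_)
        rw [Real.norm_eq_abs, abs_mul, abs_of_nonneg (Real.rpow_nonneg (abs_nonneg _) _), mul_comm]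
        exact mul_le_mul_of_nonneg_right (hS y) (Real.rpow_nonneg (abs_nonneg _) _)
    _ = S * ∫ y in Icc a b, |x - y| ^ (s - 1) := integral_const_mul _ _
    _ ≤ _ := mul_le_mul_of_nonneg_left (integral_ker_sub_le h0 hx) hS0

lemma measurable_ker_mul {w : ℝ → ℝ} (hw : Measurable w) :
    Measurable (fun z : ℝ × ℝ => |z.1 - z.2| ^ (s - 1) * w z.2) := by
  fun_prop

lemma Tame.measurable_rieszPot {w : ℝ → ℝ} (hw : Tame a b w) : Measurable (rieszPot s w) := by
  have : StronglyMeasurable (fun z : ℝ × ℝ => |z.1 - z.2| ^ (s - 1) * w z.2) :=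
    (measurable_ker_mul hw.measurable).stronglyMeasurable
  exact (this.integral_prod_right' (ν := volume)).measurable

lemma Tame.rieszInt_eq (h0 : 0 < s) {w : ℝ → ℝ} (hw : Tame a b w) (x : ℝ) :
    rieszInt s w x = rieszConst s * rieszPot s w x := by
  have h1 : ∫ y in Iio x, (x - y) ^ (s - 1) * w y = ∫ y in Iio x, |x - y| ^ (s - 1) * w y := by
    refine setIntegral_congr_fun measurableSet_Iio fun y hy => ?_
    have : (0 : ℝ) ≤ x - y := sub_nonneg.mpr (le_of_lt hy)
    simp only [abs_of_nonneg this]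
  have h2 : ∫ y in Ioi x, (y - x) ^ (s - 1) * w y = ∫ y in Ioi x, |x - y| ^ (s - 1) * w y := by
    refine setIntegral_congr_fun measurableSet_Ioi fun y hy => ?_
    have : (0 : ℝ) ≤ y - x := sub_nonneg.mpr (le_of_lt hy)
    simp only [abs_sub_comm x y, abs_of_nonneg this]
  have h3 := integral_add_compl (measurableSet_Iio (a := x)) (hw.ker_integrable h0 x)
  rw [compl_Iio, integral_Ici_eq_integral_Ioi] at h3
  unfold rieszInt leftFracInt rightFracInt rieszConst rieszPot
  rw [h1, h2, ← h3]
  ring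

/-! ### Derivatives of fractional integrals -/

/-- The kernel of the left fractional integral. -/
def leftKer (s : ℝ) : ℝ → ℝ := (Ioi 0).indicator fun t => t ^ (s - 1)

/-- The kernel of the right fractional integral. -/
def rightKer (s : ℝ) : ℝ → ℝ := (Iio 0).indicator fun t => (-t) ^ (s - 1)

open scoped Convolution in
lemma leftFracInt_eq_convolution (s : ℝ) (w : ℝ → ℝ) (x : ℝ) :
    leftFracInt s w x
      = 1 / Real.Gamma s * (leftKer s ⋆[ContinuousLinearMap.mul ℝ ℝ, volume] w) x := by
  unfold leftFracInt
  congr 1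
  rw [convolution_def, ← integral_sub_left_eq_self _ volume x, ← integral_indicator measurableSet_Iio]
  congr 1; ext y
  by_cases hy : y < x
  · simp [leftKer, hy]
  · simp [leftKer, hy]

open scoped Convolution in
lemma rightFracInt_eq_convolution (s : ℝ) (w : ℝ → ℝ) (x : ℝ) :
    rightFracInt s w x
      = 1 / Real.Gamma s * (rightKer s ⋆[ContinuousLinearMap.mul ℝ ℝ, volume] w) x := by
  unfold rightFracInt
  congr 1
  rw [convolution_def, ← integral_sub_left_eq_self _ volume x, ← integral_indicator measurableSet_Ioi]
  congr 1; ext y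
  by_cases hy : x < y
  · simp [rightKer, hy]
  · simp [rightKer, hy]

lemma locallyIntegrable_of_abs_le_ker (h0 : 0 < s) {κ : ℝ → ℝ} (hm : Measurable κ)
    (hκ : ∀ t, |κ t| ≤ |t| ^ (s - 1)) : LocallyIntegrable κ := by
  rw [locallyIntegrable_iff]
  intro K hK
  obtain ⟨R, hR⟩ := hK.isBounded.subset_closedBall 0
  have h1 := (integrableOn_ker h0 R).mono_set (s := K) (by
    intro z hz
    have := hR hz
    rwa [Real.closedBall_eq_Icc, zero_sub, zero_add] at this)
  exact h1.mono' hm.aestronglyMeasurable (Filter.Eventually.of_forall hκ)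

lemma locallyIntegrable_leftKer (h0 : 0 < s) : LocallyIntegrable (leftKer s) := by
  refine locallyIntegrable_of_abs_le_ker h0
    ((by fun_prop : Measurable fun t : ℝ => t ^ (s - 1)).indicator measurableSet_Ioi) fun t => ?_
  have := Real.rpow_nonneg (abs_nonneg t) (s - 1)
  by_cases ht : 0 < t
  · rw [leftKer, indicator_of_mem (show t ∈ Ioi 0 from ht), abs_of_nonneg (Real.rpow_nonneg ht.le _),
      abs_of_pos ht]
  · rw [leftKer, indicator_of_notMem (show t ∉ Ioi 0 from ht)]; simpa

lemma locallyIntegrable_rightKer (h0 : 0 < s) : LocallyIntegrable (rightKer s) := by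
  refine locallyIntegrable_of_abs_le_ker h0
    ((by fun_prop : Measurable fun t : ℝ => (-t) ^ (s - 1)).indicator measurableSet_Iio) fun t => ?_
  have := Real.rpow_nonneg (abs_nonneg t) (s - 1)
  by_cases ht : t < 0
  · rw [rightKer, indicator_of_mem (show t ∈ Iio 0 from ht),
      abs_of_nonneg (Real.rpow_nonneg (by linarith) _), abs_of_neg ht]
  · rw [rightKer, indicator_of_notMem (show t ∉ Iio 0 from ht)]; simpa

lemma hasDerivAt_leftFracInt (h0 : 0 < s) {w : ℝ → ℝ} (hw : ContDiff ℝ 1 w)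
    (hc : HasCompactSupport w) (x : ℝ) :
    HasDerivAt (leftFracInt s w) (leftFracInt s (deriv w) x) x := by
  rw [funext (leftFracInt_eq_convolution s w), leftFracInt_eq_convolution]
  exact (hc.hasDerivAt_convolution_right _ (locallyIntegrable_leftKer h0) hw x).const_mul _

lemma hasDerivAt_rightFracInt (h0 : 0 < s) {w : ℝ → ℝ} (hw : ContDiff ℝ 1 w)
    (hc : HasCompactSupport w) (x : ℝ) :
    HasDerivAt (rightFracInt s w) (rightFracInt s (deriv w) x) x := by
  rw [funext (rightFracInt_eq_convolution s w), rightFracInt_eq_convolution]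
  exact (hc.hasDerivAt_convolution_right _ (locallyIntegrable_rightKer h0) hw x).const_mul _

lemma hasDerivAt_rieszInt (h0 : 0 < s) {w : ℝ → ℝ} (hw : ContDiff ℝ 1 w)
    (hc : HasCompactSupport w) (x : ℝ) :
    HasDerivAt (rieszInt s w) (rieszInt s (deriv w) x) x :=
  ((hasDerivAt_leftFracInt h0 hw hc x).add (hasDerivAt_rightFracInt h0 hw hc x)).div_const _

lemma continuous_rieszInt (h0 : 0 < s) {w : ℝ → ℝ} (hw : ContDiff ℝ 1 w)
    (hc : HasCompactSupport w) : Continuous (rieszInt s w) :=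
  continuous_iff_continuousAt.mpr fun x => (hasDerivAt_rieszInt h0 hw hc x).continuousAt

lemma contDiff_rieszInt (h0 : 0 < s) (n : ℕ) {w : ℝ → ℝ} (hw : ContDiff ℝ (n + 1 : ℕ) w)
    (hc : HasCompactSupport w) : ContDiff ℝ n (rieszInt s w) ∧
      iteratedDeriv n (rieszInt s w) = rieszInt s (iteratedDeriv n w) := by
  induction n generalizing w with
  | zero =>
    have := continuous_rieszInt h0 (by simpa using hw) hc
    exact ⟨by rw [Nat.cast_zero]; exact contDiff_zero.mpr this, by simp⟩
  | succ n ih =>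
    have hw' : ContDiff ℝ ((n + 1 : ℕ) + 1) w := by exact_mod_cast hw
    have hw1 : ContDiff ℝ 1 w := hw.of_le (by norm_cast; omega)
    have hd : ContDiff ℝ (n + 1 : ℕ) (deriv w) := (contDiff_succ_iff_deriv.mp hw').2.2
    obtain ⟨h1, h2⟩ := ih hd hc.deriv
    have h3 : deriv (rieszInt s w) = rieszInt s (deriv w) :=
      funext fun x => (hasDerivAt_rieszInt h0 hw1 hc x).deriv
    refine ⟨?_, by rw [iteratedDeriv_succ', h3, h2, ← iteratedDeriv_succ']⟩
    rw [Nat.cast_add, Nat.cast_one, contDiff_succ_iff_deriv]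
    refine ⟨fun x => (hasDerivAt_rieszInt h0 hw1 hc x).differentiableAt, by simp, ?_⟩
    rw [h3]; exact h1

/-- On smooth functions with compact support the fractional Laplacian is the derivative of the
Riesz potential of the derivative. -/
lemma negFracLap_eq {α : ℝ} (h2 : α < 2) {w : ℝ → ℝ} (hw : ContDiff ℝ 2 w)
    (hc : HasCompactSupport w) (x : ℝ) :
    negFracLap α w x = rieszInt (2 - α) (deriv (deriv w)) x := by
  have h0 : 0 < 2 - α := by linarith
  have hw1 : ContDiff ℝ 1 w := hw.of_le (by norm_num)
  have hw' : ContDiff ℝ (1 + 1) w := by rwa [one_add_one_eq_two]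
  have hd : ContDiff ℝ 1 (deriv w) := (contDiff_succ_iff_deriv.mp hw').2.2
  have hl : leftRLDeriv α w x = leftFracInt (2 - α) (deriv (deriv w)) x := by
    have h3 : deriv (leftFracInt (2 - α) w) = leftFracInt (2 - α) (deriv w) :=
      funext fun x => (hasDerivAt_leftFracInt h0 hw1 hc x).deriv
    rw [leftRLDeriv, iteratedDeriv_succ, iteratedDeriv_one, h3]
    exact (hasDerivAt_leftFracInt h0 hd hc.deriv x).deriv
  have hr : rightRLDeriv α w x = rightFracInt (2 - α) (deriv (deriv w)) x := by
    have h3 : deriv (rightFracInt (2 - α) w) = rightFracInt (2 - α) (deriv w) :=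
      funext fun x => (hasDerivAt_rightFracInt h0 hw1 hc x).deriv
    rw [rightRLDeriv, iteratedDeriv_succ, iteratedDeriv_one, h3]
    exact (hasDerivAt_rightFracInt h0 hd hc.deriv x).deriv
  have hcos : Real.cos (α * Real.pi / 2) = -Real.cos ((2 - α) * Real.pi / 2) := by
    rw [← Real.cos_pi_sub]; congr 1; ring
  rw [negFracLap, hl, hr, rieszInt, hcos, mul_neg, neg_div_neg_eq]

end
end LDG

namespace LDG
noncomputable section

/-! ### Positivity of the Riesz potential -/

variable {s a b : ℝ}

lemma integral_add_rpow_Ioi {p c d : ℝ} (hp : p < -1) (hc : -d < c) :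
    ∫ x in Ioi c, (x + d) ^ p = -(c + d) ^ (p + 1) / (p + 1) := by
  have hd : ∀ x ∈ Ici c, HasDerivAt (fun t => (t + d) ^ (p + 1) / (p + 1)) ((x + d) ^ p) x := by
    intro x hx
    have hx' : (x + d) ≠ 0 := by have := mem_Ici.mp hx; linarith
    have := ((hasDerivAt_id x).add_const d).rpow_const (p := p + 1) (Or.inl hx')
    refine (this.div_const (p + 1)).congr_deriv ?_
    have : p + 1 ≠ 0 := by linarith
    simp only [id, add_sub_cancel_right]
    field_simp
  have ht : Filter.Tendsto (fun t => (t + d) ^ (p + 1) / (p + 1)) Filter.atTop (nhds (0 / (p + 1))) := by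
    refine Filter.Tendsto.div_const ?_ _
    have h1 := tendsto_rpow_neg_atTop (y := -(p + 1)) (by linarith)
    simp only [neg_neg] at h1
    exact h1.comp (Filter.tendsto_atTop_add_const_right _ d Filter.tendsto_id)
  rw [integral_Ioi_of_hasDerivAt_of_tendsto' hd (integrableOn_add_rpow_Ioi_of_lt hp hc) ht]
  ring

/-- The total weight of the windows that contain two given points. -/
lemma window_weight (h0 : 0 < s) (h1 : s < 1) {m M : ℝ} (hmM : m < M) :
    IntegrableOn (fun ω : ℝ × ℝ => (ω.2 - ω.1) ^ (s - 3)) (Iic m ×ˢ Ioi M) ∧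
    ∫ ω in Iic m ×ˢ Ioi M, (ω.2 - ω.1) ^ (s - 3) = (M - m) ^ (s - 1) / ((1 - s) * (2 - s)) := by
  have hin : ∀ l ∈ Iic m, IntegrableOn (fun r : ℝ => (r - l) ^ (s - 3)) (Ioi M) := by
    intro l hl
    have hl' := mem_Iic.mp hl
    simpa [sub_eq_add_neg] using
      integrableOn_add_rpow_Ioi_of_lt (a := s - 3) (c := M) (m := -l) (by linarith) (by linarith)
  have hinv : ∀ l ∈ Iic m, ∫ r in Ioi M, (r - l) ^ (s - 3) = (M - l) ^ (s - 2) / (2 - s) := by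
    intro l hl
    have hl' := mem_Iic.mp hl
    have := integral_add_rpow_Ioi (p := s - 3) (c := M) (d := -l) (by linarith) (by linarith)
    simp only [← sub_eq_add_neg] at this
    rw [this, show s - 3 + 1 = s - 2 by ring, show s - 2 = -(2 - s) by ring, neg_div_neg_eq]
  have hout : IntegrableOn (fun l : ℝ => (M - l) ^ (s - 2) / (2 - s)) (Iic m) := by
    have h2 : IntegrableOn (fun l : ℝ => (l + M) ^ (s - 2)) (Ici (-m)) :=
      (integrableOn_Ici_iff_integrableOn_Ioi (by simp)).mpr
        (integrableOn_add_rpow_Ioi_of_lt (by linarith) (by linarith))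
    have h3 := h2.comp_neg_Iic
    refine (h3.congr_fun (fun l _ => ?_) measurableSet_Iic).div_const _
    simp only [neg_add_eq_sub]
  have houtv : ∫ l in Iic m, (M - l) ^ (s - 2) / (2 - s)
      = (M - m) ^ (s - 1) / ((1 - s) * (2 - s)) := by
    have h2 := integral_comp_neg_Iic m (fun l : ℝ => (l + M) ^ (s - 2) / (2 - s))
    simp only [neg_add_eq_sub] at h2
    rw [h2, integral_div, integral_add_rpow_Ioi (by linarith) (by linarith)]
    rw [show s - 2 + 1 = -(1 - s) by ring, show -m + M = M - m by ring, neg_div_neg_eq, div_div,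
      neg_sub]
  have hpos : ∀ ω ∈ Iic m ×ˢ Ioi M, 0 ≤ (ω.2 - ω.1) ^ (s - 3) := fun ω hω =>
    Real.rpow_nonneg (by have h1 := mem_Iic.mp hω.1; have h2 := mem_Ioi.mp hω.2; linarith) _
  have hI : IntegrableOn (fun ω : ℝ × ℝ => (ω.2 - ω.1) ^ (s - 3)) (Iic m ×ˢ Ioi M) := by
    rw [IntegrableOn, Measure.volume_eq_prod, ← Measure.prod_restrict, integrable_prod_iff]
    · refine ⟨(ae_restrict_mem measurableSet_Iic).mono fun l hl => hin l hl, ?_⟩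
      refine (hout.congr_fun (fun l hl => ?_) measurableSet_Iic)
      refine (hinv l hl).symm.trans ?_
      refine setIntegral_congr_fun measurableSet_Ioi fun r hr => ?_
      exact (Real.norm_of_nonneg (hpos (l, r) ⟨hl, hr⟩)).symm
    · exact (Measurable.pow_const (measurable_snd.sub measurable_fst) _).aestronglyMeasurable
  refine ⟨hI, ?_⟩
  rw [Measure.volume_eq_prod, setIntegral_prod _ (by rwa [Measure.volume_eq_prod] at hI), ← houtv]
  exact setIntegral_congr_fun measurableSet_Iic fun l hl => hinv l hl

/-- The weight of the window `[l, r)`. -/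
def winWeight (s : ℝ) (ω : ℝ × ℝ) : ℝ := if ω.1 < ω.2 then (ω.2 - ω.1) ^ (s - 3) else 0

/-- The indicator of the window `[l, r)`. -/
def winInd (ω : ℝ × ℝ) (x : ℝ) : ℝ := if ω.1 ≤ x ∧ x < ω.2 then 1 else 0

lemma winWeight_nonneg (s : ℝ) (ω : ℝ × ℝ) : 0 ≤ winWeight s ω := by
  unfold winWeight
  split_ifs with h
  · exact Real.rpow_nonneg (by linarith) _
  · exact le_rfl

lemma measurable_winWeight : Measurable (winWeight s) :=
  Measurable.ite (measurableSet_lt measurable_fst measurable_snd) (by fun_prop) measurable_const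

lemma measurable_winInd : Measurable (fun z : (ℝ × ℝ) × ℝ => winInd z.1 z.2) :=
  Measurable.ite ((measurableSet_le (measurable_fst.comp measurable_fst) measurable_snd).inter
    (measurableSet_lt measurable_snd (measurable_snd.comp measurable_fst)))
    measurable_const measurable_const

lemma winWeight_mul_winInd (x y : ℝ) (ω : ℝ × ℝ) :
    winWeight s ω * winInd ω x * winInd ω y
      = (Iic (min x y) ×ˢ Ioi (max x y)).indicator (fun ω : ℝ × ℝ => (ω.2 - ω.1) ^ (s - 3)) ω := by
  by_cases h : ω ∈ Iic (min x y) ×ˢ Ioi (max x y)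
  · rw [indicator_of_mem h]
    obtain ⟨h1, h2⟩ := h
    simp only [mem_Iic, le_min_iff, mem_Ioi, max_lt_iff] at h1 h2
    simp [winWeight, winInd, h1, h2, h1.1.trans_lt h2.1]
  · rw [indicator_of_notMem h]
    simp only [mem_prod, mem_Iic, le_min_iff, mem_Ioi, max_lt_iff] at h
    unfold winInd
    split_ifs <;> simp; tauto

lemma Tame.abs {w : ℝ → ℝ} (hw : Tame a b w) : Tame a b (fun x => |w x|) := by
  obtain ⟨S, hS⟩ := hw.bounded
  exact ⟨hw.measurable.abs, ⟨S, fun x => by simpa using hS x⟩, fun x hx => by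
    simp [hw.support x hx]⟩

lemma Tame.integrable_rieszPot_mul (h0 : 0 < s) {v w : ℝ → ℝ} (hv : Tame a b v)
    (hw : Tame a b w) : Integrable (fun x => rieszPot s v x * w x) := by
  obtain ⟨S, hS⟩ := hw.bounded
  obtain ⟨S', hS'⟩ := hv.bounded
  have h1 : IntegrableOn (fun x => rieszPot s v x * w x) (Icc a b) := by
    refine Measure.integrableOn_of_bounded (M := S' * kerMass s (b - a) * S) (by simp)
      (hv.measurable_rieszPot.mul hw.measurable).aestronglyMeasurable ?_
    refine (ae_restrict_mem measurableSet_Icc).mono fun x hx => ?_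
    rw [norm_mul, Real.norm_eq_abs, Real.norm_eq_abs]
    exact mul_le_mul (hv.abs_rieszPot_le h0 hS' hx) (hS x) (abs_nonneg _)
      ((abs_nonneg _).trans (hv.abs_rieszPot_le h0 hS' hx))
  refine (integrableOn_iff_integrable_of_support_subset fun y hy => ?_).mp h1
  by_contra hy'
  exact hy (by simp [hw.support y hy'])

lemma Tame.integrable_ker_prod (h0 : 0 < s) {w : ℝ → ℝ} (hw : Tame a b w) :
    Integrable (fun z : ℝ × ℝ => |z.1 - z.2| ^ (s - 1) * w z.2 * w z.1) := by
  have hm : Measurable (fun z : ℝ × ℝ => |z.1 - z.2| ^ (s - 1) * w z.2 * w z.1) :=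
    (measurable_ker_mul hw.measurable).mul (hw.measurable.comp measurable_fst)
  rw [Measure.volume_eq_prod, integrable_prod_iff hm.aestronglyMeasurable]
  refine ⟨Filter.Eventually.of_forall fun x => (hw.ker_integrable h0 x).mul_const (w x), ?_⟩
  refine (hw.abs.integrable_rieszPot_mul h0 hw.abs).congr (Filter.Eventually.of_forall fun x => ?_)
  simp only [rieszPot, norm_mul, Real.norm_eq_abs, integral_mul_const,
    abs_of_nonneg (Real.rpow_nonneg (abs_nonneg _) _)]

/-- The quadratic form of the Riesz potential as an integral of squares of integrals over windows. -/
theorem Tame.integral_rieszPot_mul_self (h0 : 0 < s) (h1 : s < 1) {w : ℝ → ℝ} (hw : Tame a b w) :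
    Integrable (fun ω : ℝ × ℝ => winWeight s ω * (∫ x, winInd ω x * w x) ^ 2) ∧
    ∫ x, rieszPot s w x * w x
      = (1 - s) * (2 - s) * ∫ ω, winWeight s ω * (∫ x, winInd ω x * w x) ^ 2 := by
  have hκ : (1 - s) * (2 - s) ≠ 0 := by
    have : 0 < (1 - s) * (2 - s) := mul_pos (by linarith) (by linarith)
    exact this.ne'
  set H : (ℝ × ℝ) × (ℝ × ℝ) → ℝ := fun z =>
    winWeight s z.2 * ((winInd z.2 z.1.1 * w z.1.1) * (winInd z.2 z.1.2 * w z.1.2)) with hH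
  have hind : ∀ x y ω, H ((x, y), ω) = (w y * w x) *
      (Iic (min x y) ×ˢ Ioi (max x y)).indicator (fun ω : ℝ × ℝ => (ω.2 - ω.1) ^ (s - 3)) ω := by
    intro x y ω
    rw [← winWeight_mul_winInd, hH]; ring
  have hmeas : Measurable H := by
    refine (measurable_winWeight.comp measurable_snd).mul (Measurable.mul ?_ ?_)
    · exact (measurable_winInd.comp (measurable_snd.prodMk (measurable_fst.comp measurable_fst))).mul
        (hw.measurable.comp (measurable_fst.comp measurable_fst))
    · exact (measurable_winInd.comp (measurable_snd.prodMk (measurable_snd.comp measurable_fst))).mul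
        (hw.measurable.comp (measurable_snd.comp measurable_fst))
  have hne : ∀ᵐ z : ℝ × ℝ, z.1 ≠ z.2 := by
    rw [Measure.volume_eq_prod, Measure.ae_prod_iff_ae_ae]
    · refine Filter.Eventually.of_forall fun x => ?_
      have : ∀ᵐ y : ℝ, y ≠ x := Measure.ae_ne volume x
      exact this.mono fun y hy => Ne.symm hy
    · exact (measurableSet_eq_fun measurable_fst measurable_snd).compl
  have hsub : ∀ x y : ℝ, max x y - min x y = |x - y| := fun x y => max_sub_min_eq_abs' x y
  have hval : ∀ x y : ℝ, x ≠ y →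
      Integrable ((Iic (min x y) ×ˢ Ioi (max x y)).indicator
        (fun ω : ℝ × ℝ => (ω.2 - ω.1) ^ (s - 3))) ∧
      ∫ ω, (Iic (min x y) ×ˢ Ioi (max x y)).indicator
        (fun ω : ℝ × ℝ => (ω.2 - ω.1) ^ (s - 3)) ω = |x - y| ^ (s - 1) / ((1 - s) * (2 - s)) := by
    intro x y hxy
    have hms : MeasurableSet (Iic (min x y) ×ˢ Ioi (max x y)) :=
      measurableSet_Iic.prod measurableSet_Ioi
    obtain ⟨h2, h3⟩ := window_weight h0 h1 (min_lt_max.mpr hxy)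
    rw [hsub] at h3
    exact ⟨h2.integrable_indicator hms, by rw [integral_indicator hms, h3]⟩
  have hHint : Integrable H ((volume : Measure (ℝ × ℝ)).prod (volume : Measure (ℝ × ℝ))) := by
    rw [integrable_prod_iff hmeas.aestronglyMeasurable]
    constructor
    · refine hne.mono fun z hz => ?_
      obtain ⟨x, y⟩ := z
      simp only [hind]
      exact (hval x y hz).1.const_mul _
    · refine ((hw.integrable_ker_prod h0).norm.div_const ((1 - s) * (2 - s))).congr
        (hne.mono fun z hz => ?_)
      obtain ⟨x, y⟩ := z
      simp only [hind, norm_mul]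
      rw [integral_const_mul]
      have h4 : ∀ ω, ‖(Iic (min x y) ×ˢ Ioi (max x y)).indicator
          (fun ω : ℝ × ℝ => (ω.2 - ω.1) ^ (s - 3)) ω‖ = (Iic (min x y) ×ˢ Ioi (max x y)).indicator
          (fun ω : ℝ × ℝ => (ω.2 - ω.1) ^ (s - 3)) ω := fun ω => by
        refine Real.norm_of_nonneg (indicator_nonneg (fun ω hω => ?_) ω)
        have h5 := mem_Iic.mp hω.1
        have h6 := mem_Ioi.mp hω.2
        refine Real.rpow_nonneg ?_ _
        linarith [min_le_left x y, le_max_left x y]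
      simp only [h4]
      rw [(hval x y hz).2, Real.norm_of_nonneg (Real.rpow_nonneg (abs_nonneg (x - y)) (s - 1))]
      ring
  have hin : ∀ ω : ℝ × ℝ, ∫ z : ℝ × ℝ, H (z, ω) = winWeight s ω * (∫ x, winInd ω x * w x) ^ 2 := by
    intro ω
    simp only [hH]
    rw [integral_const_mul, Measure.volume_eq_prod,
      integral_prod_mul (fun x => winInd ω x * w x) (fun x => winInd ω x * w x), sq]
  have h5 := integral_prod_symm H hHint
  rw [integral_prod H hHint] at h5
  have h6 : ∫ z : ℝ × ℝ, ∫ ω, H (z, ω)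
      = ∫ z : ℝ × ℝ, (|z.1 - z.2| ^ (s - 1) * w z.2 * w z.1) / ((1 - s) * (2 - s)) := by
    refine integral_congr_ae (hne.mono fun z hz => ?_)
    obtain ⟨x, y⟩ := z
    simp only [hind]
    rw [integral_const_mul, (hval x y hz).2]
    ring
  have h7 : ∫ z : ℝ × ℝ, |z.1 - z.2| ^ (s - 1) * w z.2 * w z.1 = ∫ x, rieszPot s w x * w x := by
    have := hw.integrable_ker_prod h0
    rw [Measure.volume_eq_prod] at this ⊢
    rw [integral_prod _ this]
    simp only [rieszPot, integral_mul_const]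
  refine ⟨?_, ?_⟩
  · have := hHint.integral_prod_right
    simpa only [hin] using this
  · rw [h6, integral_div, h7] at h5
    simp only [hin] at h5
    rw [← h5, mul_div_cancel₀ _ hκ]

end
end LDG

namespace LDG
noncomputable section

/-! ### Meshes -/

namespace Mesh

variable {a b : ℝ} (M : Mesh a b)

lemma node_lt (j : Fin M.K) : M.node j.castSucc < M.node j.succ :=
  M.strictMono j.castSucc_lt_succ

lemma width_pos (j : Fin M.K) : 0 < M.width j := sub_pos.mpr (M.node_lt j)

lemma width_le_size (j : Fin M.K) : M.width j ≤ M.size :=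
  le_ciSup (Set.finite_range M.width).bddAbove j

lemma K_pos (hab : a < b) : 0 < M.K := by
  rcases Nat.eq_zero_or_pos M.K with h | h
  · exfalso
    have : (0 : Fin (M.K + 1)) = Fin.last M.K := Fin.ext (by simp [h])
    have h1 := M.node_zero
    rw [this, M.node_last] at h1
    linarith
  · exact h

lemma size_pos (hab : a < b) : 0 < M.size :=
  (M.width_pos ⟨0, M.K_pos hab⟩).trans_le (M.width_le_size _)

lemma node_mem (i : Fin (M.K + 1)) : M.node i ∈ Icc a b := by
  refine ⟨?_, ?_⟩
  · conv_lhs => rw [← M.node_zero]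
    exact M.strictMono.monotone (Fin.zero_le i)
  · conv_rhs => rw [← M.node_last]
    exact M.strictMono.monotone (Fin.le_last i)

lemma cell_subset (j : Fin M.K) : Icc (M.node j.castSucc) (M.node j.succ) ⊆ Icc a b :=
  Icc_subset_Icc (M.node_mem _).1 (M.node_mem _).2

lemma Ioo_cell_subset (j : Fin M.K) : Ioo (M.node j.castSucc) (M.node j.succ) ⊆ Ioo a b :=
  Ioo_subset_Ioo (M.node_mem _).1 (M.node_mem _).2

lemma node_succ_le {i j : Fin M.K} (h : i < j) : M.node i.succ ≤ M.node j.castSucc :=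
  M.strictMono.monotone (Fin.le_def.mpr (by simpa using h))

lemma eq_of_mem_cell {i j : Fin M.K} {x : ℝ} (hi : x ∈ Ico (M.node i.castSucc) (M.node i.succ))
    (hj : x ∈ Ico (M.node j.castSucc) (M.node j.succ)) : i = j := by
  rcases lt_trichotomy i j with h | h | h
  · linarith [M.node_succ_le h, hi.2, hj.1]
  · exact h
  · linarith [M.node_succ_le h, hj.2, hi.1]

lemma exists_mem_cell {x : ℝ} (hx : x ∈ Ico a b) :
    ∃ j : Fin M.K, x ∈ Ico (M.node j.castSucc) (M.node j.succ) := by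
  classical
  set S := Finset.univ.filter fun i => M.node i ≤ x with hS
  have h0 : (0 : Fin (M.K + 1)) ∈ S := by simp [hS, M.node_zero, hx.1]
  set i := S.max' ⟨0, h0⟩ with hi
  have hiS : M.node i ≤ x := (Finset.mem_filter.mp (S.max'_mem ⟨0, h0⟩)).2
  have hlast : i ≠ Fin.last M.K := by
    intro h
    rw [h, M.node_last] at hiS
    linarith [hx.2]
  obtain ⟨j, hj⟩ := Fin.exists_castSucc_eq.mpr hlast
  refine ⟨j, by rwa [hj], ?_⟩
  by_contra hcon
  have h1 : j.succ ∈ S := by simpa [hS] using not_lt.mp hcon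
  have h2 := S.le_max' _ h1
  rw [← hi, ← hj] at h2
  exact absurd h2 (not_le.mpr j.castSucc_lt_succ)

variable (P : Fin M.K → ℝ[X])

lemma toFun_of_mem {j : Fin M.K} {x : ℝ} (hx : x ∈ Ico (M.node j.castSucc) (M.node j.succ)) :
    M.toFun P x = (P j).eval x := by
  unfold toFun
  rw [Finset.sum_eq_single j]
  · rw [indicator_of_mem hx]
  · intro i _ hij
    exact indicator_of_notMem (fun hi => hij (M.eq_of_mem_cell hi hx)) _
  · simp

lemma toFun_of_notMem {x : ℝ} (hx : x ∉ Ico a b) : M.toFun P x = 0 := by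
  refine Finset.sum_eq_zero fun j _ => indicator_of_notMem (fun hj => hx ?_) _
  exact ⟨(M.node_mem _).1.trans hj.1, hj.2.trans_le (M.node_mem _).2⟩

lemma tame_toFun : Tame a b (M.toFun P) := by
  refine ⟨?_, ?_, fun x hx => M.toFun_of_notMem P fun h => hx ⟨h.1, h.2.le⟩⟩
  · exact Finset.measurable_sum _ fun j _ => (P j).continuous.measurable.indicator measurableSet_Ico
  · have : ∀ j, ∃ S, ∀ x ∈ Icc (M.node j.castSucc) (M.node j.succ), |(P j).eval x| ≤ S := fun j => by
      obtain ⟨S, hS⟩ := isCompact_Icc.exists_bound_of_continuousOn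
        (s := Icc (M.node j.castSucc) (M.node j.succ)) (P j).continuous.continuousOn
      exact ⟨S, hS⟩
    choose S hS using this
    have hS0 : ∀ j, 0 ≤ S j := fun j =>
      (abs_nonneg _).trans (hS j _ ⟨le_rfl, (M.node_lt j).le⟩)
    refine ⟨∑ j, S j, fun x => ?_⟩
    refine (Finset.abs_sum_le_sum_abs _ _).trans (Finset.sum_le_sum fun j _ => ?_)
    by_cases hx : x ∈ Ico (M.node j.castSucc) (M.node j.succ)
    · rw [indicator_of_mem hx]; exact hS j x ⟨hx.1, hx.2.le⟩
    · rw [indicator_of_notMem hx]; simpa using hS0 j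

lemma sum_sub_succ {n : ℕ} (g : Fin (n + 1) → ℝ) :
    ∑ j : Fin n, (g j.succ - g j.castSucc) = g (Fin.last n) - g 0 := by
  have h1 := Fin.sum_univ_succ g
  have h2 := Fin.sum_univ_castSucc g
  rw [Finset.sum_sub_distrib]; linarith

lemma sum_cellInt {φ : ℝ → ℝ} (hφ : IntegrableOn φ (Icc a b)) :
    ∑ j, M.cellInt j φ = ∫ x in Icc a b, φ x := by
  have hI : ∀ i, IntervalIntegrable φ volume a (M.node i) := fun i => by
    rw [intervalIntegrable_iff_integrableOn_Icc_of_le (M.node_mem i).1]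
    exact hφ.mono_set (Icc_subset_Icc_right (M.node_mem i).2)
  have h1 : ∀ j, M.cellInt j φ = (∫ x in a..M.node j.succ, φ x) - ∫ x in a..M.node j.castSucc, φ x :=
    fun j => (intervalIntegral.integral_interval_sub_left (hI _) (hI _)).symm
  simp only [h1]
  rw [sum_sub_succ fun i => ∫ x in a..M.node i, φ x, M.node_zero, M.node_last,
    intervalIntegral.integral_same, sub_zero, integral_Icc_eq_integral_Ioc,
    intervalIntegral.integral_of_le ((M.node_mem 0).1.trans (M.node_mem 0).2)]

lemma sum_cellInt_of_support {φ : ℝ → ℝ} (hφ : Integrable φ) (h0 : ∀ x ∉ Icc a b, φ x = 0) :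
    ∑ j, M.cellInt j φ = ∫ x, φ x := by
  rw [M.sum_cellInt hφ.integrableOn, setIntegral_eq_integral_of_forall_compl_eq_zero h0]

lemma cellInt_congr {j : Fin M.K} {φ ψ : ℝ → ℝ}
    (h : ∀ x ∈ Ioo (M.node j.castSucc) (M.node j.succ), φ x = ψ x) :
    M.cellInt j φ = M.cellInt j ψ := by
  unfold cellInt
  rw [intervalIntegral.integral_of_le (M.node_lt j).le, intervalIntegral.integral_of_le
    (M.node_lt j).le, integral_Ioc_eq_integral_Ioo, integral_Ioc_eq_integral_Ioo]
  exact setIntegral_congr_fun measurableSet_Ioo h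

lemma sum_cellBdry (φ : Fin (M.K + 1) → ℝ) (ψ : Fin M.K → ℝ[X]) :
    ∑ j, M.cellBdry j φ (ψ j) = -∑ i, φ i * (M.traceR ψ i - M.traceL ψ i) := by
  have h1 : ∑ i, φ i * M.traceL ψ i
      = ∑ j : Fin M.K, φ j.succ * (ψ j).eval (M.node j.succ) := by
    rw [Fin.sum_univ_succ]; simp [traceL]
  have h2 : ∑ i, φ i * M.traceR ψ i
      = ∑ j : Fin M.K, φ j.castSucc * (ψ j).eval (M.node j.castSucc) := by
    rw [Fin.sum_univ_castSucc]; simp [traceR]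
  simp only [cellBdry, mul_sub, Finset.sum_sub_distrib, h1, h2]
  ring

@[simp] lemma traceL_zero (ψ : Fin M.K → ℝ[X]) : M.traceL ψ 0 = 0 := rfl

@[simp] lemma traceR_last (ψ : Fin M.K → ℝ[X]) : M.traceR ψ (Fin.last M.K) = 0 := by simp [traceR]

@[simp] lemma traceL_succ (ψ : Fin M.K → ℝ[X]) (j : Fin M.K) :
    M.traceL ψ j.succ = (ψ j).eval (M.node j.succ) := rfl

@[simp] lemma traceR_castSucc (ψ : Fin M.K → ℝ[X]) (j : Fin M.K) :
    M.traceR ψ j.castSucc = (ψ j).eval (M.node j.castSucc) := by simp [traceR]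

lemma traceL_sub (φ ψ : Fin M.K → ℝ[X]) (i : Fin (M.K + 1)) :
    M.traceL (fun j => φ j - ψ j) i = M.traceL φ i - M.traceL ψ i := by
  refine Fin.cases ?_ (fun j => ?_) i <;> simp

lemma traceR_sub (φ ψ : Fin M.K → ℝ[X]) (i : Fin (M.K + 1)) :
    M.traceR (fun j => φ j - ψ j) i = M.traceR φ i - M.traceR ψ i := by
  refine Fin.lastCases ?_ (fun j => ?_) i <;> simp

lemma traceL_mul (φ ψ : Fin M.K → ℝ[X]) (i : Fin (M.K + 1)) :
    M.traceL (fun j => φ j * ψ j) i = M.traceL φ i * M.traceL ψ i := by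
  refine Fin.cases ?_ (fun j => ?_) i <;> simp

lemma traceR_mul (φ ψ : Fin M.K → ℝ[X]) (i : Fin (M.K + 1)) :
    M.traceR (fun j => φ j * ψ j) i = M.traceR φ i * M.traceR ψ i := by
  refine Fin.lastCases ?_ (fun j => ?_) i <;> simp

/-- Number of cells of a quasi-uniform mesh. -/
lemma card_mul_size_le {ρ : ℝ} (hρ : ∀ j, M.size ≤ ρ * M.width j) :
    M.K * M.size ≤ ρ * (b - a) := by
  have h1 : ∑ j, M.width j = b - a := by
    have := sum_sub_succ M.node
    rwa [M.node_last, M.node_zero] at this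
  rw [← h1, Finset.mul_sum]
  calc _ = ∑ _j : Fin M.K, M.size := by simp
    _ ≤ _ := Finset.sum_le_sum fun j _ => hρ j

end Mesh

/-! ### Coercivity of the Riesz potential on piecewise polynomials -/

lemma continuous_window_sq (p : ℝ[X]) :
    Continuous fun ω : ℝ × ℝ => (∫ z in ω.1..ω.2, p.eval z) ^ 2 := by
  have h0 : ∀ ω : ℝ × ℝ, ∫ z in ω.1..ω.2, p.eval z
      = (∫ z in (0 : ℝ)..ω.2, p.eval z) - ∫ z in (0 : ℝ)..ω.1, p.eval z := fun ω =>
    (intervalIntegral.integral_interval_sub_left (p.continuous.intervalIntegrable _ _)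
      (p.continuous.intervalIntegrable _ _)).symm
  have h1 : Continuous fun y => ∫ z in (0 : ℝ)..y, p.eval z :=
    intervalIntegral.continuous_primitive (fun _ _ => p.continuous.intervalIntegrable _ _) 0
  simp only [h0]
  exact ((h1.comp continuous_snd).sub (h1.comp continuous_fst)).pow 2

lemma one_le_sq_mul_winWeight {s h : ℝ} (h1 : s < 1) (hh : h ≤ 1) {ω : ℝ × ℝ} (hω : ω.1 < ω.2)
    (hle : ω.2 - ω.1 ≤ h) : 1 ≤ h ^ 2 * winWeight s ω := by
  have hd : 0 < ω.2 - ω.1 := sub_pos.mpr hω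
  rw [winWeight, if_pos hω]
  have h2 : (ω.2 - ω.1) ^ (-2 : ℝ) ≤ (ω.2 - ω.1) ^ (s - 3) :=
    Real.rpow_le_rpow_of_exponent_ge hd (hle.trans hh) (by linarith)
  have h3 : (ω.2 - ω.1) ^ (-2 : ℝ) = ((ω.2 - ω.1) ^ 2)⁻¹ := by
    rw [Real.rpow_neg hd.le]; norm_cast
  calc (1 : ℝ) = (ω.2 - ω.1) ^ 2 * ((ω.2 - ω.1) ^ 2)⁻¹ := by field_simp
    _ ≤ h ^ 2 * (ω.2 - ω.1) ^ (s - 3) := by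
      rw [← h3]
      gcongr

theorem exists_coercivity (k : ℕ) {s : ℝ} (h0 : 0 < s) (h1 : s < 1) :
    ∃ K : ℝ, 0 < K ∧ ∀ (a b : ℝ) (M : Mesh a b), M.size ≤ 1 → ∀ P : Fin M.K → ℝ[X],
      (∀ j, (P j).natDegree ≤ k) →
      ∑ j, M.width j * M.cellInt j (fun x => (P j).eval x ^ 2)
        ≤ K * ∫ x, rieszPot s (M.toFun P) x * M.toFun P x := by
  obtain ⟨K, hK, hwin⟩ := exists_eval_sq_le_window k
  have hκ : 0 < (1 - s) * (2 - s) := mul_pos (by linarith) (by linarith)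
  refine ⟨K / ((1 - s) * (2 - s)), by positivity, fun a b M hM P hP => ?_⟩
  obtain ⟨hI, hq⟩ := (M.tame_toFun P).integral_rieszPot_mul_self h0 h1
  set Ψ : ℝ × ℝ → ℝ := fun ω => winWeight s ω * (∫ x, winInd ω x * M.toFun P x) ^ 2 with hΨ
  have hΨ0 : ∀ ω, 0 ≤ Ψ ω := fun ω => mul_nonneg (winWeight_nonneg s ω) (sq_nonneg _)
  rw [hq, ← mul_assoc, div_mul_cancel₀ _ hκ.ne']
  let mid : Fin M.K → ℝ := fun j => (M.node j.castSucc + M.node j.succ) / 2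
  let S : Fin M.K → Set (ℝ × ℝ) := fun j =>
    Ioc (M.node j.castSucc) (mid j) ×ˢ Ioo (mid j) (M.node j.succ)
  have hml : ∀ j, M.node j.castSucc < mid j := fun j => by
    have := M.node_lt j; simp only [mid]; linarith
  have hmr : ∀ j, mid j < M.node j.succ := fun j => by
    have := M.node_lt j; simp only [mid]; linarith
  have hSm : ∀ j, MeasurableSet (S j) := fun j => measurableSet_Ioc.prod measurableSet_Ioo
  have hdisj : Pairwise (Function.onFun Disjoint S) := by
    intro i j hij
    refine Set.disjoint_left.mpr fun ω hi hj => hij ?_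
    exact M.eq_of_mem_cell ⟨hi.1.1.le, hi.1.2.trans_lt (hmr i)⟩ ⟨hj.1.1.le, hj.1.2.trans_lt (hmr j)⟩
  have hsum : ∑ j, ∫ ω in S j, Ψ ω ≤ ∫ ω, Ψ ω := by
    rw [← integral_biUnion_finset Finset.univ (fun j _ => hSm j)
      (fun i _ j _ hij => hdisj hij) (fun j _ => hI.integrableOn)]
    exact setIntegral_le_integral hI (Filter.Eventually.of_forall hΨ0)
  have hcell : ∀ j, M.width j * M.cellInt j (fun x => (P j).eval x ^ 2) ≤ K * ∫ ω in S j, Ψ ω := by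
    intro j
    have hh := M.width_pos j
    have hh1 : M.width j ≤ 1 := (M.width_le_size j).trans hM
    have hcont := continuous_window_sq (P j)
    have hIntS : IntegrableOn (fun ω : ℝ × ℝ => (∫ z in ω.1..ω.2, (P j).eval z) ^ 2) (S j) :=
      (hcont.continuousOn.integrableOn_compact (isCompact_Icc.prod isCompact_Icc)).mono_set
        (Set.prod_mono Ioc_subset_Icc_self Ioo_subset_Icc_self)
    have h2 : ∫ x in M.node j.castSucc..mid j, ∫ y in mid j..M.node j.succ,
        (∫ z in x..y, (P j).eval z) ^ 2 ≤ M.width j ^ 2 * ∫ ω in S j, Ψ ω := by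
      have h3 : ∫ x in M.node j.castSucc..mid j, ∫ y in mid j..M.node j.succ,
          (∫ z in x..y, (P j).eval z) ^ 2
          = ∫ ω in S j, (∫ z in ω.1..ω.2, (P j).eval z) ^ 2 := by
        rw [Measure.volume_eq_prod, setIntegral_prod _ (by
          rwa [Measure.volume_eq_prod] at hIntS)]
        rw [intervalIntegral.integral_of_le (hml j).le]
        refine integral_congr_ae (Filter.Eventually.of_forall fun x => ?_)
        simp only
        rw [intervalIntegral.integral_of_le (hmr j).le, integral_Ioc_eq_integral_Ioo]
      rw [h3, ← integral_const_mul]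
      refine setIntegral_mono_on hIntS (hI.integrableOn.const_mul _) (hSm j) fun ω hω => ?_
      obtain ⟨⟨h4, h5⟩, h6, h7⟩ := hω
      have hlt : ω.1 < ω.2 := h5.trans_lt h6
      have h8 : ∫ x, winInd ω x * M.toFun P x = ∫ z in ω.1..ω.2, (P j).eval z := by
        rw [intervalIntegral.integral_of_le hlt.le, integral_Ioc_eq_integral_Ioo,
          ← integral_Ico_eq_integral_Ioo, ← integral_indicator measurableSet_Ico]
        congr 1; ext x
        by_cases hx : x ∈ Ico ω.1 ω.2
        · rw [indicator_of_mem hx, winInd, if_pos (mem_Ico.mp hx), one_mul]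
          exact M.toFun_of_mem P ⟨h4.le.trans hx.1, hx.2.trans h7⟩
        · rw [indicator_of_notMem hx, winInd, if_neg (fun h => hx (mem_Ico.mpr h)), zero_mul]
      simp only [hΨ, h8]
      rw [← mul_assoc]
      refine le_mul_of_one_le_left (sq_nonneg _) (one_le_sq_mul_winWeight h1 hh1 hlt ?_)
      simp only [Mesh.width]; linarith
    have h9 : M.cellInt j (fun x => (P j).eval x ^ 2)
        ≤ M.width j * (K * (M.width j ^ 2 * ∫ ω in S j, Ψ ω) / M.width j ^ 4) := by
      unfold Mesh.cellInt
      have h10 : ∫ _x in (M.node j.castSucc)..(M.node j.succ),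
          (K * (M.width j ^ 2 * ∫ ω in S j, Ψ ω) / M.width j ^ 4)
          = M.width j * (K * (M.width j ^ 2 * ∫ ω in S j, Ψ ω) / M.width j ^ 4) := by
        rw [intervalIntegral.integral_const, smul_eq_mul]; rfl
      rw [← h10]
      refine intervalIntegral.integral_mono_on (M.node_lt j).le
        (Continuous.intervalIntegrable (by fun_prop) _ _) (by simp) fun x hx => ?_
      rw [le_div_iff₀ (by positivity)]
      exact (hwin _ _ (M.node_lt j) _ (hP j) x hx).trans (by gcongr)
    calc _ ≤ M.width j * (M.width j * (K * (M.width j ^ 2 * ∫ ω in S j, Ψ ω) / M.width j ^ 4)) := by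
          gcongr
      _ = _ := by field_simp
  calc _ ≤ ∑ j, K * ∫ ω in S j, Ψ ω := Finset.sum_le_sum fun j _ => hcell j
    _ = K * ∑ j, ∫ ω in S j, Ψ ω := (Finset.mul_sum _ _ _).symm
    _ ≤ _ := by gcongr

end
end LDG

namespace LDG
noncomputable section

/-! ### Jumps and derivatives of piecewise polynomials -/

lemma sq_integral_le {g : ℝ → ℝ} (hg : Continuous g) {l r : ℝ} (hlr : l < r) :
    (∫ x in l..r, g x) ^ 2 ≤ (r - l) * ∫ x in l..r, g x ^ 2 := by
  set I := ∫ x in l..r, g x with hI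
  have hh : 0 < r - l := sub_pos.mpr hlr
  have h0 : 0 ≤ ∫ x in l..r, ((r - l) * g x - I) ^ 2 :=
    intervalIntegral.integral_nonneg hlr.le fun x _ => sq_nonneg _
  have h1 : ∫ x in l..r, ((r - l) * g x - I) ^ 2
      = (r - l) ^ 2 * (∫ x in l..r, g x ^ 2) - 2 * (r - l) * I * I + (r - l) * I ^ 2 := by
    have : ∀ x, ((r - l) * g x - I) ^ 2
      = ((r - l) ^ 2 * g x ^ 2 - 2 * (r - l) * I * g x) + I ^ 2 := fun x => by ring
    simp only [this]
    rw [intervalIntegral.integral_add (Continuous.intervalIntegrable (by fun_prop) _ _)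
      (Continuous.intervalIntegrable (by fun_prop) _ _),
      intervalIntegral.integral_sub (Continuous.intervalIntegrable (by fun_prop) _ _)
      (Continuous.intervalIntegrable (by fun_prop) _ _),
      intervalIntegral.integral_const_mul, intervalIntegral.integral_const_mul,
      intervalIntegral.integral_const, smul_eq_mul]
  rw [h1] at h0
  have h2 : 0 ≤ (r - l) * ((r - l) * (∫ x in l..r, g x ^ 2) - I ^ 2) := by nlinarith
  linarith [nonneg_of_mul_nonneg_right h2 hh]

lemma natDegree_mul_derivative_le {k : ℕ} {ω ξ : ℝ[X]} (hω : ω.natDegree ≤ 1)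
    (hξ : ξ.natDegree ≤ k) : (ω * derivative ξ).natDegree ≤ k := by
  rcases Nat.eq_zero_or_pos ξ.natDegree with h | h
  · rw [natDegree_eq_zero.mp h |>.choose_spec.symm]; simp
  · have h1 := natDegree_derivative_le ξ
    have h2 := natDegree_mul_le (p := ω) (q := derivative ξ)
    omega

/-- One-cell estimate: if `π` represents the derivative of `ξ` together with point masses at two
points of the cell, then `π` and the mass at one point control `ξ'` and the other mass. -/
lemma jump_cell_le {k : ℕ} {l r n f K : ℝ} (hlr : l < r) (hK : 0 ≤ K) (hf : f ∈ Icc l r)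
    {ω ξ π : ℝ[X]} (hω : ω.natDegree ≤ 1) (hωn : ω.eval n = 0) (hωf : ω.eval f = r - l)
    (hω0 : ∀ x ∈ Icc l r, 0 ≤ ω.eval x ∧ ω.eval x ≤ r - l)
    (hsup : ∀ p : ℝ[X], p.natDegree ≤ k → ∀ x ∈ Icc l r,
      p.eval x ^ 2 * (r - l) ^ 2 ≤ K * ∫ x in l..r, ω.eval x * p.eval x ^ 2)
    (hξ : ξ.natDegree ≤ k) {An Af : ℝ}
    (h : ∀ z : ℝ[X], z.natDegree ≤ k → ∫ x in l..r, π.eval x * z.eval x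
      = (∫ x in l..r, (derivative ξ).eval x * z.eval x) + Af * z.eval f + An * z.eval n) :
    (r - l) * (∫ x in l..r, (derivative ξ).eval x ^ 2) + An ^ 2
      ≤ (3 + 8 * K + 16 * K ^ 2) * ((r - l) * (∫ x in l..r, π.eval x ^ 2) + Af ^ 2) := by
  set ξ' := derivative ξ with hξ'
  have hh : 0 < r - l := sub_pos.mpr hlr
  have hd' : ξ'.natDegree ≤ k := (natDegree_derivative_le ξ).trans (by omega)
  set N := ∫ x in l..r, π.eval x ^ 2 with hN
  set Y := ∫ x in l..r, ω.eval x * ξ'.eval x ^ 2 with hY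
  have hN0 : 0 ≤ N := intervalIntegral.integral_nonneg hlr.le fun x _ => sq_nonneg _
  have hY0 : 0 ≤ Y := intervalIntegral.integral_nonneg hlr.le fun x hx =>
    mul_nonneg (hω0 x hx).1 (sq_nonneg _)
  have h1 := h (ω * ξ') (natDegree_mul_derivative_le hω hξ)
  rw [eval_mul, eval_mul, hωn, hωf] at h1
  have h2 : ∫ x in l..r, ξ'.eval x * (ω * ξ').eval x = Y := by
    rw [hY]; congr 1; ext x; rw [eval_mul]; ring
  have h3 : ∫ x in l..r, π.eval x * (ω * ξ').eval x ≤ 1 / 2 * Y + (r - l) / 2 * N := by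
    rw [hY, hN, ← intervalIntegral.integral_const_mul, ← intervalIntegral.integral_const_mul,
      ← intervalIntegral.integral_add (Continuous.intervalIntegrable (by fun_prop) _ _)
      (Continuous.intervalIntegrable (by fun_prop) _ _)]
    refine intervalIntegral.integral_mono_on hlr.le (Continuous.intervalIntegrable (by fun_prop) _ _)
      (Continuous.intervalIntegrable (by fun_prop) _ _) fun x hx => ?_
    obtain ⟨h4, h5⟩ := hω0 x hx
    rw [eval_mul]
    nlinarith [mul_nonneg h4 (sq_nonneg (π.eval x - ξ'.eval x)),
      mul_le_mul_of_nonneg_right h5 (sq_nonneg (π.eval x))]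
  have h4 := hsup ξ' hd' f hf
  have h5 : -(Af * ((r - l) * ξ'.eval f)) ≤ K * Af ^ 2 + 1 / 4 * Y := by
    set e := (r - l) * ξ'.eval f with he
    have h6 : e ^ 2 ≤ K * Y := by rw [he]; linarith [mul_pow (r - l) (ξ'.eval f) 2]
    rcases eq_or_lt_of_le hK with hK0 | hK0
    · rw [← hK0, zero_mul] at h6
      have : e = 0 := pow_eq_zero_iff two_ne_zero |>.mp (le_antisymm h6 (sq_nonneg _))
      rw [this, ← hK0]; nlinarith
    · have h7 : 0 ≤ (2 * K * Af + e) ^ 2 := sq_nonneg _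
      have h8 : 0 ≤ K * (4 * (K * Af ^ 2 + Af * e) + Y) := by nlinarith
      have := nonneg_of_mul_nonneg_right h8 hK0
      linarith
  have hYle : Y ≤ 2 * (r - l) * N + 4 * K * Af ^ 2 := by
    rw [h2] at h1; linarith
  have hder : (r - l) * ∫ x in l..r, ξ'.eval x ^ 2 ≤ K * Y := by
    have h6 : ∫ x in l..r, ξ'.eval x ^ 2 ≤ ∫ _x in l..r, K * Y / (r - l) ^ 2 := by
      refine intervalIntegral.integral_mono_on hlr.le
        (Continuous.intervalIntegrable (by fun_prop) _ _) (by simp) fun x hx => ?_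
      rw [le_div_iff₀ (by positivity)]
      exact hsup ξ' hd' x hx
    rw [intervalIntegral.integral_const, smul_eq_mul] at h6
    calc _ ≤ (r - l) * ((r - l) * (K * Y / (r - l) ^ 2)) := by gcongr
      _ = K * Y := by field_simp
  have h6 := h 1 (by simp)
  simp only [eval_one, mul_one] at h6
  have h7 := sq_integral_le π.continuous hlr
  have h8 := sq_integral_le ξ'.continuous hlr
  have h9 : An ^ 2 ≤ 3 * ((∫ x in l..r, π.eval x) ^ 2 + (∫ x in l..r, ξ'.eval x) ^ 2 + Af ^ 2) := by
    have : An = (∫ x in l..r, π.eval x) - (∫ x in l..r, ξ'.eval x) - Af := by linarith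
    rw [this]
    nlinarith [sq_nonneg ((∫ x in l..r, π.eval x) + (∫ x in l..r, ξ'.eval x)),
      sq_nonneg ((∫ x in l..r, π.eval x) + Af), sq_nonneg ((∫ x in l..r, ξ'.eval x) - Af)]
  have h10 : K * Y ≤ K * (2 * (r - l) * N + 4 * K * Af ^ 2) := by gcongr
  have h11 : 0 ≤ (r - l) * N := by positivity
  have h12 : 0 ≤ K ^ 2 * ((r - l) * N) := by positivity
  nlinarith [mul_nonneg hK (sq_nonneg Af)]

/-- The trace of `U` in the penalty term: the interior trace at the right or the left end. -/
def penTrace {a b : ℝ} (M : Mesh a b) (d : Direction) (U : Fin M.K → ℝ[X]) : ℝ :=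
  match d with
  | .minusPlus => M.traceL U (Fin.last M.K)
  | .plusMinus => M.traceR U 0

/-- The jump at a node. -/
def Mesh.jump {a b : ℝ} (M : Mesh a b) (U : Fin M.K → ℝ[X]) (i : Fin (M.K + 1)) : ℝ :=
  M.traceR U i - M.traceL U i

variable {a b : ℝ}

lemma cellInt_by_parts (M : Mesh a b) (j : Fin M.K) (ξ z : ℝ[X]) :
    M.cellInt j (fun x => ξ.eval x * z.derivative.eval x)
      = ξ.eval (M.node j.succ) * z.eval (M.node j.succ)
        - ξ.eval (M.node j.castSucc) * z.eval (M.node j.castSucc)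
        - M.cellInt j (fun x => ξ.derivative.eval x * z.eval x) :=
  intervalIntegral.integral_mul_deriv_eq_deriv_mul (fun x _ => ξ.hasDerivAt x)
    (fun x _ => z.hasDerivAt x) (ξ.derivative.continuous.intervalIntegrable _ _)
    (z.derivative.continuous.intervalIntegrable _ _)

/-- The discrete derivative controls the derivatives on the cells and the jumps, up to the trace in
the penalty term. -/
theorem exists_jump_le (k : ℕ) : ∃ K : ℝ, 0 < K ∧ ∀ (a b : ℝ) (M : Mesh a b) (d : Direction)
    (ξ π : Fin M.K → ℝ[X]), (∀ j, (ξ j).natDegree ≤ k) →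
    (∀ j, ∀ z : ℝ[X], z.natDegree ≤ k → M.cellInt j (fun x => (π j).eval x * z.eval x)
      = M.cellBdry j (uHat M d ξ) z - M.cellInt j (fun x => (ξ j).eval x * z.derivative.eval x)) →
    ∑ j, M.width j * M.cellInt j (fun x => (ξ j).derivative.eval x ^ 2) + ∑ i, M.jump ξ i ^ 2
      ≤ K * (∑ j, M.width j * M.cellInt j (fun x => (π j).eval x ^ 2) + penTrace M d ξ ^ 2) := by
  obtain ⟨K₁, hK₁, hl⟩ := exists_eval_sq_le_left k
  obtain ⟨K₂, hK₂, hr⟩ := exists_eval_sq_le_right k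
  set c₁ := 3 + 8 * K₁ + 16 * K₁ ^ 2 with hc₁
  set c₂ := 3 + 8 * K₂ + 16 * K₂ ^ 2 with hc₂
  have hc₁0 : 0 < c₁ := by positivity
  have hc₂0 : 0 < c₂ := by positivity
  refine ⟨c₁ + c₂ + 1, by positivity, fun a b M d ξ π hξ h => ?_⟩
  have hX0 : 0 ≤ ∑ j, M.width j * M.cellInt j (fun x => (π j).eval x ^ 2) :=
    Finset.sum_nonneg fun j _ => mul_nonneg (M.width_pos j).le
      (intervalIntegral.integral_nonneg (M.node_lt j).le fun x _ => sq_nonneg _)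
  have hz : ∀ j, ∀ z : ℝ[X], z.natDegree ≤ k → M.cellInt j (fun x => (π j).eval x * z.eval x)
      = M.cellInt j (fun x => (ξ j).derivative.eval x * z.eval x)
        + (uHat M d ξ j.succ - (ξ j).eval (M.node j.succ)) * z.eval (M.node j.succ)
        + ((ξ j).eval (M.node j.castSucc) - uHat M d ξ j.castSucc) * z.eval (M.node j.castSucc) := by
    intro j z hzk
    rw [h j z hzk, cellInt_by_parts, Mesh.cellBdry]; ring
  cases d with
  | minusPlus =>
    have hcell : ∀ j, M.width j * M.cellInt j (fun x => (ξ j).derivative.eval x ^ 2)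
        + M.jump ξ j.castSucc ^ 2 ≤ c₁ * (M.width j * M.cellInt j (fun x => (π j).eval x ^ 2)
          + if j.succ = Fin.last M.K then penTrace M .minusPlus ξ ^ 2 else 0) := by
      intro j
      have h1 := jump_cell_le (n := M.node j.castSucc) (f := M.node j.succ) (M.node_lt j) hK₁.le
        ⟨(M.node_lt j).le, le_rfl⟩ (ω := X - C (M.node j.castSucc)) (by compute_degree) (by simp)
        (by simp) (fun x hx => by
          simp only [eval_sub, eval_X, eval_C]; constructor <;> linarith [hx.1, hx.2])
        (fun p hp x hx => by simpa using hl _ _ (M.node_lt j) p hp x hx) (hξ j) (hz j)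
      have h2 : (ξ j).eval (M.node j.castSucc) - uHat M .minusPlus ξ j.castSucc
          = M.jump ξ j.castSucc := by
        simp [Mesh.jump, uHat, j.castSucc_lt_last.ne]
      rw [h2] at h1
      refine h1.trans (mul_le_mul_of_nonneg_left (add_le_add le_rfl ?_) hc₁0.le)
      split_ifs with h3
      · simp only [uHat, h3, penTrace, if_true]
        rw [← h3, Mesh.traceL_succ, zero_sub, neg_sq]
      · simp [uHat, h3]
    have hs := Finset.sum_le_sum fun j (_ : j ∈ Finset.univ) => hcell j
    rw [Finset.sum_add_distrib, ← Finset.mul_sum, Finset.sum_add_distrib] at hs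
    have hlast : ∑ j : Fin M.K, (if j.succ = Fin.last M.K then penTrace M .minusPlus ξ ^ 2 else 0)
        ≤ penTrace M .minusPlus ξ ^ 2 := by
      have h4 := Fin.sum_univ_succ fun i : Fin (M.K + 1) =>
        if i = Fin.last M.K then penTrace M .minusPlus ξ ^ 2 else 0
      rw [Finset.sum_ite_eq' Finset.univ, if_pos (Finset.mem_univ _)] at h4
      refine (le_add_of_nonneg_left ?_).trans_eq h4.symm
      split_ifs
      · exact sq_nonneg _
      · exact le_rfl
    rw [Fin.sum_univ_castSucc]
    have h5 : M.jump ξ (Fin.last M.K) ^ 2 = penTrace M .minusPlus ξ ^ 2 := by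
      simp [Mesh.jump, penTrace]
    rw [h5]
    nlinarith [sq_nonneg (penTrace M .minusPlus ξ)]
  | plusMinus =>
    have hcell : ∀ j, M.width j * M.cellInt j (fun x => (ξ j).derivative.eval x ^ 2)
        + M.jump ξ j.succ ^ 2 ≤ c₂ * (M.width j * M.cellInt j (fun x => (π j).eval x ^ 2)
          + if j.castSucc = 0 then penTrace M .plusMinus ξ ^ 2 else 0) := by
      intro j
      have h1 := jump_cell_le (n := M.node j.succ) (f := M.node j.castSucc) (M.node_lt j) hK₂.le
        ⟨le_rfl, (M.node_lt j).le⟩ (ω := C (M.node j.succ) - X) (by compute_degree) (by simp)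
        (by simp) (fun x hx => by
          simp only [eval_sub, eval_X, eval_C]; constructor <;> linarith [hx.1, hx.2])
        (fun p hp x hx => by simpa using hr _ _ (M.node_lt j) p hp x hx) (hξ j)
        (fun z hzk => (hz j z hzk).trans (add_right_comm _ _ _))
      have h2 : uHat M .plusMinus ξ j.succ - (ξ j).eval (M.node j.succ)
          = M.jump ξ j.succ := by
        simp [Mesh.jump, uHat]
      rw [h2] at h1
      refine h1.trans (mul_le_mul_of_nonneg_left (add_le_add le_rfl ?_) hc₂0.le)
      split_ifs with h3
      · simp only [uHat, h3, penTrace, if_true, sub_zero]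
        rw [← h3, Mesh.traceR_castSucc]
      · simp [uHat, h3]
    have hs := Finset.sum_le_sum fun j (_ : j ∈ Finset.univ) => hcell j
    rw [Finset.sum_add_distrib, ← Finset.mul_sum, Finset.sum_add_distrib] at hs
    have hlast : ∑ j : Fin M.K, (if j.castSucc = 0 then penTrace M .plusMinus ξ ^ 2 else 0)
        ≤ penTrace M .plusMinus ξ ^ 2 := by
      have h4 := Fin.sum_univ_castSucc fun i : Fin (M.K + 1) =>
        if i = 0 then penTrace M .plusMinus ξ ^ 2 else 0
      rw [Finset.sum_ite_eq' Finset.univ, if_pos (Finset.mem_univ _)] at h4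
      refine (le_add_of_nonneg_right ?_).trans_eq h4.symm
      split_ifs
      · exact sq_nonneg _
      · exact le_rfl
    rw [Fin.sum_univ_succ]
    have h5 : M.jump ξ 0 ^ 2 = penTrace M .plusMinus ξ ^ 2 := by
      simp [Mesh.jump, penTrace]
    rw [h5]
    nlinarith [sq_nonneg (penTrace M .plusMinus ξ)]

/-- The alternating fluxes are skew up to the penalty. -/
lemma sum_flux_identity (M : Mesh a b) (hab : a < b) (d : Direction) (β : ℝ)
    (U Q : Fin M.K → ℝ[X]) :
    ∑ i, (qHat M d β U Q i * M.jump U i + uHat M d U i * M.jump Q i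
      - (M.traceR U i * M.traceR Q i - M.traceL U i * M.traceL Q i))
      = β / M.size * penTrace M d U ^ 2 := by
  have h0 : (0 : Fin (M.K + 1)) ≠ Fin.last M.K := fun h => by
    have := M.K_pos hab
    have h1 := congrArg Fin.val h
    simp at h1; omega
  cases d with
  | minusPlus =>
    rw [Finset.sum_eq_single (Fin.last M.K)]
    · simp [qHat, uHat, Mesh.jump, penTrace]; ring
    · intro i _ hi
      simp only [qHat, uHat, Mesh.jump, if_neg hi]; ring
    · simp
  | plusMinus =>
    rw [Finset.sum_eq_single 0]
    · simp [qHat, uHat, Mesh.jump, penTrace]; ring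
    · intro i _ hi
      simp only [qHat, uHat, Mesh.jump, if_neg hi]; ring
    · simp

/-! ### The convection term -/

/-- The numerical flux of a monotone scheme dissipates every entropy of the form `A' = f`. -/
lemma IsMonotoneFlux.mul_sub_le {f : ℝ → ℝ} {F : ℝ → ℝ → ℝ} (hF : IsMonotoneFlux f F) {A : ℝ → ℝ}
    (hA : ∀ x, HasDerivAt A (f x) x) (v w : ℝ) : F v w * (w - v) ≤ A w - A v := by
  have hAc : Continuous A := continuous_iff_continuousAt.mpr fun x => (hA x).continuousAt
  rcases lt_trichotomy v w with h | h | h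
  · obtain ⟨c, hc, he⟩ := exists_hasDerivAt_eq_slope A f h hAc.continuousOn fun x _ => hA x
    rw [eq_div_iff (by linarith)] at he
    rw [← he, ← hF.consistent]
    refine mul_le_mul_of_nonneg_right ?_ (by linarith)
    exact (hF.mono_left w hc.1.le).trans (hF.anti_right c hc.2.le)
  · subst h; simp
  · obtain ⟨c, hc, he⟩ := exists_hasDerivAt_eq_slope A f h hAc.continuousOn fun x _ => hA x
    rw [eq_div_iff (by linarith)] at he
    rw [show A w - A v = -(A v - A w) by ring, ← he, ← hF.consistent]
    have : F c c ≤ F v w := (hF.mono_left c hc.2.le).trans (hF.anti_right v hc.1.le)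
    nlinarith

lemma cellInt_mono (M : Mesh a b) {j : Fin M.K} {φ ψ : ℝ → ℝ} (hφ : Continuous φ)
    (hψ : Continuous ψ)
    (h : ∀ x ∈ Icc (M.node j.castSucc) (M.node j.succ), φ x ≤ ψ x) :
    M.cellInt j φ ≤ M.cellInt j ψ :=
  intervalIntegral.integral_mono_on (M.node_lt j).le (hφ.intervalIntegrable _ _)
    (hψ.intervalIntegrable _ _) h

lemma cellInt_add (M : Mesh a b) (j : Fin M.K) {φ ψ : ℝ → ℝ} (hφ : Continuous φ)
    (hψ : Continuous ψ) : M.cellInt j (fun x => φ x + ψ x) = M.cellInt j φ + M.cellInt j ψ :=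
  intervalIntegral.integral_add (hφ.intervalIntegrable _ _) (hψ.intervalIntegrable _ _)

lemma cellInt_sub (M : Mesh a b) (j : Fin M.K) {φ ψ : ℝ → ℝ} (hφ : Continuous φ)
    (hψ : Continuous ψ) : M.cellInt j (fun x => φ x - ψ x) = M.cellInt j φ - M.cellInt j ψ :=
  intervalIntegral.integral_sub (hφ.intervalIntegrable _ _) (hψ.intervalIntegrable _ _)

lemma cellInt_const_mul (M : Mesh a b) (j : Fin M.K) (c : ℝ) (φ : ℝ → ℝ) :
    M.cellInt j (fun x => c * φ x) = c * M.cellInt j φ :=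
  intervalIntegral.integral_const_mul _ _

/-- Local constants for the convection term on `[-R, R]`. -/
structure ConvectionBounds (f f' : ℝ → ℝ) (F : ℝ → ℝ → ℝ) (R L L' : ℝ) : Prop where
  lip : ∀ x ∈ Icc (-R) R, ∀ y ∈ Icc (-R) R, |f x - f y| ≤ L * |x - y|
  lip_deriv : ∀ x ∈ Icc (-R) R, ∀ y ∈ Icc (-R) R, |f' x - f' y| ≤ L' * |x - y|
  lip_flux : ∀ x ∈ Icc (-R) R, ∀ y ∈ Icc (-R) R, ∀ x' ∈ Icc (-R) R, ∀ y' ∈ Icc (-R) R,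
    |F x y - F x' y'| ≤ L * max |x - x'| |y - y'|

lemma convection_cell_le (M : Mesh a b) {f f' A u u' : ℝ → ℝ} {F : ℝ → ℝ → ℝ}
    (hf : ∀ x, HasDerivAt f (f' x) x) (hA : ∀ x, HasDerivAt A (f x) x) (hf' : Continuous f')
    (hu : ∀ x, HasDerivAt u (u' x) x) (hu' : Continuous u') {S L L' δ : ℝ}
    (hL : 0 ≤ L) (hL' : 0 ≤ L') (hb : ConvectionBounds f f' F (S + 2) L L')
    (hS : ∀ x ∈ Icc a b, |u x| ≤ S) (hS' : ∀ x ∈ Icc a b, |u' x| ≤ S) (hδ : δ ≤ 1)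
    (j : Fin M.K) {ξ V : ℝ[X]}
    (hξ : ∀ x ∈ Icc (M.node j.castSucc) (M.node j.succ), |ξ.eval x| ≤ 1)
    (hV : ∀ x ∈ Icc (M.node j.castSucc) (M.node j.succ), |V.eval x - u x| ≤ δ) :
    M.cellInt j (fun x => (f (u x) - f ((V - ξ).eval x)) * ξ.derivative.eval x)
      ≤ (f (u (M.node j.succ)) * ξ.eval (M.node j.succ) - A (u (M.node j.succ))
          + A (u (M.node j.succ) - ξ.eval (M.node j.succ)))
        - (f (u (M.node j.castSucc)) * ξ.eval (M.node j.castSucc) - A (u (M.node j.castSucc))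
          + A (u (M.node j.castSucc) - ξ.eval (M.node j.castSucc)))
        + S * L' * M.cellInt j (fun x => ξ.eval x ^ 2)
        + L * δ * M.cellInt j (fun x => |ξ.derivative.eval x|) := by
  have hfc : Continuous f := continuous_iff_continuousAt.mpr fun x => (hf x).continuousAt
  have huc : Continuous u := continuous_iff_continuousAt.mpr fun x => (hu x).continuousAt
  have hFTC : M.cellInt j (fun x => (f (u x) - f (u x - ξ.eval x)) * ξ.derivative.eval x
      + u' x * (f' (u x) * ξ.eval x - f (u x) + f (u x - ξ.eval x)))
      = (f (u (M.node j.succ)) * ξ.eval (M.node j.succ) - A (u (M.node j.succ))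
          + A (u (M.node j.succ) - ξ.eval (M.node j.succ)))
        - (f (u (M.node j.castSucc)) * ξ.eval (M.node j.castSucc) - A (u (M.node j.castSucc))
          + A (u (M.node j.castSucc) - ξ.eval (M.node j.castSucc))) := by
    refine intervalIntegral.integral_eq_sub_of_hasDerivAt (f := fun x =>
      f (u x) * ξ.eval x - A (u x) + A (u x - ξ.eval x)) (fun x _ => ?_)
      (Continuous.intervalIntegrable (by fun_prop) _ _)
    have h1 : HasDerivAt (fun x => f (u x)) (f' (u x) * u' x) x := (hf (u x)).comp x (hu x)
    have h2 : HasDerivAt (fun x => A (u x)) (f (u x) * u' x) x := (hA (u x)).comp x (hu x)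
    have h3 : HasDerivAt (fun x => A (u x - ξ.eval x))
        (f (u x - ξ.eval x) * (u' x - ξ.derivative.eval x)) x :=
      (hA (u x - ξ.eval x)).comp x ((hu x).sub (ξ.hasDerivAt x))
    refine (((h1.mul (ξ.hasDerivAt x)).sub h2).add h3).congr_deriv ?_
    ring
  rw [← hFTC, add_assoc, ← cellInt_const_mul, ← cellInt_const_mul,
    ← cellInt_add M j (by fun_prop) (by fun_prop), ← cellInt_add M j (by fun_prop) (by fun_prop)]
  refine cellInt_mono M (by fun_prop) (by fun_prop) fun x hx => ?_
  have hxab := M.cell_subset j hx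
  have hu1 := abs_le.mp (hS x hxab)
  have hξ1 := abs_le.mp (hξ x hx)
  have hV1 := abs_le.mp (hV x hx)
  have hmu : u x ∈ Icc (-(S + 2)) (S + 2) := ⟨by linarith, by linarith⟩
  have hmw : u x - ξ.eval x ∈ Icc (-(S + 2)) (S + 2) := ⟨by linarith, by linarith⟩
  have hmU : (V - ξ).eval x ∈ Icc (-(S + 2)) (S + 2) := by
    rw [eval_sub]; exact ⟨by linarith, by linarith⟩
  have h1 : (f (u x - ξ.eval x) - f ((V - ξ).eval x)) * ξ.derivative.eval x
      ≤ L * δ * |ξ.derivative.eval x| := by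
    refine (le_abs_self _).trans ?_
    rw [abs_mul]
    refine mul_le_mul_of_nonneg_right ((hb.lip _ hmw _ hmU).trans ?_) (abs_nonneg _)
    refine mul_le_mul_of_nonneg_left ?_ hL
    rw [eval_sub, abs_sub_comm]
    simpa using hV x hx
  have h2 : |f' (u x) * ξ.eval x - f (u x) + f (u x - ξ.eval x)| ≤ L' * ξ.eval x ^ 2 := by
    have hmv : ∃ c ∈ Icc (-(S + 2)) (S + 2), f (u x) - f (u x - ξ.eval x) = f' c * ξ.eval x ∧
        |u x - c| ≤ |ξ.eval x| := by
      rcases lt_trichotomy (ξ.eval x) 0 with h | h | h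
      · obtain ⟨c, hc, he⟩ := exists_hasDerivAt_eq_slope f f' (a := u x) (b := u x - ξ.eval x)
          (by linarith) hfc.continuousOn fun y _ => hf y
        rw [eq_div_iff (by linarith)] at he
        refine ⟨c, ⟨by linarith [hc.1], by linarith [hc.2]⟩, by linarith, ?_⟩
        rw [abs_of_neg h, abs_of_neg (by linarith [hc.1])]; linarith [hc.2]
      · exact ⟨u x, hmu, by simp [h], by simp [h]⟩
      · obtain ⟨c, hc, he⟩ := exists_hasDerivAt_eq_slope f f' (a := u x - ξ.eval x) (b := u x)
          (by linarith) hfc.continuousOn fun y _ => hf y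
        rw [eq_div_iff (by linarith)] at he
        refine ⟨c, ⟨by linarith [hc.1], by linarith [hc.2]⟩, by linarith, ?_⟩
        rw [abs_of_pos h, abs_of_pos (by linarith [hc.2])]; linarith [hc.1]
    obtain ⟨c, hc, he, hcx⟩ := hmv
    have h3 : f' (u x) * ξ.eval x - f (u x) + f (u x - ξ.eval x) = (f' (u x) - f' c) * ξ.eval x := by
      linarith
    rw [h3, abs_mul, ← sq_abs (ξ.eval x), sq, ← mul_assoc]
    refine mul_le_mul_of_nonneg_right ((hb.lip_deriv _ hmu _ hc).trans ?_) (abs_nonneg _)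
    gcongr
  have h3 : -(u' x * (f' (u x) * ξ.eval x - f (u x) + f (u x - ξ.eval x)))
      ≤ S * L' * ξ.eval x ^ 2 := by
    refine (neg_le_abs _).trans ?_
    rw [abs_mul, mul_assoc]
    exact mul_le_mul (hS' x hxab) h2 (abs_nonneg _) ((abs_nonneg _).trans (hS' x hxab))
  linarith

theorem convection_le (M : Mesh a b) {f f' u u' : ℝ → ℝ} {F : ℝ → ℝ → ℝ}
    (hF : IsMonotoneFlux f F)
    (hf : ∀ x, HasDerivAt f (f' x) x) (hf' : Continuous f')
    (hu : ∀ x, HasDerivAt u (u' x) x) (hu' : Continuous u') (hua : u a = 0) (hub : u b = 0)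
    {S L L' δ : ℝ} (hL : 0 ≤ L) (hL' : 0 ≤ L') (hb : ConvectionBounds f f' F (S + 2) L L')
    (hS : ∀ x ∈ Icc a b, |u x| ≤ S) (hS' : ∀ x ∈ Icc a b, |u' x| ≤ S) (hδ0 : 0 ≤ δ) (hδ : δ ≤ 1)
    {ξ V : Fin M.K → ℝ[X]}
    (hξ : ∀ j, ∀ x ∈ Icc (M.node j.castSucc) (M.node j.succ), |(ξ j).eval x| ≤ 1)
    (hV : ∀ j, ∀ x ∈ Icc (M.node j.castSucc) (M.node j.succ), |(V j).eval x - u x| ≤ δ) :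
    ∑ i, (f (u (M.node i)) - fHat M F (fun j => V j - ξ j) i) * M.jump ξ i
      + ∑ j, M.cellInt j (fun x => (f (u x) - f ((V j - ξ j).eval x)) * (ξ j).derivative.eval x)
      ≤ S * L' * ∑ j, M.cellInt j (fun x => (ξ j).eval x ^ 2)
        + L * δ * (∑ i, |M.jump ξ i| + ∑ j, M.cellInt j (fun x => |(ξ j).derivative.eval x|)) := by
  have hfc : Continuous f := continuous_iff_continuousAt.mpr fun x => (hf x).continuousAt
  set A : ℝ → ℝ := fun y => ∫ x in (0 : ℝ)..y, f x with hAdef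
  have hA : ∀ x, HasDerivAt A (f x) x := fun x => (hfc.integral_hasStrictDerivAt 0 x).hasDerivAt
  set Φ : ℝ → ℝ → ℝ := fun v e => f v * e - A v + A (v - e) with hΦ
  have hΦ0 : ∀ v, Φ v 0 = 0 := fun v => by simp [hΦ]
  have hcells := Finset.sum_le_sum fun j (_ : j ∈ (Finset.univ : Finset (Fin M.K))) =>
    convection_cell_le M hf hA hf' hu hu' hL hL' hb hS hS' hδ j (hξ j) (hV j)
  rw [Finset.sum_add_distrib, Finset.sum_add_distrib, ← Finset.mul_sum, ← Finset.mul_sum] at hcells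
  have htel : ∑ j : Fin M.K, (Φ (u (M.node j.succ)) ((ξ j).eval (M.node j.succ))
      - Φ (u (M.node j.castSucc)) ((ξ j).eval (M.node j.castSucc)))
      = ∑ i, (Φ (u (M.node i)) (M.traceL ξ i) - Φ (u (M.node i)) (M.traceR ξ i)) := by
    rw [Finset.sum_sub_distrib, Finset.sum_sub_distrib,
      Fin.sum_univ_succ fun i => Φ (u (M.node i)) (M.traceL ξ i),
      Fin.sum_univ_castSucc fun i => Φ (u (M.node i)) (M.traceR ξ i)]
    simp [hΦ0]
  have hnodeV : ∀ i, |u (M.node i)| ≤ S := fun i => hS _ (M.node_mem i)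
  have hS0 : 0 ≤ S := (abs_nonneg _).trans (hnodeV 0)
  have hLξ : ∀ i, |M.traceL ξ i| ≤ 1 := fun i => by
    refine Fin.cases (by simp) (fun j => ?_) i
    exact hξ j _ ⟨(M.node_lt j).le, le_rfl⟩
  have hRξ : ∀ i, |M.traceR ξ i| ≤ 1 := fun i => by
    refine Fin.lastCases (by simp) (fun j => ?_) i
    rw [M.traceR_castSucc]; exact hξ j _ ⟨le_rfl, (M.node_lt j).le⟩
  have hLV : ∀ i, |M.traceL V i - u (M.node i)| ≤ δ := fun i => by
    refine Fin.cases (by simpa [M.node_zero, hua] using hδ0) (fun j => ?_) i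
    exact hV j _ ⟨(M.node_lt j).le, le_rfl⟩
  have hRV : ∀ i, |M.traceR V i - u (M.node i)| ≤ δ := fun i => by
    refine Fin.lastCases (by simpa [M.node_last, hub] using hδ0) (fun j => ?_) i
    rw [M.traceR_castSucc]; exact hV j _ ⟨le_rfl, (M.node_lt j).le⟩
  have hnode : ∀ i, (f (u (M.node i)) - fHat M F (fun j => V j - ξ j) i) * M.jump ξ i
      + (Φ (u (M.node i)) (M.traceL ξ i) - Φ (u (M.node i)) (M.traceR ξ i))
      ≤ L * δ * |M.jump ξ i| := by
    intro i
    rw [fHat, M.traceL_sub, M.traceR_sub]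
    set v := u (M.node i) with hv
    set eL := M.traceL ξ i with heL
    set eR := M.traceR ξ i with heR
    have h1 := hF.mul_sub_le hA (v - eL) (v - eR)
    have b1 := abs_le.mp (hnodeV i)
    have b2 := abs_le.mp (hLξ i)
    have b3 := abs_le.mp (hRξ i)
    have b4 := abs_le.mp (hLV i)
    have b5 := abs_le.mp (hRV i)
    have h2 : (F (v - eL) (v - eR) - F (M.traceL V i - eL) (M.traceR V i - eR)) * M.jump ξ i
        ≤ L * δ * |M.jump ξ i| := by
      refine (le_abs_self _).trans ?_
      rw [abs_mul]
      refine mul_le_mul_of_nonneg_right ((hb.lip_flux _ ⟨by linarith, by linarith⟩ _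
        ⟨by linarith, by linarith⟩ _ ⟨by linarith, by linarith⟩ _
        ⟨by linarith, by linarith⟩).trans ?_) (abs_nonneg _)
      refine mul_le_mul_of_nonneg_left (max_le ?_ ?_) hL
      · rw [abs_sub_comm]; simpa using hLV i
      · rw [abs_sub_comm]; simpa using hRV i
    have h3 : M.jump ξ i = eR - eL := rfl
    rw [h3] at h2 ⊢
    simp only [hΦ]
    linarith
  have hnodes := Finset.sum_le_sum fun i (_ : i ∈ Finset.univ) => hnode i
  rw [Finset.sum_add_distrib, ← Finset.mul_sum, ← htel] at hnodes
  simp only [hΦ] at hnodes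
  linarith

end
end LDG

namespace LDG
noncomputable section

/-! ### The energy identity at a fixed time -/

/-- An exact solution at a fixed time; `u'` and `q'` are the derivatives in space, `v` the
derivative in time. -/
structure ExactSlice (s ε a b : ℝ) (f f' g u u' v q q' : ℝ → ℝ) : Prop where
  hasDerivAt_u : ∀ x, HasDerivAt u (u' x) x
  continuous_u' : Continuous u'
  continuous_v : Continuous v
  hasDerivAt_q : ∀ x, HasDerivAt q (q' x) x
  continuous_q' : Continuous q'
  tame : Tame a b (fun x => √ε * u' x)
  q_eq : ∀ x, q x = rieszInt s (fun y => √ε * u' y) x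
  left_zero : u a = 0
  right_zero : u b = 0
  equation : ∀ x ∈ Ioo a b, v x + f' (u x) * u' x = √ε * q' x + g x

/-- The equations of the scheme at a fixed time. -/
structure SchemeSlice {a b : ℝ} (M : Mesh a b) (k : ℕ) (d : Direction) (s ε β : ℝ)
    (f : ℝ → ℝ) (F : ℝ → ℝ → ℝ) (g : ℝ → ℝ) (U U' P Q : Fin M.K → ℝ[X]) : Prop where
  degree_U : ∀ j, (U j).natDegree ≤ k
  degree_P : ∀ j, (P j).natDegree ≤ k
  degree_Q : ∀ j, (Q j).natDegree ≤ k
  eq_u : ∀ j, ∀ v : ℝ[X], v.natDegree ≤ k →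
    M.cellInt j (fun x => (U' j).eval x * v.eval x)
      + M.cellBdry j (fun i => fHat M F U i - √ε * qHat M d β U Q i) v
      - M.cellInt j (fun x => (f ((U j).eval x) - √ε * (Q j).eval x) * v.derivative.eval x)
      = M.cellInt j (fun x => g x * v.eval x)
  eq_q : ∀ j, ∀ w : ℝ[X], w.natDegree ≤ k →
    M.cellInt j (fun x => (Q j).eval x * w.eval x)
      - M.cellInt j (fun x => rieszInt s (M.toFun P) x * w.eval x) = 0
  eq_p : ∀ j, ∀ z : ℝ[X], z.natDegree ≤ k →
    M.cellInt j (fun x => (P j).eval x * z.eval x)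
      - √ε * M.cellBdry j (uHat M d U) z
      + √ε * M.cellInt j (fun x => (U j).eval x * z.derivative.eval x) = 0

/-- Projections `V`, `R` of `u`, `p`, for which the equation for `p` has no consistency error. -/
structure Comparison {a b : ℝ} (M : Mesh a b) (k : ℕ) (d : Direction) (u p : ℝ → ℝ)
    (V R : Fin M.K → ℝ[X]) : Prop where
  degree_V : ∀ j, (V j).natDegree ≤ k
  degree_R : ∀ j, (R j).natDegree ≤ k
  orth_V : ∀ j, ∀ z : ℝ[X], z.natDegree ≤ k →
    M.cellInt j (fun x => (V j).eval x * z.derivative.eval x)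
      = M.cellInt j (fun x => u x * z.derivative.eval x)
  uHat_V : ∀ i, uHat M d V i = u (M.node i)
  pen_V : penTrace M d V = 0
  orth_R : ∀ j, ∀ z : ℝ[X], z.natDegree ≤ k →
    M.cellInt j (fun x => (R j).eval x * z.eval x) = M.cellInt j (fun x => p x * z.eval x)

variable {a b : ℝ} {M : Mesh a b} {k : ℕ} {d : Direction} {s ε β : ℝ}

lemma uHat_sub (M : Mesh a b) (d : Direction) (U V : Fin M.K → ℝ[X]) (i : Fin (M.K + 1)) :
    uHat M d (fun j => U j - V j) i = uHat M d U i - uHat M d V i := by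
  cases d <;> simp only [uHat] <;> split_ifs <;> simp [M.traceL_sub, M.traceR_sub]

lemma qHat_sub (M : Mesh a b) (d : Direction) (β : ℝ) (U V Q R : Fin M.K → ℝ[X])
    (i : Fin (M.K + 1)) :
    qHat M d β (fun j => U j - V j) (fun j => Q j - R j) i
      = qHat M d β U Q i - qHat M d β V R i := by
  cases d <;> simp only [qHat] <;> split_ifs <;> simp only [M.traceL_sub, M.traceR_sub] <;> ring

lemma cellBdry_sub (M : Mesh a b) (j : Fin M.K) (φ ψ : Fin (M.K + 1) → ℝ) (v : ℝ[X]) :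
    M.cellBdry j (fun i => φ i - ψ i) v = M.cellBdry j φ v - M.cellBdry j ψ v := by
  simp only [Mesh.cellBdry]; ring

lemma cellBdry_const_mul (M : Mesh a b) (j : Fin M.K) (c : ℝ) (φ : Fin (M.K + 1) → ℝ) (v : ℝ[X]) :
    M.cellBdry j (fun i => c * φ i) v = c * M.cellBdry j φ v := by
  simp only [Mesh.cellBdry]; ring

lemma cellInt_by_parts' (M : Mesh a b) (j : Fin M.K) {φ φ' : ℝ → ℝ}
    (h : ∀ x, HasDerivAt φ (φ' x) x) (hφ' : Continuous φ') (z : ℝ[X]) :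
    M.cellInt j (fun x => φ' x * z.eval x)
      = M.cellBdry j (fun i => φ (M.node i)) z
        - M.cellInt j (fun x => φ x * z.derivative.eval x) := by
  have : M.cellInt j (fun x => φ x * z.derivative.eval x)
      = φ (M.node j.succ) * z.eval (M.node j.succ)
        - φ (M.node j.castSucc) * z.eval (M.node j.castSucc)
        - M.cellInt j (fun x => φ' x * z.eval x) :=
    intervalIntegral.integral_mul_deriv_eq_deriv_mul (fun x _ => h x)
      (fun x _ => z.hasDerivAt x) (hφ'.intervalIntegrable _ _)
      (z.derivative.continuous.intervalIntegrable _ _)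
  rw [this, Mesh.cellBdry]; ring

/-- The error `R - P` is the discrete derivative of the error `V - U`. -/
lemma discrete_deriv_error {f : ℝ → ℝ} {F : ℝ → ℝ → ℝ} {g u u' : ℝ → ℝ}
    {U U' P Q V R : Fin M.K → ℝ[X]} (hs : SchemeSlice M k d s ε β f F g U U' P Q)
    (hu : ∀ x, HasDerivAt u (u' x) x) (hu' : Continuous u')
    (hc : Comparison M k d u (fun x => √ε * u' x) V R) (j : Fin M.K) (z : ℝ[X])
    (hz : z.natDegree ≤ k) :
    M.cellInt j (fun x => (R j - P j).eval x * z.eval x)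
      = √ε * (M.cellBdry j (uHat M d fun j => V j - U j) z
        - M.cellInt j (fun x => (V j - U j).eval x * z.derivative.eval x)) := by
  have h1 := hs.eq_p j z hz
  have h2 := hc.orth_R j z hz
  have h3 := hc.orth_V j z hz
  have h4 := cellInt_by_parts' M j hu hu' z
  have h5 : M.cellInt j (fun x => √ε * u' x * z.eval x)
      = √ε * M.cellInt j (fun x => u' x * z.eval x) := by
    rw [← cellInt_const_mul]; congr 1; ext x; ring
  have h6 : M.cellBdry j (uHat M d fun j => V j - U j) z
      = M.cellBdry j (fun i => u (M.node i)) z - M.cellBdry j (uHat M d U) z := by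
    rw [← cellBdry_sub]; congr 1; ext i; rw [uHat_sub, hc.uHat_V]
  simp only [eval_sub, sub_mul]
  rw [cellInt_sub M j (by fun_prop) (by fun_prop), cellInt_sub M j (by fun_prop) (by fun_prop), h6]
  rw [h5, h4] at h2
  linear_combination h2 + √ε * h3 - h1

/-- The equation for `u` in weak form for the error. -/
lemma weak_error {f f' : ℝ → ℝ} {F : ℝ → ℝ → ℝ} {g u u' v q q' : ℝ → ℝ}
    {U U' P Q : Fin M.K → ℝ[X]} (hf : ∀ x, HasDerivAt f (f' x) x) (hf' : Continuous f')
    (he : ExactSlice s ε a b f f' g u u' v q q') (hs : SchemeSlice M k d s ε β f F g U U' P Q)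
    (j : Fin M.K) (z : ℝ[X]) (hz : z.natDegree ≤ k) :
    M.cellInt j (fun x => (v x - (U' j).eval x) * z.eval x)
      + M.cellBdry j (fun i => f (u (M.node i)) - fHat M F U i) z
      - M.cellInt j (fun x => (f (u x) - f ((U j).eval x)) * z.derivative.eval x)
      = √ε * (M.cellBdry j (fun i => q (M.node i) - qHat M d β U Q i) z
        - M.cellInt j (fun x => (q x - (Q j).eval x) * z.derivative.eval x)) := by
  have hfc : Continuous f := continuous_iff_continuousAt.mpr fun x => (hf x).continuousAt
  have huc : Continuous u := continuous_iff_continuousAt.mpr fun x => (he.hasDerivAt_u x).continuousAt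
  have hqc : Continuous q := continuous_iff_continuousAt.mpr fun x => (he.hasDerivAt_q x).continuousAt
  have hu' := he.continuous_u'
  have hv := he.continuous_v
  have hq' := he.continuous_q'
  have h1 := hs.eq_u j z hz
  have h2 : M.cellInt j (fun x => g x * z.eval x)
      = M.cellInt j (fun x => v x * z.eval x) + M.cellInt j (fun x => f' (u x) * u' x * z.eval x)
        - √ε * M.cellInt j (fun x => q' x * z.eval x) := by
    rw [← cellInt_const_mul, ← cellInt_add M j (by fun_prop) (by fun_prop),
      ← cellInt_sub M j (by fun_prop) (by fun_prop)]
    refine M.cellInt_congr fun x hx => ?_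
    linear_combination (-z.eval x) * he.equation x (M.Ioo_cell_subset j hx)
  have h3 := cellInt_by_parts' M j (φ := fun x => f (u x)) (φ' := fun x => f' (u x) * u' x)
    (fun x => (hf (u x)).comp x (he.hasDerivAt_u x)) (by fun_prop) z
  have h4 := cellInt_by_parts' M j he.hasDerivAt_q hq' z
  simp only [sub_mul] at h1 ⊢
  rw [cellInt_sub M j (by fun_prop) (by fun_prop)] at h1
  rw [cellInt_sub M j (by fun_prop) (by fun_prop), cellInt_sub M j (by fun_prop) (by fun_prop),
    cellInt_sub M j (by fun_prop) (by fun_prop), cellBdry_sub, cellBdry_sub]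
  rw [cellBdry_sub, cellBdry_const_mul] at h1
  simp only [mul_assoc] at h1 h2 h3
  rw [cellInt_const_mul] at h1
  rw [h2, h3, h4] at h1
  linear_combination -h1

lemma toFun_sub (M : Mesh a b) (P Q : Fin M.K → ℝ[X]) (x : ℝ) :
    M.toFun (fun j => P j - Q j) x = M.toFun P x - M.toFun Q x := by
  simp only [Mesh.toFun, ← Finset.sum_sub_distrib]
  refine Finset.sum_congr rfl fun j _ => ?_
  by_cases hx : x ∈ Ico (M.node j.castSucc) (M.node j.succ)
  · simp [indicator_of_mem hx]
  · simp [indicator_of_notMem hx]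

lemma sum_cellInt_mul_toFun (M : Mesh a b) {φ : ℝ → ℝ} (P : Fin M.K → ℝ[X])
    (hI : Integrable fun x => φ x * M.toFun P x) :
    ∑ j, M.cellInt j (fun x => φ x * (P j).eval x) = ∫ x, φ x * M.toFun P x := by
  rw [← M.sum_cellInt_of_support hI fun x hx => by
    rw [(M.tame_toFun P).support x hx, mul_zero]]
  refine Finset.sum_congr rfl fun j _ => M.cellInt_congr fun x hx => ?_
  rw [M.toFun_of_mem P ⟨hx.1.le, hx.2⟩]

lemma Tame.integrable_rieszInt_mul (h0 : 0 < s) {v w : ℝ → ℝ} (hv : Tame a b v)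
    (hw : Tame a b w) : Integrable (fun x => rieszInt s v x * w x) := by
  simp only [hv.rieszInt_eq h0, mul_assoc]
  exact (hv.integrable_rieszPot_mul h0 hw).const_mul _

/-- The pairing of the equation for `q` with the error `R - P`. -/
lemma sum_q_error {f : ℝ → ℝ} {F : ℝ → ℝ → ℝ} {g p q : ℝ → ℝ} (h0 : 0 < s)
    {U U' P Q R : Fin M.K → ℝ[X]} (hs : SchemeSlice M k d s ε β f F g U U' P Q)
    (hp : Tame a b p) (hq : ∀ x, q x = rieszInt s p x) (hR : ∀ j, (R j).natDegree ≤ k) :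
    ∑ j, M.cellInt j (fun x => (Q j).eval x * (R j - P j).eval x)
      = ∑ j, M.cellInt j (fun x => q x * (R j - P j).eval x)
        - (∫ x, rieszInt s (fun y => p y - M.toFun R y) x * M.toFun (fun j => R j - P j) x)
        - ∫ x, rieszInt s (M.toFun fun j => R j - P j) x * M.toFun (fun j => R j - P j) x := by
  have hW := M.tame_toFun fun j => R j - P j
  have hζ := hp.sub (M.tame_toFun R)
  have hP := M.tame_toFun P
  have h1 : ∑ j, M.cellInt j (fun x => (Q j).eval x * (R j - P j).eval x)
      = ∑ j, M.cellInt j (fun x => rieszInt s (M.toFun P) x * (R j - P j).eval x) :=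
    Finset.sum_congr rfl fun j _ => sub_eq_zero.mp (hs.eq_q j _
      ((natDegree_sub_le _ _).trans (max_le (hR j) (hs.degree_P j))))
  rw [h1, sum_cellInt_mul_toFun M _ (hP.integrable_rieszInt_mul h0 hW)]
  simp only [hq]
  rw [sum_cellInt_mul_toFun M _ (hp.integrable_rieszInt_mul h0 hW),
    ← integral_sub (hp.integrable_rieszInt_mul h0 hW) (hζ.integrable_rieszInt_mul h0 hW)]
  have hI := integral_sub ((hp.integrable_rieszInt_mul h0 hW).sub
    (hζ.integrable_rieszInt_mul h0 hW)) (hW.integrable_rieszInt_mul h0 hW)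
  simp only [Pi.sub_apply] at hI
  rw [← hI]
  congr 1; ext x
  have h2 : M.toFun P = fun x => (p x - (p x - M.toFun R x)) - M.toFun (fun j => R j - P j) x := by
    ext y; rw [toFun_sub]; ring
  have h3 : rieszInt s (M.toFun P) x = rieszInt s p x
      - rieszInt s (fun y => p y - M.toFun R y) x - rieszInt s (M.toFun fun j => R j - P j) x := by
    conv_lhs => rw [h2]
    rw [((hp.sub hζ).sub hW).rieszInt_eq h0, (hp.sub hζ).rieszPot_sub h0 hW,
      hp.rieszPot_sub h0 hζ, hp.rieszInt_eq h0, hζ.rieszInt_eq h0, hW.rieszInt_eq h0]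
    ring
  rw [h3]; ring

/-- The energy identity. `S` is any piecewise polynomial approximation of `q`. -/
theorem energy_identity {f f' : ℝ → ℝ} {F : ℝ → ℝ → ℝ} {g u u' v q q' : ℝ → ℝ} (hab : a < b)
    (h0 : 0 < s) {U U' P Q V R S : Fin M.K → ℝ[X]} (hf : ∀ x, HasDerivAt f (f' x) x)
    (hf' : Continuous f') (he : ExactSlice s ε a b f f' g u u' v q q')
    (hs : SchemeSlice M k d s ε β f F g U U' P Q)
    (hc : Comparison M k d u (fun x => √ε * u' x) V R) (hS : ∀ j, (S j).natDegree ≤ k) :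
    ∑ j, M.cellInt j (fun x => (v x - (U' j).eval x) * (V j - U j).eval x)
      + √ε * (β / M.size * penTrace M d (fun j => V j - U j) ^ 2)
      + ∫ x, rieszInt s (M.toFun fun j => R j - P j) x * M.toFun (fun j => R j - P j) x
      = (∑ i, (f (u (M.node i)) - fHat M F U i) * M.jump (fun j => V j - U j) i
          + ∑ j, M.cellInt j (fun x => (f (u x) - f ((U j).eval x))
            * (V j - U j).derivative.eval x))
        - ∑ j, M.cellInt j (fun x => ((S j).eval x - q x) * (R j - P j).eval x)
        - (∫ x, rieszInt s (fun y => √ε * u' y - M.toFun R y) x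
            * M.toFun (fun j => R j - P j) x)
        + √ε * (∑ i, (qHat M d β V S i - q (M.node i)) * M.jump (fun j => V j - U j) i
          + ∑ j, M.cellInt j (fun x => ((S j).eval x - q x) * (V j - U j).derivative.eval x)) := by
  have hqc : Continuous q := continuous_iff_continuousAt.mpr fun x => (he.hasDerivAt_q x).continuousAt
  have hξ : ∀ j, (V j - U j).natDegree ≤ k := fun j =>
    (natDegree_sub_le _ _).trans (max_le (hc.degree_V j) (hs.degree_U j))
  have hθ : ∀ j, (S j - Q j).natDegree ≤ k := fun j =>
    (natDegree_sub_le _ _).trans (max_le (hS j) (hs.degree_Q j))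
  have hA := Finset.sum_congr rfl fun j (_ : j ∈ Finset.univ) =>
    weak_error hf hf' he hs j (V j - U j) (hξ j)
  rw [Finset.sum_sub_distrib, Finset.sum_add_distrib, ← Finset.mul_sum, Finset.sum_sub_distrib,
    M.sum_cellBdry, M.sum_cellBdry] at hA
  have hC := Finset.sum_congr rfl fun j (_ : j ∈ Finset.univ) =>
    discrete_deriv_error hs he.hasDerivAt_u he.continuous_u' hc j (S j - Q j) (hθ j)
  rw [← Finset.mul_sum, Finset.sum_sub_distrib, M.sum_cellBdry _ fun j => S j - Q j] at hC
  have hB := sum_q_error h0 hs he.tame he.q_eq hc.degree_R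
  have hflux := sum_flux_identity M hab d β (fun j => V j - U j) (fun j => S j - Q j)
  rw [Finset.sum_sub_distrib, Finset.sum_add_distrib] at hflux
  have hparts : ∑ j, M.cellInt j (fun x => (V j - U j).eval x * (S j - Q j).derivative.eval x)
      + ∑ j, M.cellInt j (fun x => (S j - Q j).eval x * (V j - U j).derivative.eval x)
      = -∑ i, (M.traceR (fun j => V j - U j) i * M.traceR (fun j => S j - Q j) i
        - M.traceL (fun j => V j - U j) i * M.traceL (fun j => S j - Q j) i) := by
    have h1 := M.sum_cellBdry (fun _ => 1) (fun j => (V j - U j) * (S j - Q j))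
    simp only [M.traceR_mul, M.traceL_mul, one_mul] at h1
    rw [← h1, ← Finset.sum_add_distrib]
    refine Finset.sum_congr rfl fun j _ => ?_
    rw [cellInt_by_parts, Mesh.cellBdry, eval_mul, eval_mul]
    have : M.cellInt j (fun x => (V j - U j).derivative.eval x * (S j - Q j).eval x)
      = M.cellInt j (fun x => (S j - Q j).eval x * (V j - U j).derivative.eval x) := by
      congr 1; ext x; ring
    rw [this]; ring
  have hθπ : ∑ j, M.cellInt j (fun x => (R j - P j).eval x * (S j - Q j).eval x)
      = ∑ j, M.cellInt j (fun x => ((S j).eval x - q x) * (R j - P j).eval x)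
        + ∑ j, M.cellInt j (fun x => q x * (R j - P j).eval x)
        - ∑ j, M.cellInt j (fun x => (Q j).eval x * (R j - P j).eval x) := by
    rw [← Finset.sum_add_distrib, ← Finset.sum_sub_distrib]
    refine Finset.sum_congr rfl fun j _ => ?_
    rw [← cellInt_add M j (by fun_prop) (by fun_prop), ← cellInt_sub M j (by fun_prop) (by fun_prop)]
    congr 1; ext x; simp only [eval_sub]; ring
  have hqQ : ∑ j, M.cellInt j (fun x => (q x - (Q j).eval x) * (V j - U j).derivative.eval x)
      = ∑ j, M.cellInt j (fun x => (S j - Q j).eval x * (V j - U j).derivative.eval x)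
        - ∑ j, M.cellInt j (fun x => ((S j).eval x - q x) * (V j - U j).derivative.eval x) := by
    rw [← Finset.sum_sub_distrib]
    refine Finset.sum_congr rfl fun j _ => ?_
    rw [← cellInt_sub M j (by fun_prop) (by fun_prop)]
    congr 1; ext x; simp only [eval_sub]; ring
  have hqhat : ∑ i, (q (M.node i) - qHat M d β U Q i) * M.jump (fun j => V j - U j) i
      = ∑ i, qHat M d β (fun j => V j - U j) (fun j => S j - Q j) i * M.jump (fun j => V j - U j) i
        - ∑ i, (qHat M d β V S i - q (M.node i)) * M.jump (fun j => V j - U j) i := by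
    rw [← Finset.sum_sub_distrib]
    refine Finset.sum_congr rfl fun i _ => ?_
    rw [qHat_sub]; ring
  change _ + -∑ i, _ * M.jump (fun j => V j - U j) i - _
    = √ε * (-∑ i, _ * M.jump (fun j => V j - U j) i - _) at hA
  change _ = √ε * (-∑ i, _ * M.jump (fun j => S j - Q j) i - _) at hC
  rw [hqhat, hqQ] at hA
  rw [hθπ, hB] at hC
  linear_combination hA + hC - √ε * hflux - √ε * hparts

end
end LDG

namespace LDG
noncomputable section

/-! ### The energy inequality at a fixed time -/

variable {a b : ℝ} {M : Mesh a b} {k : ℕ} {d : Direction} {s ε β : ℝ}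

lemma sum_cellInt_mul_le (M : Mesh a b) {φ ψ : Fin M.K → ℝ → ℝ} (hφ : ∀ j, Continuous (φ j))
    (hψ : ∀ j, Continuous (ψ j)) {δ : ℝ}
    (h : ∀ j, ∀ x ∈ Icc (M.node j.castSucc) (M.node j.succ), |φ j x| ≤ δ) :
    |∑ j, M.cellInt j (fun x => φ j x * ψ j x)| ≤ δ * ∑ j, M.cellInt j (fun x => |ψ j x|) := by
  rw [Finset.mul_sum]
  refine (Finset.abs_sum_le_sum_abs _ _).trans (Finset.sum_le_sum fun j _ => ?_)
  refine (intervalIntegral.abs_integral_le_integral_abs (M.node_lt j).le).trans ?_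
  rw [← cellInt_const_mul]
  have h1 := hφ j
  have h2 := hψ j
  refine cellInt_mono M (by fun_prop) (by fun_prop) fun x hx => ?_
  rw [abs_mul]
  exact mul_le_mul_of_nonneg_right (h j x hx) (abs_nonneg _)

lemma sum_width (M : Mesh a b) : ∑ j, M.width j = b - a := by
  have := Mesh.sum_sub_succ M.node
  rwa [M.node_last, M.node_zero] at this

lemma cellInt_const (M : Mesh a b) (j : Fin M.K) (c : ℝ) :
    M.cellInt j (fun _ => c) = M.width j * c := by
  simp [Mesh.cellInt, Mesh.width]

lemma mul_abs_le_sq {δ y c μ : ℝ} (hc : 0 < c) (hμ : 0 < μ) :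
    δ * |y| ≤ μ * (c * y ^ 2) + δ ^ 2 / (4 * μ * c) := by
  rw [← sq_abs y]
  have h : 0 ≤ (2 * μ * c * |y| - δ) ^ 2 / (4 * μ * c) := by positivity
  have h2 : (2 * μ * c * |y| - δ) ^ 2 / (4 * μ * c)
      = μ * (c * |y| ^ 2) - δ * |y| + δ ^ 2 / (4 * μ * c) := by field_simp; ring
  linarith

lemma mul_sum_cellInt_abs_le (M : Mesh a b) (hab : a < b) {ρ : ℝ}
    (hρ : ∀ j, M.size ≤ ρ * M.width j)
    (π : Fin M.K → ℝ[X]) {δ μ : ℝ} (hμ : 0 < μ) :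
    δ * ∑ j, M.cellInt j (fun x => |(π j).eval x|)
      ≤ μ * ∑ j, M.width j * M.cellInt j (fun x => (π j).eval x ^ 2)
        + ρ * (b - a) / (4 * μ) * (δ ^ 2 / M.size) := by
  have hh := M.size_pos hab
  have hcell : ∀ j, δ * M.cellInt j (fun x => |(π j).eval x|)
      ≤ μ * (M.width j * M.cellInt j (fun x => (π j).eval x ^ 2))
        + ρ / (4 * μ) * (δ ^ 2 / M.size) * M.width j := by
    intro j
    have hw := M.width_pos j
    have h1 : δ ^ 2 / (4 * μ * M.width j) ≤ ρ / (4 * μ) * (δ ^ 2 / M.size) := by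
      rw [div_mul_div_comm, div_le_div_iff₀ (by positivity) (by positivity)]
      have := mul_le_mul_of_nonneg_left (hρ j) (mul_nonneg hμ.le (sq_nonneg δ))
      nlinarith
    calc _ = M.cellInt j (fun x => δ * |(π j).eval x|) := (cellInt_const_mul M j _ _).symm
      _ ≤ M.cellInt j (fun x => μ * (M.width j * (π j).eval x ^ 2)
          + ρ / (4 * μ) * (δ ^ 2 / M.size)) :=
        cellInt_mono M (by fun_prop) (by fun_prop) fun x _ =>
          (mul_abs_le_sq hw hμ).trans (by linarith)
      _ = _ := by
        rw [cellInt_add M j (by fun_prop) (by fun_prop), cellInt_const_mul, cellInt_const_mul,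
          cellInt_const]; ring
  calc _ = ∑ j, δ * M.cellInt j (fun x => |(π j).eval x|) := Finset.mul_sum _ _ _
    _ ≤ _ := Finset.sum_le_sum fun j _ => hcell j
    _ = μ * ∑ j, M.width j * M.cellInt j (fun x => (π j).eval x ^ 2)
        + ρ / (4 * μ) * (δ ^ 2 / M.size) * ∑ j, M.width j := by
      rw [Finset.sum_add_distrib, Finset.mul_sum, Finset.mul_sum]
    _ = _ := by rw [sum_width]; ring

lemma mul_sum_abs_jump_le (M : Mesh a b) (hab : a < b) {ρ : ℝ}
    (hρ : ∀ j, M.size ≤ ρ * M.width j) (J : Fin (M.K + 1) → ℝ) {δ μ : ℝ} (hμ : 0 < μ) :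
    δ * ∑ i, |J i| ≤ μ * ∑ i, J i ^ 2 + 2 * (ρ * (b - a) / (4 * μ) * (δ ^ 2 / M.size)) := by
  have hh := M.size_pos hab
  have h1 : (M.K + 1 : ℝ) * M.size ≤ 2 * (ρ * (b - a)) := by
    have h2 := M.card_mul_size_le hρ
    have h3 : (1 : ℝ) ≤ M.K := by exact_mod_cast M.K_pos hab
    nlinarith
  calc _ = ∑ i, δ * |J i| := Finset.mul_sum _ _ _
    _ ≤ ∑ i, (μ * (1 * J i ^ 2) + δ ^ 2 / (4 * μ * 1)) :=
      Finset.sum_le_sum fun i _ => mul_abs_le_sq one_pos hμ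
    _ = μ * ∑ i, J i ^ 2 + (M.K + 1 : ℝ) * (δ ^ 2 / (4 * μ)) := by
      rw [Finset.sum_add_distrib, ← Finset.mul_sum]; simp
    _ ≤ _ := by
      rw [show 2 * (ρ * (b - a) / (4 * μ) * (δ ^ 2 / M.size))
        = (2 * (ρ * (b - a)) / M.size) * (δ ^ 2 / (4 * μ)) by field_simp]
      refine add_le_add le_rfl (mul_le_mul_of_nonneg_right ?_ (by positivity))
      rwa [le_div_iff₀ hh]

lemma Tame.integrable {w : ℝ → ℝ} (hw : Tame a b w) : Integrable w := by
  obtain ⟨S, hS⟩ := hw.bounded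
  have h1 : IntegrableOn w (Icc a b) :=
    Measure.integrableOn_of_bounded (M := S) (by simp) hw.measurable.aestronglyMeasurable
      (Filter.Eventually.of_forall hS)
  refine (integrableOn_iff_integrable_of_support_subset fun y hy => ?_).mp h1
  by_contra hy'
  exact hy (hw.support y hy')

lemma abs_integral_rieszInt_mul_le (h0 : 0 < s) (h1 : s < 1) {ζ : ℝ → ℝ} (hζ : Tame a b ζ) {δ : ℝ}
    (hδ : ∀ x, |ζ x| ≤ δ) (π : Fin M.K → ℝ[X]) :
    |∫ x, rieszInt s ζ x * M.toFun π x|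
      ≤ rieszConst s * kerMass s (b - a) * δ * ∑ j, M.cellInt j (fun x => |(π j).eval x|) := by
  have hW := M.tame_toFun π
  have hc := (rieszConst_pos h0 h1).le
  have h2 : ∑ j, M.cellInt j (fun x => |(π j).eval x|) = ∫ x, |M.toFun π x| := by
    rw [← M.sum_cellInt_of_support hW.integrable.abs fun x hx => by rw [hW.support x hx, abs_zero]]
    refine Finset.sum_congr rfl fun j _ => M.cellInt_congr fun x hx => ?_
    rw [M.toFun_of_mem π ⟨hx.1.le, hx.2⟩]
  rw [h2, ← integral_const_mul, ← Real.norm_eq_abs]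
  refine norm_integral_le_of_norm_le (hW.integrable.abs.const_mul _)
    (Filter.Eventually.of_forall fun x => ?_)
  by_cases hx : x ∈ Icc a b
  · rw [Real.norm_eq_abs, abs_mul]
    refine mul_le_mul_of_nonneg_right ?_ (abs_nonneg _)
    rw [hζ.rieszInt_eq h0, abs_mul, abs_of_nonneg hc, mul_assoc, mul_comm (kerMass _ _)]
    exact mul_le_mul_of_nonneg_left (hζ.abs_rieszPot_le h0 hδ hx) hc
  · simp [hW.support x hx]

lemma abs_sub_toFun_le (M : Mesh a b) {p : ℝ → ℝ} (hp : Continuous p) (hpt : Tame a b p)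
    {R : Fin M.K → ℝ[X]} {δ : ℝ} (hδ0 : 0 ≤ δ)
    (hR : ∀ j, ∀ x ∈ Icc (M.node j.castSucc) (M.node j.succ), |(R j).eval x - p x| ≤ δ) (x : ℝ) :
    |p x - M.toFun R x| ≤ δ := by
  by_cases hx : x ∈ Ico a b
  · obtain ⟨j, hj⟩ := M.exists_mem_cell hx
    rw [M.toFun_of_mem R hj, abs_sub_comm]
    exact hR j x ⟨hj.1, hj.2.le⟩
  · have hpx : p x = 0 := by
      by_cases hxb : x = b
      · subst hxb
        have h1 : x ∈ closure (Ioi x) := by rw [closure_Ioi]; exact self_mem_Ici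
        exact closure_minimal (t := {y | p y = 0})
          (fun y hy => hpt.support y fun h => absurd h.2 (not_le.mpr hy))
          (isClosed_eq hp continuous_const) h1
      · exact hpt.support x fun h => hx ⟨h.1, lt_of_le_of_ne h.2 hxb⟩
    rw [hpx, M.toFun_of_notMem R hx]; simpa using hδ0

lemma abs_qHat_sub_le (M : Mesh a b) {V S : Fin M.K → ℝ[X]} {q : ℝ → ℝ} {δ : ℝ} (hab : a < b)
    (hpen : penTrace M d V = 0)
    (hS : ∀ j, ∀ x ∈ Icc (M.node j.castSucc) (M.node j.succ), |(S j).eval x - q x| ≤ δ)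
    (i : Fin (M.K + 1)) : |qHat M d β V S i - q (M.node i)| ≤ δ := by
  have h0 : (0 : Fin (M.K + 1)) ≠ Fin.last M.K := fun h => by
    have := M.K_pos hab
    have h1 := congrArg Fin.val h
    simp at h1; omega
  have hL : ∀ i, i ≠ 0 → |M.traceL S i - q (M.node i)| ≤ δ := fun i => by
    refine Fin.cases (fun h => absurd rfl h) (fun j _ => ?_) i
    exact hS j _ ⟨(M.node_lt j).le, le_rfl⟩
  have hR : ∀ i, i ≠ Fin.last M.K → |M.traceR S i - q (M.node i)| ≤ δ := fun i => by
    refine Fin.lastCases (fun h => absurd rfl h) (fun j _ => ?_) i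
    rw [M.traceR_castSucc]; exact hS j _ ⟨le_rfl, (M.node_lt j).le⟩
  cases d with
  | minusPlus =>
    simp only [penTrace] at hpen
    simp only [qHat]
    split_ifs with h
    · subst h
      simpa [hpen] using hL _ h0.symm
    · exact hR i h
  | plusMinus =>
    simp only [penTrace] at hpen
    simp only [qHat]
    split_ifs with h
    · subst h
      simpa [hpen] using hR _ h0
    · exact hL i h

lemma sum_cellInt_time_le (M : Mesh a b) {v : ℝ → ℝ} (hv : Continuous v) {V' : Fin M.K → ℝ[X]}
    (U' ξ : Fin M.K → ℝ[X]) {δ : ℝ}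
    (hV' : ∀ j, ∀ x ∈ Icc (M.node j.castSucc) (M.node j.succ), |(V' j).eval x - v x| ≤ δ) :
    ∑ j, M.cellInt j (fun x => (V' j - U' j).eval x * (ξ j).eval x)
      ≤ ∑ j, M.cellInt j (fun x => (v x - (U' j).eval x) * (ξ j).eval x)
        + (∑ j, M.cellInt j (fun x => (ξ j).eval x ^ 2) + (b - a) * δ ^ 2) := by
  rw [← sum_width M, Finset.sum_mul, ← Finset.sum_add_distrib, ← Finset.sum_add_distrib]
  refine Finset.sum_le_sum fun j _ => ?_
  rw [← cellInt_const, ← cellInt_add M j (by fun_prop) (by fun_prop),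
    ← cellInt_add M j (by fun_prop) (by fun_prop)]
  refine cellInt_mono M (by fun_prop) (by fun_prop) fun x hx => ?_
  have h2 := sq_le_sq' (abs_le.mp (hV' j x hx)).1 (abs_le.mp (hV' j x hx)).2
  have h3 : (V' j - U' j).eval x * (ξ j).eval x
      = (v x - (U' j).eval x) * (ξ j).eval x + ((V' j).eval x - v x) * (ξ j).eval x := by
    rw [eval_sub]; ring
  rw [h3]
  have h4 := two_mul_le_add_sq ((V' j).eval x - v x) ((ξ j).eval x)
  have h5 := sq_nonneg ((V' j).eval x - v x)
  have h6 := sq_nonneg ((ξ j).eval x)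
  linarith

set_option maxHeartbeats 1000000 in
/-- The energy inequality: the error in `u_h` grows at most exponentially up to a term of the order
of `δ² / h`, if all the local projections have errors at most `δ`. -/
theorem exists_energy_le (k : ℕ) (h0 : 0 < s) (h1 : s < 1) (hε : 0 < ε) (hβ : 0 < β) {a b : ℝ}
    (hab : a < b) {ρ B L L' : ℝ} (hρ : 0 < ρ) (hB : 0 ≤ B) (hL : 0 ≤ L) (hL' : 0 ≤ L')
    {f f' : ℝ → ℝ} {F : ℝ → ℝ → ℝ} (hF : IsMonotoneFlux f F) (hf : ∀ x, HasDerivAt f (f' x) x)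
    (hf' : Continuous f') (hb : ConvectionBounds f f' F (B + 2) L L') :
    ∃ K : ℝ, 0 < K ∧ ∀ (M : Mesh a b) (d : Direction) (g u u' v q q' : ℝ → ℝ)
      (U U' P Q V V' R S : Fin M.K → ℝ[X]) (δ : ℝ), M.size ≤ 1 →
      (∀ j, M.size ≤ ρ * M.width j) → ExactSlice s ε a b f f' g u u' v q q' →
      SchemeSlice M k d s ε β f F g U U' P Q →
      Comparison M k d u (fun x => √ε * u' x) V R → (∀ j, (S j).natDegree ≤ k) →
      (∀ x ∈ Icc a b, |u x| ≤ B) → (∀ x ∈ Icc a b, |u' x| ≤ B) → 0 ≤ δ → δ ≤ 1 →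
      (∀ j, ∀ x ∈ Icc (M.node j.castSucc) (M.node j.succ), |(V j).eval x - u x| ≤ δ) →
      (∀ j, ∀ x ∈ Icc (M.node j.castSucc) (M.node j.succ), |(V' j).eval x - v x| ≤ δ) →
      (∀ j, ∀ x ∈ Icc (M.node j.castSucc) (M.node j.succ), |(R j).eval x - √ε * u' x| ≤ δ) →
      (∀ j, ∀ x ∈ Icc (M.node j.castSucc) (M.node j.succ), |(S j).eval x - q x| ≤ δ) →
      (∀ j, ∀ x ∈ Icc (M.node j.castSucc) (M.node j.succ), |(V j - U j).eval x| ≤ 1) →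
      ∑ j, M.cellInt j (fun x => (V' j - U' j).eval x * (V j - U j).eval x)
        ≤ K * (∑ j, M.cellInt j (fun x => (V j - U j).eval x ^ 2) + δ ^ 2 / M.size) := by
  obtain ⟨Kc, hKc, hcoer⟩ := exists_coercivity k h0 h1
  obtain ⟨Kj, hKj, hjump⟩ := exists_jump_le k
  have hc := rieszConst_pos h0 h1
  have hsε : 0 < √ε := Real.sqrt_pos.mpr hε
  set c := rieszConst s with hcdef
  set m := kerMass s (b - a) with hm
  have hm0 : 0 ≤ m := kerMass_nonneg _ _
  set K₁ := L + 1 + c * m + √ε with hK₁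
  have hK₁0 : 0 < K₁ := by positivity
  set Kx := Kc / c with hKx
  have hKx0 : 0 < Kx := by positivity
  set Kp := 1 / (√ε * β) with hKp
  have hKp0 : 0 < Kp := by positivity
  set Kz := Kx + Kj * (Kx / ε + Kp) with hKz
  have hKz0 : 0 < Kz := by positivity
  set μ := 1 / (K₁ * Kz) with hμ
  have hμ0 : 0 < μ := by positivity
  have hba : 0 < b - a := sub_pos.mpr hab
  refine ⟨B * L' + 1 + (b - a) + K₁ * (ρ * (b - a) / μ), by positivity, ?_⟩
  intro M d g u u' v q q' U U' P Q V V' R S δ hM hqu he hs hcmp hSd hu hu' hδ0 hδ1 hV hV' hR hS hξ1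
  have hh := M.size_pos hab
  have huc : Continuous u := continuous_iff_continuousAt.mpr fun x => (he.hasDerivAt_u x).continuousAt
  have hqc : Continuous q := continuous_iff_continuousAt.mpr fun x => (he.hasDerivAt_q x).continuousAt
  have hvc := he.continuous_v
  have hu'c := he.continuous_u'
  have hid := energy_identity hab h0 hf hf' he hs hcmp hSd
  have hξd : ∀ j, (V j - U j).natDegree ≤ k := fun j =>
    (natDegree_sub_le _ _).trans (max_le (hcmp.degree_V j) (hs.degree_U j))
  have hπd : ∀ j, (R j - P j).natDegree ≤ k := fun j =>
    (natDegree_sub_le _ _).trans (max_le (hcmp.degree_R j) (hs.degree_P j))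
  have hW := M.tame_toFun fun j => R j - P j
  -- good terms
  set D := ∫ x, rieszInt s (M.toFun fun j => R j - P j) x * M.toFun (fun j => R j - P j) x with hD
  set X := ∑ j, M.width j * M.cellInt j (fun x => (R j - P j).eval x ^ 2) with hX
  set pen := penTrace M d (fun j => V j - U j) with hpen
  have hDeq : D = c * ∫ x, rieszPot s (M.toFun fun j => R j - P j) x
      * M.toFun (fun j => R j - P j) x := by
    rw [hD, ← integral_const_mul]
    congr 1; ext x; rw [hW.rieszInt_eq h0]; ring
  have hXD : X ≤ Kx * D := by
    have := hcoer a b M hM (fun j => R j - P j) hπd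
    rw [hDeq, hKx]
    calc X ≤ _ := this
      _ = _ := by field_simp
  have hX0 : 0 ≤ X := Finset.sum_nonneg fun j _ => mul_nonneg (M.width_pos j).le
      (intervalIntegral.integral_nonneg (M.node_lt j).le fun x _ => sq_nonneg _)
  have hD0 : 0 ≤ D := by
    by_contra h
    push Not at h
    nlinarith
  set G := √ε * (β / M.size * pen ^ 2) + D with hG
  have hpen0 : 0 ≤ √ε * (β / M.size * pen ^ 2) := by positivity
  have hpenG : pen ^ 2 ≤ Kp * G := by
    have h2 : √ε * β * pen ^ 2 ≤ √ε * (β / M.size * pen ^ 2) := by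
      rw [mul_assoc]
      refine mul_le_mul_of_nonneg_left (mul_le_mul_of_nonneg_right ?_ (sq_nonneg _)) hsε.le
      rw [le_div_iff₀ hh]; nlinarith
    rw [hKp, one_div_mul_eq_div, le_div_iff₀ (by positivity)]
    linarith
  have hXG : X ≤ Kx * G := hXD.trans (mul_le_mul_of_nonneg_left (by linarith) hKx0.le)
  set Y₁ := ∑ j, M.width j * M.cellInt j (fun x => (V j - U j).derivative.eval x ^ 2) with hY₁
  set Y₂ := ∑ i, M.jump (fun j => V j - U j) i ^ 2 with hY₂
  have hYG : Y₁ + Y₂ ≤ Kj * (Kx / ε + Kp) * G := by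
    have h2 := hjump a b M d (fun j => V j - U j) (fun j => C (√ε)⁻¹ * (R j - P j)) hξd
      (fun j z hz => by
        have h3 := discrete_deriv_error hs he.hasDerivAt_u he.continuous_u' hcmp j z hz
        have h4 : M.cellInt j (fun x => (C (√ε)⁻¹ * (R j - P j)).eval x * z.eval x)
            = (√ε)⁻¹ * M.cellInt j (fun x => (R j - P j).eval x * z.eval x) := by
          rw [← cellInt_const_mul]; congr 1; ext x; rw [eval_mul, eval_C]; ring
        rw [h4, h3, inv_mul_cancel_left₀ hsε.ne'])
    have h5 : ∑ j, M.width j * M.cellInt j (fun x => (C (√ε)⁻¹ * (R j - P j)).eval x ^ 2)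
        = X / ε := by
      rw [hX, Finset.sum_div]
      refine Finset.sum_congr rfl fun j _ => ?_
      have h6 : M.cellInt j (fun x => (C (√ε)⁻¹ * (R j - P j)).eval x ^ 2)
          = ε⁻¹ * M.cellInt j (fun x => (R j - P j).eval x ^ 2) := by
        rw [← cellInt_const_mul]; congr 1; ext x
        rw [eval_mul, eval_C, mul_pow, inv_pow, Real.sq_sqrt hε.le]
      rw [h6]; field_simp
    rw [h5] at h2
    refine h2.trans ?_
    rw [mul_assoc]
    refine mul_le_mul_of_nonneg_left ?_ hKj.le
    have h7 : X / ε ≤ Kx * G / ε := div_le_div_of_nonneg_right hXG hε.le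
    calc X / ε + pen ^ 2 ≤ Kx * G / ε + Kp * G := add_le_add h7 hpenG
      _ = _ := by ring
  -- bad terms
  set A₁ := ∑ j, M.cellInt j (fun x => |(V j - U j).derivative.eval x|) with hA₁
  set A₂ := ∑ i, |M.jump (fun j => V j - U j) i| with hA₂
  set A₃ := ∑ j, M.cellInt j (fun x => |(R j - P j).eval x|) with hA₃
  set E := ∑ j, M.cellInt j (fun x => (V j - U j).eval x ^ 2) with hE
  have hUV : ∀ j, V j - (V j - U j) = U j := fun j => by ring
  have hconv := convection_le M hF hf hf' he.hasDerivAt_u he.continuous_u' he.left_zero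
    he.right_zero hL hL' hb hu hu' hδ0 hδ1 hξ1 hV
  simp only [hUV] at hconv
  have hb1 := (abs_le.mp (sum_cellInt_mul_le M (φ := fun j x => (S j).eval x - q x)
    (ψ := fun j x => (R j - P j).eval x) (fun j => by fun_prop) (fun j => by fun_prop) hS)).1
  have hb2 := (abs_le.mp (sum_cellInt_mul_le M (φ := fun j x => (S j).eval x - q x)
    (ψ := fun j x => (V j - U j).derivative.eval x) (fun j => by fun_prop)
    (fun j => by fun_prop) hS)).2
  have hb3 := (abs_le.mp (abs_integral_rieszInt_mul_le h0 h1 (he.tame.sub (M.tame_toFun R))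
    (abs_sub_toFun_le M (by fun_prop) he.tame hδ0 hR) (fun j => R j - P j))).1
  have hb4 : ∑ i, (qHat M d β V S i - q (M.node i)) * M.jump (fun j => V j - U j) i ≤ δ * A₂ := by
    rw [hA₂, Finset.mul_sum]
    refine Finset.sum_le_sum fun i _ => (le_abs_self _).trans ?_
    rw [abs_mul]
    exact mul_le_mul_of_nonneg_right (abs_qHat_sub_le M hab hcmp.pen_V hS i) (abs_nonneg _)
  have hy1 := mul_sum_cellInt_abs_le M hab hqu (fun j => (V j - U j).derivative) (δ := δ) hμ0
  have hy2 := mul_sum_abs_jump_le M hab hqu (M.jump fun j => V j - U j) (δ := δ) hμ0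
  have hy3 := mul_sum_cellInt_abs_le M hab hqu (fun j => R j - P j) (δ := δ) hμ0
  have hsplit := sum_cellInt_time_le M (v := v) hvc (V' := V') (fun j => (U' j))
    (fun j => V j - U j) hV'
  have hdh : δ ^ 2 ≤ δ ^ 2 / M.size := by
    rw [le_div_iff₀ hh]; nlinarith [sq_nonneg δ]
  set W := δ ^ 2 / M.size with hWd
  have hW0 : 0 ≤ W := by positivity
  have hA₁0 : 0 ≤ A₁ := Finset.sum_nonneg fun j _ =>
    intervalIntegral.integral_nonneg (M.node_lt j).le fun x _ => abs_nonneg _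
  have hA₂0 : 0 ≤ A₂ := Finset.sum_nonneg fun i _ => abs_nonneg _
  have hA₃0 : 0 ≤ A₃ := Finset.sum_nonneg fun j _ =>
    intervalIntegral.integral_nonneg (M.node_lt j).le fun x _ => abs_nonneg _
  have hE0 : 0 ≤ E := Finset.sum_nonneg fun j _ =>
    intervalIntegral.integral_nonneg (M.node_lt j).le fun x _ => sq_nonneg _
  have hbad : δ * A₁ + δ * A₂ + δ * A₃ ≤ μ * (Kz * G) + ρ * (b - a) / μ * W := by
    have h2 : ρ * (b - a) / (4 * μ) * W * 4 = ρ * (b - a) / μ * W := by field_simp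
    have h3 : μ * X + μ * (Y₁ + Y₂) ≤ μ * (Kz * G) := by
      rw [← mul_add, hKz]
      refine mul_le_mul_of_nonneg_left ?_ hμ0.le
      linarith
    linarith
  have hbad2 : K₁ * (δ * A₁ + δ * A₂ + δ * A₃) ≤ G + K₁ * (ρ * (b - a) / μ) * W := by
    calc _ ≤ K₁ * (μ * (Kz * G) + ρ * (b - a) / μ * W) := by gcongr
      _ = (μ * (K₁ * Kz)) * G + K₁ * (ρ * (b - a) / μ) * W := by ring
      _ = _ := by rw [hμ, one_div_mul_cancel (by positivity), one_mul]
  have hcoll : L * δ * (A₂ + A₁) + δ * A₃ + c * m * δ * A₃ + √ε * (δ * A₂ + δ * A₁)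
      ≤ K₁ * (δ * A₁ + δ * A₂ + δ * A₃) := by
    have e1 := mul_nonneg hδ0 hA₁0
    have e2 := mul_nonneg hδ0 hA₂0
    have e3 := mul_nonneg hδ0 hA₃0
    have e4 := mul_nonneg hc.le hm0
    have h2 : K₁ * (δ * A₁ + δ * A₂ + δ * A₃)
        - (L * δ * (A₂ + A₁) + δ * A₃ + c * m * δ * A₃ + √ε * (δ * A₂ + δ * A₁))
        = (1 + c * m) * (δ * A₁ + δ * A₂) + (L + √ε) * (δ * A₃) := by rw [hK₁]; ring
    have h3 : 0 ≤ (1 + c * m) * (δ * A₁ + δ * A₂) + (L + √ε) * (δ * A₃) := by positivity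
    linarith
  have hq2 : √ε * (∑ i, (qHat M d β V S i - q (M.node i)) * M.jump (fun j => V j - U j) i
      + ∑ j, M.cellInt j (fun x => ((S j).eval x - q x) * (V j - U j).derivative.eval x))
      ≤ √ε * (δ * A₂ + δ * A₁) := mul_le_mul_of_nonneg_left (add_le_add hb4 hb2) hsε.le
  have hfin : (B * L' + 1 + (b - a) + K₁ * (ρ * (b - a) / μ)) * (E + W)
      = B * L' * E + E + (b - a) * W + K₁ * (ρ * (b - a) / μ) * W
        + (B * L' * W + W + (b - a) * E + K₁ * (ρ * (b - a) / μ) * E) := by ring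
  have hrest : 0 ≤ B * L' * W + W + (b - a) * E + K₁ * (ρ * (b - a) / μ) * E := by positivity
  have hbaW : (b - a) * δ ^ 2 ≤ (b - a) * W := mul_le_mul_of_nonneg_left hdh hba.le
  rw [hfin]
  linarith

end
end LDG

namespace LDG
noncomputable section

/-! ### Regularity of the exact solution -/

variable {T : ℝ} {W : ℝ → ℝ → ℝ}

lemma uniqueDiffOn_strip (hT : 0 < T) : UniqueDiffOn ℝ ((univ : Set ℝ) ×ˢ Icc 0 T) :=
  uniqueDiffOn_univ.prod (uniqueDiffOn_Icc hT)

lemma exists_space_deriv (hT : 0 < T) {n : ℕ}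
    (hW : ContDiffOn ℝ (n + 1 : ℕ) (Function.uncurry W) (univ ×ˢ Icc 0 T)) :
    ∃ W' : ℝ → ℝ → ℝ, ContDiffOn ℝ n (Function.uncurry W') (univ ×ˢ Icc 0 T) ∧
      ∀ t ∈ Icc 0 T, ∀ x, HasDerivAt (fun y => W y t) (W' x t) x := by
  refine ⟨fun x t => fderivWithin ℝ (Function.uncurry W) (univ ×ˢ Icc 0 T) (x, t) (1, 0), ?_, ?_⟩
  · exact (hW.fderivWithin (uniqueDiffOn_strip hT) (by norm_cast)).clm_apply contDiffOn_const
  · intro t ht x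
    have hd : HasFDerivWithinAt (Function.uncurry W)
        (fderivWithin ℝ (Function.uncurry W) (univ ×ˢ Icc 0 T) (x, t)) (univ ×ˢ Icc 0 T) (x, t) :=
      ((hW.differentiableOn (by norm_cast)) (x, t) ⟨mem_univ x, ht⟩).hasFDerivWithinAt
    have hl : HasDerivWithinAt (fun y : ℝ => (y, t)) ((1 : ℝ), (0 : ℝ)) univ x :=
      (hasDerivWithinAt_id x univ).prodMk (hasDerivWithinAt_const x univ t)
    have hm : MapsTo (fun y : ℝ => (y, t)) univ ((univ : Set ℝ) ×ˢ Icc 0 T) := fun y _ =>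
      ⟨mem_univ y, ht⟩
    have := hd.comp_hasDerivWithinAt x hl hm
    rwa [hasDerivWithinAt_univ] at this

lemma exists_time_deriv (hT : 0 < T) {n : ℕ}
    (hW : ContDiffOn ℝ (n + 1 : ℕ) (Function.uncurry W) (univ ×ˢ Icc 0 T)) :
    ∃ W' : ℝ → ℝ → ℝ, ContDiffOn ℝ n (Function.uncurry W') (univ ×ˢ Icc 0 T) ∧
      ∀ t ∈ Ioo 0 T, ∀ x, HasDerivAt (fun τ => W x τ) (W' x t) t := by
  refine ⟨fun x t => fderivWithin ℝ (Function.uncurry W) (univ ×ˢ Icc 0 T) (x, t) (0, 1), ?_, ?_⟩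
  · exact (hW.fderivWithin (uniqueDiffOn_strip hT) (by norm_cast)).clm_apply contDiffOn_const
  · intro t ht x
    have hd : HasFDerivWithinAt (Function.uncurry W)
        (fderivWithin ℝ (Function.uncurry W) (univ ×ˢ Icc 0 T) (x, t)) (univ ×ˢ Icc 0 T) (x, t) :=
      ((hW.differentiableOn (by norm_cast)) (x, t)
        ⟨mem_univ x, ht.1.le, ht.2.le⟩).hasFDerivWithinAt
    have hl : HasDerivWithinAt (fun τ : ℝ => (x, τ)) ((0 : ℝ), (1 : ℝ)) (Icc 0 T) t :=
      (hasDerivWithinAt_const t _ x).prodMk (hasDerivWithinAt_id t _)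
    have hm : MapsTo (fun τ : ℝ => (x, τ)) (Icc 0 T) ((univ : Set ℝ) ×ˢ Icc 0 T) := fun τ hτ =>
      ⟨mem_univ x, hτ⟩
    exact (hd.comp_hasDerivWithinAt t hl hm).hasDerivAt (Icc_mem_nhds ht.1 ht.2)

lemma contDiff_slice {n : WithTop ℕ∞}
    (hW : ContDiffOn ℝ n (Function.uncurry W) (univ ×ˢ Icc 0 T)) {t : ℝ} (ht : t ∈ Icc 0 T) :
    ContDiff ℝ n (fun x => W x t) := by
  rw [← contDiffOn_univ]
  exact hW.comp (f := fun x : ℝ => (x, t)) (by fun_prop) fun x _ => ⟨mem_univ x, ht⟩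

lemma exists_iteratedDeriv_bound (hT : 0 < T) (a b : ℝ) (n : ℕ) (W : ℝ → ℝ → ℝ)
    (hW : ContDiffOn ℝ n (Function.uncurry W) (univ ×ˢ Icc 0 T)) :
    ∃ D, ∀ t ∈ Icc 0 T, ∀ x ∈ Icc a b, |iteratedDeriv n (fun y => W y t) x| ≤ D := by
  induction n generalizing W with
  | zero =>
    obtain ⟨D, hD⟩ := ((isCompact_Icc (a := a) (b := b)).prod
      (isCompact_Icc (a := (0 : ℝ)) (b := T))).exists_bound_of_continuousOn
      (hW.continuousOn.mono (prod_mono (subset_univ _) subset_rfl))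
    exact ⟨D, fun t ht x hx => by simpa using hD (x, t) ⟨hx, ht⟩⟩
  | succ n ih =>
    obtain ⟨W', hW', hd⟩ := exists_space_deriv hT hW
    obtain ⟨D, hD⟩ := ih W' hW'
    refine ⟨D, fun t ht x hx => ?_⟩
    rw [iteratedDeriv_succ', funext fun y => (hd t ht y).deriv]
    exact hD t ht x hx

/-- The slices of `w` are smooth in space, with derivatives of order `k + 1` bounded by `D`. -/
def SliceBound (k : ℕ) (a b T D : ℝ) (w : ℝ → ℝ → ℝ) : Prop :=
  ∀ t ∈ Icc 0 T, ContDiff ℝ (k + 1 : ℕ) (fun x => w x t) ∧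
    ∀ x ∈ Icc a b, |iteratedDeriv (k + 1) (fun y => w y t) x| ≤ D

lemma SliceBound.mono {k : ℕ} {a b T D D' : ℝ} {w : ℝ → ℝ → ℝ} (h : SliceBound k a b T D w)
    (hD : D ≤ D') : SliceBound k a b T D' w :=
  fun t ht => ⟨(h t ht).1, fun x hx => ((h t ht).2 x hx).trans hD⟩

lemma exists_sliceBound (hT : 0 < T) (a b : ℝ) (k n : ℕ) (hn : k + 1 ≤ n)
    (hW : ContDiffOn ℝ n (Function.uncurry W) (univ ×ˢ Icc 0 T)) :
    ∃ D, SliceBound k a b T D W := by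
  have h1 : ContDiffOn ℝ (k + 1 : ℕ) (Function.uncurry W) (univ ×ˢ Icc 0 T) :=
    hW.of_le (by exact_mod_cast hn)
  obtain ⟨D, hD⟩ := exists_iteratedDeriv_bound hT a b (k + 1) W h1
  exact ⟨D, fun t ht => ⟨contDiff_slice h1 ht, hD t ht⟩⟩

lemma iteratedDeriv_eq_zero_of_support {a b : ℝ} {w : ℝ → ℝ} (h : ∀ x ∉ Icc a b, w x = 0) (n : ℕ) :
    ∀ x ∉ Icc a b, iteratedDeriv n w x = 0 := by
  intro x hx
  have h1 : w =ᶠ[nhds x] fun _ => 0 :=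
    Filter.eventually_of_mem (isClosed_Icc.isOpen_compl.mem_nhds hx) h
  rw [h1.iteratedDeriv_eq n]
  simp [iteratedDeriv_fun_const_zero]

lemma Tame.of_continuous {a b : ℝ} {w : ℝ → ℝ} (hw : Continuous w) (h : ∀ x ∉ Icc a b, w x = 0) :
    Tame a b w := by
  obtain ⟨S, hS⟩ := (isCompact_Icc (a := a) (b := b)).exists_bound_of_continuousOn hw.continuousOn
  refine ⟨hw.measurable, ⟨max S 0, fun x => ?_⟩, h⟩
  by_cases hx : x ∈ Icc a b
  · exact (hS x hx).trans (le_max_left _ _)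
  · rw [h x hx]; simp

lemma rieszInt_const_mul (s c : ℝ) (w : ℝ → ℝ) (x : ℝ) :
    rieszInt s (fun y => c * w y) x = c * rieszInt s w x := by
  have h1 : ∀ y, (x - y) ^ (s - 1) * (c * w y) = c * ((x - y) ^ (s - 1) * w y) := fun y => by ring
  have h2 : ∀ y, (y - x) ^ (s - 1) * (c * w y) = c * ((y - x) ^ (s - 1) * w y) := fun y => by ring
  simp only [rieszInt, leftFracInt, rightFracInt, h1, h2, integral_const_mul]
  ring

/-- The data of an exact solution that enter the error analysis. -/
structure ExactData (k : ℕ) (s ε a b T : ℝ) (f f' : ℝ → ℝ) (g u u' v q q' : ℝ → ℝ → ℝ)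
    (B D : ℝ) : Prop where
  slice : ∀ t ∈ Ioo 0 T, ExactSlice s ε a b f f' (fun x => g x t) (fun x => u x t)
    (fun x => u' x t) (fun x => v x t) (fun x => q x t) (fun x => q' x t)
  continuous_u : ContinuousOn (Function.uncurry u) (univ ×ˢ Icc 0 T)
  continuous_v : ContinuousOn (Function.uncurry v) (univ ×ˢ Icc 0 T)
  time_deriv : ∀ t ∈ Ioo 0 T, ∀ x, HasDerivAt (fun τ => u x τ) (v x t) t
  bound_u : ∀ t ∈ Icc 0 T, ∀ x ∈ Icc a b, |u x t| ≤ B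
  bound_u' : ∀ t ∈ Icc 0 T, ∀ x ∈ Icc a b, |u' x t| ≤ B
  zero_left : ∀ t ∈ Icc 0 T, u a t = 0
  zero_right : ∀ t ∈ Icc 0 T, u b t = 0
  smooth_u : SliceBound k a b T D u
  smooth_v : SliceBound k a b T D v
  smooth_p : SliceBound k a b T D (fun x t => √ε * u' x t)
  smooth_q : SliceBound k a b T D q

theorem IsExactSolution.exists_exactData {k : ℕ} {α ε a b T : ℝ} {f f' : ℝ → ℝ}
    {g u : ℝ → ℝ → ℝ} {u₀ : ℝ → ℝ} (h1 : 1 < α) (h2 : α < 2) (hε : 0 < ε) (hT : 0 < T)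
    (hf : ∀ x, HasDerivAt f (f' x) x)
    (hu : IsExactSolution (k + 4) α ε a b T f g u₀ u) :
    ∃ (u' v q q' : ℝ → ℝ → ℝ) (B D : ℝ), 0 ≤ B ∧ 0 ≤ D ∧
      ExactData k (2 - α) ε a b T f f' g u u' v q q' B D := by
  have h0 : 0 < 2 - α := by linarith
  have hs1 : 2 - α < 1 := by linarith
  obtain ⟨u', hu', hdu⟩ := exists_space_deriv hT (n := k + 3) hu.smooth
  obtain ⟨v, hv, hdv⟩ := exists_time_deriv hT (n := k + 3) hu.smooth
  obtain ⟨u'', hu'', hdu'⟩ := exists_space_deriv hT (n := k + 2) hu'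
  obtain ⟨B₁, hB₁⟩ := exists_iteratedDeriv_bound hT a b 0 u (hu.smooth.of_le (by simp))
  obtain ⟨B₂, hB₂⟩ := exists_iteratedDeriv_bound hT a b 0 u' (hu'.of_le (by simp))
  obtain ⟨D₁, hD₁⟩ := exists_sliceBound hT a b k (k + 4) (by omega) hu.smooth
  obtain ⟨D₂, hD₂⟩ := exists_sliceBound hT a b k (k + 3) (by omega) hv
  have hp : ContDiffOn ℝ (k + 3 : ℕ) (Function.uncurry fun x t => √ε * u' x t)
    (univ ×ˢ Icc 0 T) := contDiffOn_const.mul hu'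
  obtain ⟨D₃, hD₃⟩ := exists_sliceBound hT a b k (k + 3) (by omega) hp
  have hu'0 : ∀ t ∈ Icc 0 T, ∀ x ∉ Icc a b, u' x t = 0 := fun t ht x hx => by
    have := iteratedDeriv_eq_zero_of_support (hu.support t ht) 1 x hx
    rwa [iteratedDeriv_one, (hdu t ht x).deriv] at this
  have hp0 : ∀ t ∈ Icc 0 T, ∀ x ∉ Icc a b, √ε * u' x t = 0 := fun t ht x hx => by
    rw [hu'0 t ht x hx, mul_zero]
  have hsup : ∀ t ∈ Icc 0 T, HasCompactSupport (fun x => √ε * u' x t) := fun t ht =>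
    HasCompactSupport.intro isCompact_Icc (hp0 t ht)
  set c := rieszConst (2 - α) * (max D₃ 0 * kerMass (2 - α) (b - a))
  have hq : SliceBound k a b T c (fun x t => rieszInt (2 - α) (fun y => √ε * u' y t) x) := by
    intro t ht
    have hpt : ContDiff ℝ (k + 1 + 1 : ℕ) (fun x => √ε * u' x t) :=
      contDiff_slice (hp.of_le (by exact_mod_cast (by omega : k + 1 + 1 ≤ k + 3))) ht
    obtain ⟨h3, h4⟩ := contDiff_rieszInt h0 (k + 1) hpt (hsup t ht)
    refine ⟨h3, fun x hx => ?_⟩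
    change |iteratedDeriv (k + 1) (rieszInt (2 - α) fun y => √ε * u' y t) x| ≤ c
    have hsupp := iteratedDeriv_eq_zero_of_support (hp0 t ht) (k + 1)
    have ht' : Tame a b (iteratedDeriv (k + 1) fun x => √ε * u' x t) :=
      Tame.of_continuous (hpt.continuous_iteratedDeriv (k + 1) (by norm_cast; omega)) hsupp
    rw [h4, ht'.rieszInt_eq h0, abs_mul, abs_of_pos (rieszConst_pos h0 hs1)]
    refine mul_le_mul_of_nonneg_left (ht'.abs_rieszPot_le h0 (fun y => ?_) hx)
      (rieszConst_pos h0 hs1).le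
    by_cases hy : y ∈ Icc a b
    · exact ((hD₃ t ht).2 y hy).trans (le_max_left _ _)
    · rw [hsupp y hy]; simp
  have hzero : ∀ t ∈ Icc 0 T, u a t = 0 ∧ u b t = 0 := by
    intro t ht
    have hcont : Continuous fun x => u x t := (contDiff_slice hu.smooth ht).continuous
    have hcl : IsClosed {y | u y t = 0} := isClosed_eq hcont continuous_const
    constructor
    · have h3 : a ∈ closure (Iio a) := by rw [closure_Iio]; exact self_mem_Iic
      exact closure_minimal (fun y hy => hu.support t ht y fun h => absurd h.1 (not_le.mpr hy)) hcl h3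
    · have h3 : b ∈ closure (Ioi b) := by rw [closure_Ioi]; exact self_mem_Ici
      exact closure_minimal (fun y hy => hu.support t ht y fun h => absurd h.2 (not_le.mpr hy)) hcl h3
  refine ⟨u', v, fun x t => rieszInt (2 - α) (fun y => √ε * u' y t) x,
    fun x t => rieszInt (2 - α) (fun y => √ε * u'' y t) x,
    max (max B₁ B₂) 0, max (max (max D₁ D₂) (max D₃ c)) 0, le_max_right _ _, le_max_right _ _,
    ?_⟩
  refine
    { slice := fun t ht => ?_
      continuous_u := hu.smooth.continuousOn
      continuous_v := hv.continuousOn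
      time_deriv := hdv
      bound_u := fun t ht x hx => by
        have := hB₁ t ht x hx
        rw [iteratedDeriv_zero] at this
        exact this.trans ((le_max_left _ _).trans (le_max_left _ _))
      bound_u' := fun t ht x hx => by
        have := hB₂ t ht x hx
        rw [iteratedDeriv_zero] at this
        exact this.trans ((le_max_right _ _).trans (le_max_left _ _))
      zero_left := fun t ht => (hzero t ht).1
      zero_right := fun t ht => (hzero t ht).2
      smooth_u := hD₁.mono (by simp)
      smooth_v := hD₂.mono (by simp)
      smooth_p := hD₃.mono (by simp)
      smooth_q := hq.mono (by simp) }
  have ht' : t ∈ Icc 0 T := ⟨ht.1.le, ht.2.le⟩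
  have hpt : ContDiff ℝ 1 (fun x => √ε * u' x t) :=
    contDiff_slice (hp.of_le (by norm_cast; omega)) ht'
  have hpd : deriv (fun x => √ε * u' x t) = fun x => √ε * u'' x t :=
    funext fun x => ((hdu' t ht' x).const_mul _).deriv
  have hu''c : Continuous fun x => u'' x t := (contDiff_slice hu'' ht').continuous
  have hu''s : ∀ x ∉ Icc a b, √ε * u'' x t = 0 := fun x hx => by
    have := iteratedDeriv_eq_zero_of_support (hp0 t ht') 1 x hx
    rwa [iteratedDeriv_one, hpd] at this
  refine
    { hasDerivAt_u := hdu t ht'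
      continuous_u' := (contDiff_slice hu' ht').continuous
      continuous_v := (contDiff_slice hv ht').continuous
      hasDerivAt_q := fun x => ?_
      continuous_q' := ?_
      tame := Tame.of_continuous hpt.continuous (hp0 t ht')
      q_eq := fun x => rfl
      left_zero := (hzero t ht').1
      right_zero := (hzero t ht').2
      equation := fun x hx => ?_ }
  · have := hasDerivAt_rieszInt h0 hpt (hsup t ht') x
    rw [hpd] at this
    exact this
  · have hc1 : ContDiff ℝ 1 (fun x => √ε * u'' x t) :=
      contDiff_const.mul (contDiff_slice (hu''.of_le (by norm_cast; omega)) ht')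
    exact continuous_rieszInt h0 hc1 (HasCompactSupport.intro isCompact_Icc hu''s)
  · have h3 := hu.equation t ht x hx
    have hdd : deriv (deriv fun y => u y t) = fun x => u'' x t := by
      rw [funext fun y => (hdu t ht' y).deriv]
      exact funext fun y => (hdu' t ht' y).deriv
    have hfu : HasDerivAt (fun y => f (u y t)) (f' (u x t) * u' x t) x :=
      (hf (u x t)).comp x (hdu t ht' x)
    rw [(hdv t ht x).deriv, hfu.deriv,
      negFracLap_eq h2 (contDiff_slice (hu.smooth.of_le (by norm_cast; omega)) ht')
        (HasCompactSupport.intro isCompact_Icc (hu.support t ht')), hdd] at h3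
    rw [h3, rieszInt_const_mul, ← mul_assoc, Real.mul_self_sqrt hε.le]

/-! ### Time derivatives -/

lemma continuousOn_integral_slice {W : ℝ → ℝ → ℝ} (hT : 0 ≤ T)
    (hW : ContinuousOn (Function.uncurry W) (univ ×ˢ Icc 0 T)) (l h : ℝ) (i : ℕ) :
    ContinuousOn (fun t => ∫ y in (0 : ℝ)..1, W (l + h * y) t * y ^ i) (Icc 0 T) := by
  have h1 : Continuous fun z : ℝ × ℝ => W (l + h * z.2) (projIcc 0 T hT z.1) * z.2 ^ i := by
    refine Continuous.mul ?_ (by fun_prop)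
    exact hW.comp_continuous (f := fun z : ℝ × ℝ => (l + h * z.2, (projIcc 0 T hT z.1 : ℝ)))
      ((by fun_prop : Continuous fun z : ℝ × ℝ => l + h * z.2).prodMk
        (continuous_subtype_val.comp (continuous_projIcc.comp continuous_fst)))
      fun z => ⟨mem_univ _, (projIcc 0 T hT z.1).2⟩
  have h2 : Continuous fun t => ∫ y in (0 : ℝ)..1, W (l + h * y) (projIcc 0 T hT t) * y ^ i :=
    intervalIntegral.continuous_parametric_intervalIntegral_of_continuous' h1 _ _
  refine h2.continuousOn.congr fun t ht => ?_
  simp only [projIcc_of_mem hT ht]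

lemma continuous_slice_of_continuousOn {W : ℝ → ℝ → ℝ}
    (hW : ContinuousOn (Function.uncurry W) (univ ×ˢ Icc 0 T)) {t : ℝ} (ht : t ∈ Icc 0 T) :
    Continuous fun x => W x t :=
  hW.comp_continuous (f := fun x : ℝ => (x, t)) (by fun_prop) fun x => ⟨mem_univ x, ht⟩

lemma hasDerivAt_integral_slice {W W' : ℝ → ℝ → ℝ}
    (hW : ContinuousOn (Function.uncurry W) (univ ×ˢ Icc 0 T))
    (hW' : ContinuousOn (Function.uncurry W') (univ ×ˢ Icc 0 T))
    (hd : ∀ t ∈ Ioo 0 T, ∀ x, HasDerivAt (fun τ => W x τ) (W' x t) t) (l h : ℝ) (i : ℕ) {t : ℝ}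
    (ht : t ∈ Ioo 0 T) :
    HasDerivAt (fun t => ∫ y in (0 : ℝ)..1, W (l + h * y) t * y ^ i)
      (∫ y in (0 : ℝ)..1, W' (l + h * y) t * y ^ i) t := by
  have hmem : ∀ τ ∈ Ioo 0 T, τ ∈ Icc 0 T := fun τ hτ => ⟨hτ.1.le, hτ.2.le⟩
  have hc : ∀ τ ∈ Ioo 0 T, Continuous fun y => W (l + h * y) τ * y ^ i := fun τ hτ =>
    ((continuous_slice_of_continuousOn hW (hmem τ hτ)).comp (by fun_prop)).mul (by fun_prop)
  have hc' : ∀ τ ∈ Ioo 0 T, Continuous fun y => W' (l + h * y) τ * y ^ i := fun τ hτ =>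
    ((continuous_slice_of_continuousOn hW' (hmem τ hτ)).comp (by fun_prop)).mul (by fun_prop)
  have hK : IsCompact (((fun y => l + h * y) '' Icc (0 : ℝ) 1) ×ˢ Icc 0 T) :=
    (isCompact_Icc.image (by fun_prop)).prod isCompact_Icc
  obtain ⟨S, hS⟩ := hK.exists_bound_of_continuousOn
    (hW'.mono (prod_mono (subset_univ _) subset_rfl))
  refine (intervalIntegral.hasDerivAt_integral_of_dominated_loc_of_deriv_le (s := Ioo 0 T)
    (F := fun τ y => W (l + h * y) τ * y ^ i) (F' := fun τ y => W' (l + h * y) τ * y ^ i)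
    (bound := fun _ => S)
    (isOpen_Ioo.mem_nhds ht) ?_ ((hc t ht).intervalIntegrable _ _)
    (hc' t ht).aestronglyMeasurable ?_ (by simp) ?_).2
  · exact Filter.eventually_of_mem (isOpen_Ioo.mem_nhds ht) fun τ hτ =>
      (hc τ hτ).aestronglyMeasurable
  · refine Filter.Eventually.of_forall fun y hy τ hτ => ?_
    rw [uIoc_of_le zero_le_one] at hy
    have h1 := hS (l + h * y, τ) ⟨⟨y, ⟨hy.1.le, hy.2⟩, rfl⟩, hmem τ hτ⟩
    rw [norm_mul, norm_pow, Real.norm_of_nonneg hy.1.le]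
    have h2 : y ^ i ≤ 1 := pow_le_one₀ hy.1.le hy.2
    calc _ ≤ ‖W' (l + h * y) τ‖ * 1 := by gcongr
      _ ≤ S := by rw [mul_one]; exact h1
  · exact Filter.Eventually.of_forall fun y _ τ hτ => (hd τ hτ _).mul_const _

lemma continuousOn_refMom {W : ℝ → ℝ → ℝ} (hT : 0 ≤ T)
    (hW : ContinuousOn (Function.uncurry W) (univ ×ˢ Icc 0 T)) (e : Option ℝ) (k i : ℕ) (l h : ℝ) :
    ContinuousOn (fun t => refMom e k i fun y => W (l + h * y) t) (Icc 0 T) := by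
  unfold refMom
  split_ifs
  · cases e with
    | none => exact continuousOn_integral_slice hT hW l h k
    | some c =>
      exact hW.comp (f := fun t : ℝ => (l + h * c, t)) (by fun_prop) fun t ht => ⟨mem_univ _, ht⟩
  · exact continuousOn_integral_slice hT hW l h i

lemma hasDerivAt_refMom {W W' : ℝ → ℝ → ℝ}
    (hW : ContinuousOn (Function.uncurry W) (univ ×ˢ Icc 0 T))
    (hW' : ContinuousOn (Function.uncurry W') (univ ×ˢ Icc 0 T))
    (hd : ∀ t ∈ Ioo 0 T, ∀ x, HasDerivAt (fun τ => W x τ) (W' x t) t) (e : Option ℝ) (k i : ℕ)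
    (l h : ℝ) {t : ℝ} (ht : t ∈ Ioo 0 T) :
    HasDerivAt (fun t => refMom e k i fun y => W (l + h * y) t)
      (refMom e k i fun y => W' (l + h * y) t) t := by
  unfold refMom
  split_ifs
  · cases e with
    | none => exact hasDerivAt_integral_slice hW hW' hd l h k ht
    | some c => exact hd t ht _
  · exact hasDerivAt_integral_slice hW hW' hd l h i ht

lemma continuousOn_eval_cellProj {W : ℝ → ℝ → ℝ} (hT : 0 ≤ T)
    (hW : ContinuousOn (Function.uncurry W) (univ ×ˢ Icc 0 T)) (e : Option ℝ) {k : ℕ}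
    (B : Fin (k + 1) → ℝ[X]) (l h x : ℝ) :
    ContinuousOn (fun t => (cellProj e B l h fun y => W y t).eval x) (Icc 0 T) := by
  simp only [eval_cellProj]
  exact continuousOn_finsetSum _ fun i _ => (continuousOn_refMom hT hW e k i l h).mul_const _

lemma hasDerivAt_eval_cellProj {W W' : ℝ → ℝ → ℝ}
    (hW : ContinuousOn (Function.uncurry W) (univ ×ˢ Icc 0 T))
    (hW' : ContinuousOn (Function.uncurry W') (univ ×ˢ Icc 0 T))
    (hd : ∀ t ∈ Ioo 0 T, ∀ x, HasDerivAt (fun τ => W x τ) (W' x t) t) (e : Option ℝ) {k : ℕ}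
    (B : Fin (k + 1) → ℝ[X]) (l h x : ℝ) {t : ℝ} (ht : t ∈ Ioo 0 T) :
    HasDerivAt (fun t => (cellProj e B l h fun y => W y t).eval x)
      ((cellProj e B l h fun y => W' y t).eval x) t := by
  simp only [eval_cellProj]
  exact HasDerivAt.fun_sum fun i _ => (hasDerivAt_refMom hW hW' hd e k i l h ht).mul_const _

/-- The inner product on an interval in terms of values at `k + 1` points. -/
lemma exists_integral_mul_eq (k : ℕ) (l r : ℝ) : ∃ G : Fin (k + 1) → Fin (k + 1) → ℝ,
    ∀ p q : ℝ[X], p.natDegree ≤ k → q.natDegree ≤ k →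
      ∫ x in l..r, p.eval x * q.eval x
        = ∑ i : Fin (k + 1), ∑ j : Fin (k + 1), p.eval (i : ℝ) * q.eval (j : ℝ) * G i j := by
  let v : Fin (k + 1) → ℝ := fun i => (i : ℝ)
  have hv : Set.InjOn v (Finset.univ : Finset (Fin (k + 1))) := fun i _ j _ hij =>
    Fin.ext (by
      have h : ((i : ℕ) : ℝ) = ((j : ℕ) : ℝ) := hij
      exact_mod_cast h)
  have hint : ∀ p : ℝ[X], p.natDegree ≤ k → ∀ x, p.eval x
      = ∑ i : Fin (k + 1), p.eval (i : ℝ) * (Lagrange.basis Finset.univ v i).eval x := by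
    intro p hp x
    have hd : p.degree < (Finset.univ : Finset (Fin (k + 1))).card := by
      rw [Finset.card_univ, Fintype.card_fin]
      exact (degree_le_natDegree).trans_lt (by exact_mod_cast Nat.lt_succ_iff.mpr hp)
    conv_lhs => rw [Lagrange.eq_interpolate hv hd]
    simp [Lagrange.interpolate_apply, eval_finsetSum, v]
  refine ⟨fun i j => ∫ x in l..r, (Lagrange.basis Finset.univ v i).eval x
    * (Lagrange.basis Finset.univ v j).eval x, fun p q hp hq => ?_⟩
  have h1 : ∀ x, p.eval x * q.eval x
      = ∑ i : Fin (k + 1), ∑ j : Fin (k + 1), p.eval (i : ℝ) * q.eval (j : ℝ)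
      * ((Lagrange.basis Finset.univ v i).eval x * (Lagrange.basis Finset.univ v j).eval x) := by
    intro x
    rw [hint p hp x, hint q hq x, Finset.sum_mul_sum]
    exact Finset.sum_congr rfl fun i _ => Finset.sum_congr rfl fun j _ => by ring
  simp only [h1]
  rw [intervalIntegral.integral_finsetSum fun i _ =>
    Continuous.intervalIntegrable (by fun_prop) _ _]
  refine Finset.sum_congr rfl fun i _ => ?_
  rw [intervalIntegral.integral_finsetSum fun j _ =>
    Continuous.intervalIntegrable (by fun_prop) _ _]
  simp only [intervalIntegral.integral_const_mul]

lemma hasDerivAt_integral_sq {k : ℕ} {p p' : ℝ → ℝ[X]} {t : ℝ} (l r : ℝ)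
    (hp : ∀ τ, (p τ).natDegree ≤ k) (hp' : (p' t).natDegree ≤ k)
    (hd : ∀ x, HasDerivAt (fun τ => (p τ).eval x) ((p' t).eval x) t) :
    HasDerivAt (fun τ => ∫ x in l..r, (p τ).eval x ^ 2)
      (2 * ∫ x in l..r, (p' t).eval x * (p t).eval x) t := by
  obtain ⟨G, hG⟩ := exists_integral_mul_eq k l r
  have h1 : ∀ τ, ∫ x in l..r, (p τ).eval x ^ 2
      = ∑ i : Fin (k + 1), ∑ j : Fin (k + 1), (p τ).eval (i : ℝ) * (p τ).eval (j : ℝ) * G i j :=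
    fun τ => by simp only [sq]; exact hG _ _ (hp τ) (hp τ)
  have h2 : 2 * ∫ x in l..r, (p' t).eval x * (p t).eval x
      = ∑ i : Fin (k + 1), ∑ j : Fin (k + 1),
        ((p' t).eval (i : ℝ) * (p t).eval (j : ℝ) + (p t).eval (i : ℝ) * (p' t).eval (j : ℝ))
          * G i j := by
    have h3 : ∫ x in l..r, (p t).eval x * (p' t).eval x = ∫ x in l..r, (p' t).eval x * (p t).eval x := by
      congr 1; ext x; ring
    rw [two_mul]
    nth_rewrite 2 [← h3]
    rw [hG _ _ hp' (hp t), hG _ _ (hp t) hp', ← Finset.sum_add_distrib]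
    refine Finset.sum_congr rfl fun i _ => ?_
    rw [← Finset.sum_add_distrib]
    exact Finset.sum_congr rfl fun j _ => by ring
  rw [h2]
  simp only [h1]
  exact HasDerivAt.fun_sum fun i _ => HasDerivAt.fun_sum fun j _ =>
    ((hd i).mul (hd j)).mul_const _

lemma continuousOn_integral_sq {k : ℕ} {p : ℝ → ℝ[X]} {S : Set ℝ} (l r : ℝ)
    (hp : ∀ τ, (p τ).natDegree ≤ k)
    (hc : ∀ x, ContinuousOn (fun τ => (p τ).eval x) S) :
    ContinuousOn (fun τ => ∫ x in l..r, (p τ).eval x ^ 2) S := by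
  obtain ⟨G, hG⟩ := exists_integral_mul_eq k l r
  have h1 : ∀ τ, ∫ x in l..r, (p τ).eval x ^ 2
      = ∑ i : Fin (k + 1), ∑ j : Fin (k + 1), (p τ).eval (i : ℝ) * (p τ).eval (j : ℝ) * G i j :=
    fun τ => by simp only [sq]; exact hG _ _ (hp τ) (hp τ)
  simp only [h1]
  exact continuousOn_finsetSum _ fun i _ => continuousOn_finsetSum _ fun j _ =>
    ((hc i).mul (hc j)).mul_const _

end
end LDG

namespace LDG
noncomputable section

/-! ### Constants of the nonlinearity -/

lemma exists_abs_sub_le_of_contDiff {φ : ℝ → ℝ} (hφ : ContDiff ℝ 1 φ) (R : ℝ) :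
    ∃ L : ℝ, 0 ≤ L ∧ ∀ x ∈ Icc (-R) R, ∀ y ∈ Icc (-R) R, |φ x - φ y| ≤ L * |x - y| := by
  obtain ⟨L, hL⟩ := (hφ.locallyLipschitz.locallyLipschitzOn
    (s := Icc (-R) R)).exists_lipschitzOnWith_of_compact isCompact_Icc
  exact ⟨L, L.2, fun x hx y hy => by simpa [Real.dist_eq] using hL.dist_le_mul x hx y hy⟩

lemma exists_convectionBounds {f : ℝ → ℝ} {F : ℝ → ℝ → ℝ} (hf : ContDiff ℝ 3 f)
    (hF : IsMonotoneFlux f F) (R : ℝ) :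
    ∃ L L' : ℝ, 0 ≤ L ∧ 0 ≤ L' ∧ ConvectionBounds f (deriv f) F R L L' := by
  have hf' : ContDiff ℝ 1 (deriv f) :=
    ((contDiff_succ_iff_deriv (n := 2)).mp hf).2.2.of_le (by norm_num)
  obtain ⟨L₁, h1, hL₁⟩ := exists_abs_sub_le_of_contDiff (hf.of_le (by norm_num)) R
  obtain ⟨L', h2, hL'⟩ := exists_abs_sub_le_of_contDiff hf' R
  obtain ⟨L₂, hL₂⟩ := (hF.lipschitz.locallyLipschitzOn
    (s := Icc (-R) R ×ˢ Icc (-R) R)).exists_lipschitzOnWith_of_compact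
    (isCompact_Icc.prod isCompact_Icc)
  refine ⟨max L₁ L₂, L', h1.trans (le_max_left _ _), h2, ⟨fun x hx y hy => ?_, hL',
    fun x hx y hy x' hx' y' hy' => ?_⟩⟩
  · exact (hL₁ x hx y hy).trans (mul_le_mul_of_nonneg_right (le_max_left _ _) (abs_nonneg _))
  · have := hL₂.dist_le_mul (x, y) ⟨hx, hy⟩ (x', y') ⟨hx', hy'⟩
    rw [Prod.dist_eq, Real.dist_eq, Real.dist_eq, Real.dist_eq] at this
    exact this.trans (mul_le_mul_of_nonneg_right (le_max_right _ _)
      ((abs_nonneg _).trans (le_max_left _ _)))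

/-! ### Projections on a mesh -/

variable {a b : ℝ} {k : ℕ}

/-- The projection on each cell. -/
def Mesh.proj (M : Mesh a b) (e : Option ℝ) (B : Fin (k + 1) → ℝ[X]) (w : ℝ → ℝ)
    (j : Fin M.K) : ℝ[X] :=
  cellProj e B (M.node j.castSucc) (M.width j) w

/-- The end of a cell at which the projection of `u` is exact. -/
def Direction.endpoint : Direction → ℝ
  | .minusPlus => 1
  | .plusMinus => 0

lemma Direction.endpoint_eq (d : Direction) : d.endpoint = 0 ∨ d.endpoint = 1 := by
  cases d <;> simp [Direction.endpoint]

lemma exists_proj_sub_le {e : Option ℝ} {B : Fin (k + 1) → ℝ[X]} (hB : IsDualBasis e k B)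
    (he : ∀ c, e = some c → c ∈ Icc (0 : ℝ) 1) (a b : ℝ) :
    ∃ K : ℝ, 0 < K ∧ ∀ (M : Mesh a b) (w : ℝ → ℝ) (D : ℝ), ContDiff ℝ (k + 1 : ℕ) w →
      (∀ x ∈ Icc a b, |iteratedDeriv (k + 1) w x| ≤ D) →
      ∀ j, ∀ x ∈ Icc (M.node j.castSucc) (M.node j.succ),
        |(M.proj e B w j).eval x - w x| ≤ K * (D * M.size ^ (k + 1)) := by
  obtain ⟨K, hK, h⟩ := hB.exists_abs_cellProj_sub_le he
  refine ⟨K, hK, fun M w D hw hD j x hx => ?_⟩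
  have hlt := M.node_lt j
  obtain ⟨p, hp, hpw⟩ := exists_taylor_poly hw hlt fun y hy => hD y (M.cell_subset j hy)
  have hD0 : 0 ≤ D := (abs_nonneg _).trans (hD x (M.cell_subset j hx))
  have h1 : M.width j ^ (k + 1) ≤ M.size ^ (k + 1) :=
    pow_le_pow_left₀ (M.width_pos j).le (M.width_le_size j) _
  refine h _ _ hlt w hw.continuous p hp _ (fun y hy => (hpw y hy).trans ?_) x hx
  exact mul_le_mul_of_nonneg_left h1 hD0

lemma comparison_proj (hk : 1 ≤ k) (M : Mesh a b) (d : Direction) {B B' : Fin (k + 1) → ℝ[X]}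
    (hB : IsDualBasis (some d.endpoint) k B) (hB' : IsDualBasis none k B') {u p : ℝ → ℝ}
    (hu : Continuous u) (hp : Continuous p) (ha : u a = 0) (hb : u b = 0) :
    Comparison M k d u p (M.proj (some d.endpoint) B u) (M.proj none B' p) where
  degree_V j := hB.natDegree_cellProj_le _ _ _
  degree_R j := hB'.natDegree_cellProj_le _ _ _
  orth_V j z hz := by
    refine hB.integral_cellProj (M.node_lt j) hu (Or.inl ?_)
    have := natDegree_derivative_le z
    omega
  orth_R j z hz := hB'.integral_cellProj (M.node_lt j) hp (Or.inr ⟨rfl, hz⟩)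
  uHat_V i := by
    cases d with
    | minusPlus =>
      simp only [uHat]
      split_ifs with hi
      · rw [hi, M.node_last, hb]
      · induction i using Fin.cases with
        | zero => rw [M.node_zero, ha, M.traceL_zero]
        | succ j =>
          have := hB.eval_cellProj_point (M.node_lt j) u
          simp only [Direction.endpoint, mul_one, add_sub_cancel] at this
          rw [M.traceL_succ]
          exact this
    | plusMinus =>
      simp only [uHat]
      split_ifs with hi
      · rw [hi, M.node_zero, ha]
      · induction i using Fin.lastCases with
        | last => rw [M.node_last, hb, M.traceR_last]
        | cast j =>
          have := hB.eval_cellProj_point (M.node_lt j) u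
          simp only [Direction.endpoint, mul_zero, add_zero] at this
          rw [M.traceR_castSucc]
          exact this
  pen_V := by
    cases d with
    | minusPlus =>
      simp only [penTrace]
      rcases Fin.eq_zero_or_eq_succ (Fin.last M.K) with h | ⟨j, h⟩
      · rw [h, M.traceL_zero]
      · have h1 : (M.proj (some 1) B u j).eval (M.node j.succ) = u (M.node j.succ) := by
          have := hB.eval_cellProj_point (M.node_lt j) u
          simp only [Direction.endpoint, mul_one, add_sub_cancel] at this
          exact this
        rw [← h, M.node_last, hb] at h1
        rw [h, M.traceL_succ, ← h, M.node_last]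
        exact h1
    | plusMinus =>
      simp only [penTrace]
      rcases Fin.eq_castSucc_or_eq_last (0 : Fin (M.K + 1)) with ⟨j, h⟩ | h
      · have h1 : (M.proj (some 0) B u j).eval (M.node j.castSucc) = u (M.node j.castSucc) := by
          have := hB.eval_cellProj_point (M.node_lt j) u
          simp only [Direction.endpoint, mul_zero, add_zero] at this
          exact this
        rw [← h, M.node_zero, ha] at h1
        rw [h, M.traceR_castSucc, ← h, M.node_zero]
        exact h1
      · rw [h, M.traceR_last]

/-! ### A barrier argument -/

lemma le_exp_barrier {E E' : ℝ → ℝ} {T A η μ : ℝ} (hA : 0 ≤ A) (hη : 0 < η)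
    (hμ : 2 * η * Real.exp ((2 * A + 1) * T) ≤ μ) (hc : ContinuousOn E (Icc 0 T))
    (hd : ∀ t ∈ Ioo 0 T, HasDerivAt E (E' t) t) (h0 : E 0 ≤ η)
    (hE : ∀ t ∈ Ioo 0 T, E t ≤ μ → E' t ≤ A * (E t + η)) :
    ∀ t ∈ Icc 0 T, E t ≤ 2 * η * Real.exp ((2 * A + 1) * T) := by
  set Φ : ℝ → ℝ := fun t => 2 * η * Real.exp ((2 * A + 1) * t) with hΦ
  have hmono : ∀ t ∈ Icc 0 T, Φ t ≤ 2 * η * Real.exp ((2 * A + 1) * T) := fun t ht => by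
    have := ht.2
    simp only [hΦ]
    gcongr
  have hΦη : ∀ t, 0 ≤ t → 2 * η ≤ Φ t := fun t ht => by
    have : 1 ≤ Real.exp ((2 * A + 1) * t) := Real.one_le_exp (by positivity)
    simp only [hΦ]
    nlinarith
  have hΦd : ∀ t, HasDerivAt Φ ((2 * A + 1) * Φ t) t := fun t => by
    have h1 : HasDerivAt (fun t => (2 * A + 1) * t) (2 * A + 1) t := by
      simpa using (hasDerivAt_id t).const_mul (2 * A + 1)
    refine (h1.exp.const_mul (2 * η)).congr_deriv ?_
    simp only [hΦ]; ring
  suffices h : ∀ t ∈ Icc 0 T, E t ≤ Φ t from fun t ht => (h t ht).trans (hmono t ht)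
  intro t ht
  rcases ht.1.eq_or_lt with rfl | ht0
  · linarith [hΦη 0 le_rfl]
  have hcΦ : ContinuousOn (fun τ => Φ τ - E τ) (Icc 0 T) :=
    (continuous_iff_continuousAt.mpr fun τ => (hΦd τ).continuousAt).continuousOn.sub hc
  have h1 : ∀ᶠ τ in nhdsWithin 0 (Icc 0 T), 0 < Φ τ - E τ :=
    (hcΦ 0 ⟨le_rfl, ht0.le.trans ht.2⟩).eventually (lt_mem_nhds (by linarith [hΦη 0 le_rfl]))
  have h2 : ∀ᶠ τ in nhdsWithin (0 : ℝ) (Ioi 0), 0 < Φ τ - E τ ∧ τ ∈ Ioo 0 t := by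
    refine Filter.Eventually.and ?_ (Ioo_mem_nhdsGT ht0)
    rw [← nhdsWithin_Ioo_eq_nhdsGT (ht0.trans_le ht.2)]
    exact h1.filter_mono (nhdsWithin_mono _ Ioo_subset_Icc_self)
  obtain ⟨τ, hτ, hτ0, hτt⟩ := h2.exists
  have hsub : ∀ y ∈ Ico τ T, y ∈ Ioo 0 T := fun y hy => ⟨hτ0.trans_le hy.1, hy.2⟩
  refine image_le_of_deriv_right_lt_deriv_boundary (f := E) (f' := E') (a := τ) (b := T)
    (hc.mono (Icc_subset_Icc_left hτ0.le)) (fun y hy => (hd y (hsub y hy)).hasDerivWithinAt)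
    (by linarith) hΦd (fun y hy hyE => ?_) ⟨hτt.le, ht.2⟩
  have hy := hsub y hy
  have h3 := hE y hy (hyE.le.trans ((hmono y ⟨hy.1.le, hy.2.le⟩).trans hμ))
  have h4 := hΦη y hy.1.le
  rw [hyE] at h3
  nlinarith

/-! ### The error in the mean-square norm -/

lemma sq_eval_mul_size_le {M : Mesh a b} {ρ K : ℝ} (hK : 0 < K)
    (hqu : ∀ j, M.size ≤ ρ * M.width j) {ξ : Fin M.K → ℝ[X]}
    (h : ∀ l r : ℝ, l < r → ∀ p : ℝ[X], p.natDegree ≤ k → ∀ x ∈ Icc l r,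
      p.eval x ^ 2 * (r - l) ≤ K * ∫ x in l..r, p.eval x ^ 2)
    (hρ : 0 < ρ) (hξ : ∀ j, (ξ j).natDegree ≤ k) (j : Fin M.K) {x : ℝ}
    (hx : x ∈ Icc (M.node j.castSucc) (M.node j.succ)) :
    (ξ j).eval x ^ 2 * M.size ≤ K * ρ * ∑ i, M.cellInt i (fun y => (ξ i).eval y ^ 2) := by
  have h0 : ∀ i, 0 ≤ M.cellInt i (fun y => (ξ i).eval y ^ 2) := fun i =>
    intervalIntegral.integral_nonneg (M.node_lt i).le fun y _ => sq_nonneg _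
  have h1 : (ξ j).eval x ^ 2 * M.width j ≤ K * M.cellInt j (fun y => (ξ j).eval y ^ 2) :=
    h _ _ (M.node_lt j) (ξ j) (hξ j) x hx
  have h2 : M.cellInt j (fun y => (ξ j).eval y ^ 2)
      ≤ ∑ i, M.cellInt i (fun y => (ξ i).eval y ^ 2) :=
    Finset.single_le_sum (f := fun i => M.cellInt i (fun y => (ξ i).eval y ^ 2))
      (fun i _ => h0 i) (Finset.mem_univ j)
  calc (ξ j).eval x ^ 2 * M.size ≤ (ξ j).eval x ^ 2 * (ρ * M.width j) :=
        mul_le_mul_of_nonneg_left (hqu j) (sq_nonneg _)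
    _ = ρ * ((ξ j).eval x ^ 2 * M.width j) := by ring
    _ ≤ ρ * (K * ∑ i, M.cellInt i (fun y => (ξ i).eval y ^ 2)) :=
        mul_le_mul_of_nonneg_left (h1.trans (mul_le_mul_of_nonneg_left h2 hK.le)) hρ.le
    _ = _ := by ring

lemma eLpNorm_sub_toFun_le (M : Mesh a b) {u : ℝ → ℝ} (hu : Continuous u) (U : Fin M.K → ℝ[X])
    {X : ℝ} (hX : 0 ≤ X)
    (h : ∑ j, M.cellInt j (fun x => (u x - (U j).eval x) ^ 2) ≤ X ^ 2) :
    eLpNorm (fun x => u x - M.toFun U x) 2 (volume.restrict (Icc a b)) ≤ ENNReal.ofReal X := by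
  obtain ⟨S, hS⟩ := isCompact_Icc.exists_bound_of_continuousOn (s := Icc a b) hu.continuousOn
  obtain ⟨S', hS'⟩ := (M.tame_toFun U).bounded
  have hmem : MemLp (fun x => u x - M.toFun U x) 2 (volume.restrict (Icc a b)) := by
    refine MemLp.of_bound (hu.measurable.sub (M.tame_toFun U).measurable).aestronglyMeasurable
      (S + S') ?_
    filter_upwards [ae_restrict_mem measurableSet_Icc] with x hx
    exact (norm_sub_le _ _).trans (add_le_add (hS x hx) (hS' x))
  have h1 : ∫ x in Icc a b, (u x - M.toFun U x) ^ 2 ≤ X ^ 2 := by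
    rw [← M.sum_cellInt hmem.integrable_sq]
    refine le_trans (le_of_eq (Finset.sum_congr rfl fun j _ => ?_)) h
    exact M.cellInt_congr fun x hx => by rw [M.toFun_of_mem U ⟨hx.1.le, hx.2⟩]
  rw [hmem.eLpNorm_eq_integral_rpow_norm (by norm_num) (by norm_num)]
  refine ENNReal.ofReal_le_ofReal ?_
  have h2 : ∀ x, ‖u x - M.toFun U x‖ ^ (2 : ENNReal).toReal = (u x - M.toFun U x) ^ 2 := fun x => by
    rw [ENNReal.toReal_ofNat, Real.rpow_two, Real.norm_eq_abs, sq_abs]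
  simp only [h2]
  rw [ENNReal.toReal_ofNat, ← one_div, ← Real.sqrt_eq_rpow]
  exact (Real.sqrt_le_sqrt h1).trans (Real.sqrt_sq hX).le

lemma sum_cellInt_sq_sub_le (M : Mesh a b) {u : ℝ → ℝ} (hu : Continuous u) {U V : Fin M.K → ℝ[X]}
    {δ : ℝ} (hV : ∀ j, ∀ x ∈ Icc (M.node j.castSucc) (M.node j.succ), |(V j).eval x - u x| ≤ δ) :
    ∑ j, M.cellInt j (fun x => (u x - (U j).eval x) ^ 2)
      ≤ 2 * ∑ j, M.cellInt j (fun x => (V j - U j).eval x ^ 2) + 2 * ((b - a) * δ ^ 2) := by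
  have h1 : ∀ j, M.cellInt j (fun x => (u x - (U j).eval x) ^ 2)
      ≤ 2 * M.cellInt j (fun x => (V j - U j).eval x ^ 2) + M.width j * (2 * δ ^ 2) := fun j => by
    rw [← cellInt_const, ← cellInt_const_mul, ← cellInt_add M j (by fun_prop) (by fun_prop)]
    refine cellInt_mono M (by fun_prop) (by fun_prop) fun x hx => ?_
    have h2 := sq_le_sq' (neg_le_of_abs_le (hV j x hx)) (le_of_abs_le (hV j x hx))
    rw [eval_sub]
    nlinarith [sq_nonneg ((V j).eval x - (U j).eval x + ((V j).eval x - u x))]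
  calc _ ≤ _ := Finset.sum_le_sum fun j _ => h1 j
    _ = _ := by rw [Finset.sum_add_distrib, ← Finset.mul_sum, ← Finset.sum_mul, sum_width]; ring

lemma initial_error_le (M : Mesh a b) {u : ℝ → ℝ} (hu : Continuous u) {U V : Fin M.K → ℝ[X]}
    {δ : ℝ} (hV : ∀ j, ∀ x ∈ Icc (M.node j.castSucc) (M.node j.succ), |(V j).eval x - u x| ≤ δ)
    (hU : ∀ j, M.cellInt j (fun x => (U j).eval x * (V j - U j).eval x)
      = M.cellInt j (fun x => u x * (V j - U j).eval x)) :
    ∑ j, M.cellInt j (fun x => (V j - U j).eval x ^ 2) ≤ (b - a) * δ ^ 2 := by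
  rw [← sum_width M, Finset.sum_mul]
  refine Finset.sum_le_sum fun j _ => ?_
  have h1 : M.cellInt j (fun x => (V j - U j).eval x ^ 2)
      = M.cellInt j (fun x => ((V j).eval x - u x) * (V j - U j).eval x) := by
    have e1 : (fun x => (V j - U j).eval x ^ 2) = fun x =>
        (V j).eval x * (V j - U j).eval x - (U j).eval x * (V j - U j).eval x := by
      ext x; rw [eval_sub]; ring
    have e2 : (fun x => ((V j).eval x - u x) * (V j - U j).eval x) = fun x =>
        (V j).eval x * (V j - U j).eval x - u x * (V j - U j).eval x := by
      ext x; ring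
    rw [e1, e2, cellInt_sub M j (by fun_prop) (by fun_prop),
      cellInt_sub M j (by fun_prop) (by fun_prop), hU]
  have h2 : M.cellInt j (fun x => ((V j).eval x - u x) * (V j - U j).eval x)
      ≤ M.cellInt j (fun x => 1 / 2 * (V j - U j).eval x ^ 2 + 1 / 2 * δ ^ 2) := by
    refine cellInt_mono M (by fun_prop) (by fun_prop) fun x hx => ?_
    have h2 := sq_le_sq' (neg_le_of_abs_le (hV j x hx)) (le_of_abs_le (hV j x hx))
    nlinarith [sq_nonneg ((V j).eval x - u x - (V j - U j).eval x)]
  rw [cellInt_add M j (by fun_prop) (by fun_prop), cellInt_const_mul, cellInt_const] at h2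
  linarith

lemma IsLDGSolution.schemeSlice {M : Mesh a b} {d : Direction} {α ε β T : ℝ}
    {f : ℝ → ℝ} {F : ℝ → ℝ → ℝ} {g : ℝ → ℝ → ℝ} {u₀ : ℝ → ℝ} {U U' P Q : ℝ → Fin M.K → ℝ[X]}
    (h : IsLDGSolution M k d α ε β T f F g u₀ U U' P Q) {t : ℝ} (ht : t ∈ Ioo 0 T) :
    SchemeSlice M k d (2 - α) ε β f F (fun x => g x t) (U t) (U' t) (P t) (Q t) :=
  ⟨h.degree_U t, h.degree_P t, h.degree_Q t, h.eq_u t ht, h.eq_q t ht, h.eq_p t ht⟩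

end
end LDG

namespace LDG
noncomputable section

variable {a b : ℝ} {k : ℕ}

/-- The constants of the error estimate depend on the exact solution only through its data. -/
theorem ExactData.exists_error_le (hk : 1 ≤ k) {s α ε β T ρ B D L L' : ℝ} {f f' : ℝ → ℝ}
    {F : ℝ → ℝ → ℝ} {g u u' v q q' : ℝ → ℝ → ℝ} {u₀ : ℝ → ℝ} (d : Direction)
    (hs : s = 2 - α) (h0 : 0 < s) (h1 : s < 1) (hε : 0 < ε) (hβ : 0 < β) (hab : a < b) (hρ : 0 < ρ)
    (hB : 0 ≤ B) (hD : 0 ≤ D) (hL : 0 ≤ L) (hL' : 0 ≤ L')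
    (hF : IsMonotoneFlux f F) (hf : ∀ x, HasDerivAt f (f' x) x) (hf' : Continuous f')
    (hb : ConvectionBounds f f' F (B + 2) L L')
    (hu : ExactData k s ε a b T f f' g u u' v q q' B D) (hu₀ : ∀ x, u x 0 = u₀ x) :
    ∃ C h₀ : ℝ, 0 < C ∧ 0 < h₀ ∧ ∀ M : Mesh a b, M.size < h₀ → (∀ j, M.size ≤ ρ * M.width j) →
      ∀ U U' P Q : ℝ → Fin M.K → ℝ[X], IsLDGSolution M k d α ε β T f F g u₀ U U' P Q →
        ∀ t ∈ Icc 0 T, eLpNorm (fun x => u x t - M.toFun (U t) x) 2 (volume.restrict (Icc a b))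
          ≤ ENNReal.ofReal (C * M.size ^ ((k : ℝ) + 1 / 2)) := by
  obtain ⟨Bu, hBu⟩ := exists_isDualBasis (e := some d.endpoint)
    (by rcases d.endpoint_eq with h | h <;> simp [h]) k
  obtain ⟨Bp, hBp⟩ := exists_isDualBasis (e := none) (Or.inl rfl) k
  obtain ⟨Ku, hKu, happu⟩ := exists_proj_sub_le hBu (fun c hc => by
    obtain rfl := Option.some.inj hc
    rcases d.endpoint_eq with h | h <;> simp [h]) a b
  obtain ⟨Kp, hKp, happp⟩ := exists_proj_sub_le hBp (by simp) a b
  obtain ⟨K, hK, henergy⟩ := exists_energy_le k h0 h1 hε hβ hab hρ hB hL hL' hF hf hf' hb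
  obtain ⟨Ki, hKi, hinv⟩ := exists_eval_sq_le k
  have hba : 0 < b - a := sub_pos.mpr hab
  set C₀ := (max Ku Kp) * (D + 1) with hC₀
  have hC₀0 : 0 < C₀ := mul_pos (hKu.trans_le (le_max_left _ _)) (by linarith)
  set c := C₀ ^ 2 * (1 + (b - a)) with hc
  have hc0 : 0 < c := by positivity
  set X := Real.exp ((2 * (2 * K) + 1) * T) with hX
  have hX0 : 0 < X := Real.exp_pos _
  have hX1 : 0 ≤ T → 1 ≤ X := fun hT => Real.one_le_exp (by positivity)
  set Y := 2 * c * X * (Ki * ρ) with hY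
  have hY0 : 0 < Y := by positivity
  refine ⟨√(6 * c * X), min (min 1 (1 / C₀)) (1 / Y), by positivity, by positivity, ?_⟩
  intro M hM hqu U U' P Q hS t ht
  have hT : 0 ≤ T := ht.1.trans ht.2
  have hh := M.size_pos hab
  obtain ⟨⟨hM1, hM2⟩, hM3⟩ : (M.size < 1 ∧ M.size < 1 / C₀) ∧ M.size < 1 / Y := by
    simpa only [lt_min_iff] using hM
  set h := M.size with hhdef
  rw [lt_div_iff₀ hC₀0] at hM2
  rw [lt_div_iff₀ hY0] at hM3
  set δ := C₀ * h ^ (k + 1) with hδ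
  have hδ0 : 0 ≤ δ := by positivity
  have hpow : h ^ (k + 1) ≤ h := pow_le_of_le_one hh.le hM1.le (by omega)
  have hδ1 : δ ≤ 1 := by nlinarith
  have happ : ∀ {e : Option ℝ} {W : Fin (k + 1) → ℝ[X]} {K' : ℝ}, 0 < K' → K' ≤ max Ku Kp →
      (∀ (M : Mesh a b) (w : ℝ → ℝ) (D : ℝ), ContDiff ℝ (k + 1 : ℕ) w →
      (∀ x ∈ Icc a b, |iteratedDeriv (k + 1) w x| ≤ D) →
      ∀ j, ∀ x ∈ Icc (M.node j.castSucc) (M.node j.succ),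
        |(M.proj e W w j).eval x - w x| ≤ K' * (D * M.size ^ (k + 1))) →
      ∀ w : ℝ → ℝ → ℝ, SliceBound k a b T D w → ∀ t ∈ Icc 0 T, ∀ j,
      ∀ x ∈ Icc (M.node j.castSucc) (M.node j.succ),
        |(M.proj e W (fun y => w y t) j).eval x - w x t| ≤ δ := by
    intro e W K' hK' hle hw w hwb t ht j x hx
    refine (hw M _ D (hwb t ht).1 (hwb t ht).2 j x hx).trans ?_
    rw [hδ, hC₀, ← hhdef, mul_assoc]
    gcongr
    linarith
  have hVu := happ hKu (le_max_left _ _) happu u hu.smooth_u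
  have hVv := happ hKu (le_max_left _ _) happu v hu.smooth_v
  have hVp := happ hKp (le_max_right _ _) happp _ hu.smooth_p
  have hVq := happ hKp (le_max_right _ _) happp q hu.smooth_q
  set V : ℝ → Fin M.K → ℝ[X] := fun t => M.proj (some d.endpoint) Bu (fun y => u y t) with hV
  set V' : ℝ → Fin M.K → ℝ[X] := fun t => M.proj (some d.endpoint) Bu (fun y => v y t) with hV'
  have hdegV : ∀ t j, (V t j).natDegree ≤ k := fun t j => hBu.natDegree_cellProj_le _ _ _
  have hdegV' : ∀ t j, (V' t j).natDegree ≤ k := fun t j => hBu.natDegree_cellProj_le _ _ _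
  have hdeg : ∀ t j, (V t j - U t j).natDegree ≤ k := fun t j =>
    (natDegree_sub_le _ _).trans (max_le (hdegV t j) (hS.degree_U t j))
  have hdeg' : ∀ t j, (V' t j - U' t j).natDegree ≤ k := fun t j =>
    (natDegree_sub_le _ _).trans (max_le (hdegV' t j) (hS.degree_U' t j))
  set E : ℝ → ℝ := fun t => ∑ j, M.cellInt j (fun x => (V t j - U t j).eval x ^ 2) with hE
  set E' : ℝ → ℝ := fun t => ∑ j, 2 * M.cellInt j
    (fun x => (V' t j - U' t j).eval x * (V t j - U t j).eval x) with hE'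
  have hEc : ContinuousOn E (Icc 0 T) := by
    refine continuousOn_finsetSum _ fun j _ => ?_
    refine continuousOn_integral_sq _ _ (fun τ => hdeg τ j) fun x => ?_
    simp only [eval_sub]
    exact (continuousOn_eval_cellProj hT hu.continuous_u _ _ _ _ _).sub (hS.continuousOn j x)
  have hEd : ∀ t ∈ Ioo 0 T, HasDerivAt E (E' t) t := by
    intro t ht
    refine HasDerivAt.fun_sum fun j _ => ?_
    refine hasDerivAt_integral_sq _ _ (fun τ => hdeg τ j)
      (p' := fun τ => V' τ j - U' τ j) (hdeg' t j) fun x => ?_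
    simp only [eval_sub]
    exact (hasDerivAt_eval_cellProj hu.continuous_u hu.continuous_v hu.time_deriv _ _ _ _ _ ht).sub
      (hS.hasDerivAt t ht j x)
  set η := c * h ^ (2 * k + 1) with hη
  have hη0 : 0 < η := by positivity
  have hδη : (b - a) * δ ^ 2 ≤ η := by
    have e1 : δ ^ 2 = C₀ ^ 2 * (h ^ (2 * k + 1) * h) := by rw [hδ]; ring
    have e2 : h ^ (2 * k + 1) * h ≤ h ^ (2 * k + 1) := mul_le_of_le_one_right (by positivity) hM1.le
    calc (b - a) * δ ^ 2 ≤ (b - a) * (C₀ ^ 2 * h ^ (2 * k + 1)) := by rw [e1]; gcongr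
      _ ≤ (1 + (b - a)) * (C₀ ^ 2 * h ^ (2 * k + 1)) := by gcongr; linarith
      _ = η := by rw [hη, hc]; ring
  have hδh : δ ^ 2 / h ≤ η := by
    have e1 : δ ^ 2 / h = C₀ ^ 2 * h ^ (2 * k + 1) * 1 := by rw [hδ]; field_simp; ring
    rw [e1, hη, hc, mul_right_comm (C₀ ^ 2)]
    gcongr
    linarith
  have hslice : ∀ τ ∈ Icc 0 T, Continuous fun x => u x τ := fun τ hτ =>
    (hu.smooth_u τ hτ).1.continuous
  have hE0 : E 0 ≤ η := by
    have h00 : (0 : ℝ) ∈ Icc 0 T := ⟨le_rfl, hT⟩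
    refine (initial_error_le M (hslice 0 h00) (hVu 0 h00) fun j => ?_).trans hδη
    have := hS.initial j _ (hdeg 0 j)
    simp only [← hu₀] at this
    exact sub_eq_zero.mp this
  have hEμ : 2 * η * X ≤ h / (Ki * ρ) := by
    rw [le_div_iff₀ (by positivity)]
    have e1 : h ^ (2 * k) ≤ h := pow_le_of_le_one hh.le hM1.le (by omega)
    calc 2 * η * X * (Ki * ρ) = Y * h ^ (2 * k) * h := by rw [hη, hY]; ring
      _ ≤ Y * h * h := by gcongr
      _ ≤ 1 * h := by gcongr; linarith
      _ = h := one_mul h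
  have hEb : ∀ t ∈ Icc 0 T, E t ≤ 2 * η * X := by
    refine le_exp_barrier (A := 2 * K) (by positivity) hη0 hEμ hEc hEd hE0 fun t ht hle => ?_
    have ht' : t ∈ Icc 0 T := ⟨ht.1.le, ht.2.le⟩
    have hξ : ∀ j, ∀ x ∈ Icc (M.node j.castSucc) (M.node j.succ), |(V t j - U t j).eval x| ≤ 1 := by
      intro j x hx
      have h3 := sq_eval_mul_size_le (M := M) hKi hqu hinv hρ (hdeg t) j hx
      have h4 : Ki * ρ * E t ≤ h := by
        have := (le_div_iff₀ (by positivity)).mp hle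
        linarith
      refine (sq_le_one_iff_abs_le_one _).mp (le_of_mul_le_mul_right ?_ hh)
      rw [one_mul]
      exact h3.trans h4
    have h5 := hu.slice t ht
    have hcmp : Comparison M k d (fun x => u x t) (fun x => √ε * u' x t) (V t)
        (M.proj none Bp fun x => √ε * u' x t) :=
      comparison_proj hk M d hBu hBp (hslice t ht') (continuous_const.mul h5.continuous_u')
        (hu.zero_left t ht') (hu.zero_right t ht')
    have h6 := henergy M d _ _ _ _ _ _ (U t) (U' t) (P t) (Q t) (V t) (V' t) _
      (M.proj none Bp fun x => q x t) δ hM1.le hqu h5 (by rw [hs]; exact hS.schemeSlice ht) hcmp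
      (fun j => hBp.natDegree_cellProj_le _ _ _) (hu.bound_u t ht') (hu.bound_u' t ht') hδ0 hδ1
      (hVu t ht') (hVv t ht') (hVp t ht') (hVq t ht') hξ
    calc E' t = 2 * ∑ j, M.cellInt j
          (fun x => (V' t j - U' t j).eval x * (V t j - U t j).eval x) := by
          simp only [hE', Finset.mul_sum]
      _ ≤ 2 * (K * (E t + δ ^ 2 / h)) := mul_le_mul_of_nonneg_left h6 zero_le_two
      _ ≤ 2 * (K * (E t + η)) := by gcongr
      _ = 2 * K * (E t + η) := by ring
  refine eLpNorm_sub_toFun_le M (hslice t ht) (U t) (by positivity) ?_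
  have h7 : (√(6 * c * X) * h ^ ((k : ℝ) + 1 / 2)) ^ 2 = 6 * η * X := by
    have h8 : (h ^ ((k : ℝ) + 1 / 2)) ^ 2 = h ^ (2 * k + 1) := by
      rw [← Real.rpow_natCast, ← Real.rpow_mul hh.le, ← Real.rpow_natCast]
      congr 1
      push_cast
      ring
    rw [mul_pow, Real.sq_sqrt (by positivity), h8, hη]; ring
  rw [h7]
  have h9 := sum_cellInt_sq_sub_le M (hslice t ht) (U := U t) (hVu t ht)
  have h10 := hEb t ht
  have h11 : η ≤ η * X := le_mul_of_one_le_right hη0.le (hX1 hT)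
  simp only [hE] at h10
  linarith

end
end LDG

theorem mainTheorem3 (k : ℕ) (hk : 1 ≤ k) :
    ∃ m : ℕ, ∀ (α ε β a b T ρ : ℝ), 1 < α → α < 2 → 0 < ε → 0 < β → a < b → 0 < T →
      ∀ (f : ℝ → ℝ) (F : ℝ → ℝ → ℝ) (g : ℝ → ℝ → ℝ) (u₀ : ℝ → ℝ) (u : ℝ → ℝ → ℝ)
        (d : LDG.Direction),
        ContDiff ℝ 3 f → LDG.IsMonotoneFlux f F →
        LDG.IsExactSolution m α ε a b T f g u₀ u →
        ∃ C h₀ : ℝ, 0 < C ∧ 0 < h₀ ∧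
          ∀ M : LDG.Mesh a b, M.size < h₀ → (∀ j, M.size ≤ ρ * M.width j) →
            ∀ U U' P Q : ℝ → Fin M.K → Polynomial ℝ,
              LDG.IsLDGSolution M k d α ε β T f F g u₀ U U' P Q →
              ∀ t ∈ Set.Icc 0 T,
                MeasureTheory.eLpNorm (fun x => u x t - M.toFun (U t) x) 2
                    (MeasureTheory.volume.restrict (Set.Icc a b))
                  ≤ ENNReal.ofReal (C * M.size ^ ((k : ℝ) + 1 / 2)) := by
  refine ⟨k + 4, fun α ε β a b T ρ h1 h2 hε hβ hab hT f F g u₀ u d hf hF hu => ?_⟩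
  rcases le_or_gt ρ 0 with hρ | hρ
  · refine ⟨1, 1, one_pos, one_pos, fun M _ hqu => ?_⟩
    have h3 := hqu ⟨0, M.K_pos hab⟩
    have h4 := mul_nonpos_of_nonpos_of_nonneg hρ (M.width_pos ⟨0, M.K_pos hab⟩).le
    exact absurd (M.size_pos hab) (by linarith)
  have hfd : ∀ x, HasDerivAt f (deriv f x) x := fun x =>
    (hf.differentiable (by norm_num) x).hasDerivAt
  obtain ⟨u', v, q, q', B, D, hB, hD, hdata⟩ := hu.exists_exactData h1 h2 hε hT hfd
  obtain ⟨L, L', hL, hL', hb⟩ := LDG.exists_convectionBounds hf hF (B + 2)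
  exact hdata.exists_error_le hk d rfl (by linarith) (by linarith) hε hβ hab hρ hB hD hL hL' hF hfd
    (hf.continuous_deriv (by norm_num)) hb hu.initial
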